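/- Let $n\ge 3$; all manifolds and maps are smooth, manifolds have no boundary, and hypersurfaces and surfaces are immersed. A hypersurface $M^n\to\mathbb R^{n+1}$ is of type number two if at each point its shape operator has exactly two nonzero eigenvalues $\nu_1,\nu_2$ (counted with multiplicity), the other $n-2$ eigenvalues being zero; $\Delta$ denotes the two-dimensional distribution on $M^n$ spanned by the eigenvectors with nonzero eigenvalues, and $K_0$ the class of those hypersurfaces of type number two for which $\Delta$ is involutive. Such a hypersurface is minimal if $\nu_1+\nu_2=0$. (1) If $M^n$ is a minimal hypersurface in the class $K_0$, then each connected integral surface of $\Delta$ is, as a surface in $\mathbb R^{n+1}$, a minimal surface in some three-dimensional affine subspace $\mathbb R^3\subset\mathbb R^{n+1}$ or in some sphere $S^3(r)$, $r>0$, of a four-dimensional affine subspace of $\mathbb R^{n+1}$. (2) Conversely, let $z\colon M^2\to\mathbb R^{n+1}$ be a surface without umbilical points which is a minimal surface in a three-dimensional affine subspace $\mathbb R^3\subset\mathbb R^{n+1}$, or in a sphere $S^3(r)$, with centre $a$ and radius $r>0$, of a four-dimensional affine subspace of $\mathbb R^{n+1}$. For $s\in M^2$ let $P(s)$ be the $(n-2)$-dimensional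 linear subspace of $\mathbb R^{n+1}$ orthogonal to the tangent plane of the surface at $s$ and to its unit normal in $\mathbb R^3$, respectively in $S^3(r)$. Then $P$ admits smooth fields of bases $b_1,\dots,b_{n-2}$ on $M^2$, and for each such field the map $$X(s;w)=z(s)+\sum_{\alpha=1}^{n-2}w^\alpha b_\alpha(s),\qquad s\in M^2,\ w\in\mathbb R^{n-2},$$ is, on the open set of its regular points (the points where its differential is injective), a minimal hypersurface of type number two in the class $K_0$, with the given surface ($w=0$) as an integral surface of its distribution $\Delta$. In the case of $\mathbb R^3$ every point is regular; in the case of $S^3(r)$ the regular points are exactly those with $\langle X(s;w)-a,\,z(s)-a\rangle\neq0$. -/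

import Mathlib

open scoped Manifold ContDiff

noncomputable section

namespace ConullityTwo

/-- The Euclidean space `ℝ^{n+1}`. -/
abbrev Amb (n : ℕ) : Type := EuclideanSpace ℝ (Fin (n + 1))

section Immersions

variable {B : Type*} [NormedAddCommGroup B] [NormedSpace ℝ B]
  {H : Type*} [TopologicalSpace H] (I : ModelWithCorners ℝ B H)
  {M : Type*} [TopologicalSpace M] [ChartedSpace H M]
  {E : Type*} [NormedAddCommGroup E] [InnerProductSpace ℝ E]

/-- The differential at `p` of an `E`-valued map on a manifold, with values in `E`. -/
def dif (f : M → E) (p : M) : TangentSpace I p →L[ℝ] E := mfderiv I 𝓘(ℝ, E) f p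

/-- The metric induced by `f` on the tangent space at `p` (first fundamental form). -/
def metric (f : M → E) (p : M) (v w : TangentSpace I p) : ℝ :=
  inner ℝ (dif I f p v) (dif I f p w)

/-- `f` is a smooth immersion on the open set `U`. -/
structure IsImmersionOn (f : M → E) (U : Set M) : Prop where
  isOpen : IsOpen U
  smooth : ContMDiffOn I 𝓘(ℝ, E) ∞ f U
  injective : ∀ p ∈ U, Function.Injective (dif I f p)

/-- `ξ` is a smooth unit normal field on the open set `V` of the immersion `f`, regarded as an
immersion into a submanifold `Q` of `E` whose tangent space at `x ∈ Q` is `T x`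
(`T x = ⊤` when `Q = E`). -/
structure IsUnitNormalOn (T : E → Submodule ℝ E) (f ξ : M → E) (V : Set M) : Prop where
  isOpen : IsOpen V
  smooth : ContMDiffOn I 𝓘(ℝ, E) ∞ ξ V
  norm_eq : ∀ q ∈ V, ‖ξ q‖ = 1
  mem : ∀ q ∈ V, ξ q ∈ T (f q)
  orthogonal : ∀ q ∈ V, ∀ v : TangentSpace I q, inner ℝ (dif I f q v) (ξ q) = 0

/-- `A` is the shape operator at `p`, in the ambient space with tangent spaces `T`, with respect to
some local unit normal field `ξ` around `p`: `A v` is minus the tangential part of `D_v ξ`.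
When the codimension in the ambient space is one, `A` exists and is unique up to sign. -/
def IsShapeOperator (T : E → Submodule ℝ E) (f : M → E) (p : M)
    (A : Module.End ℝ (TangentSpace I p)) : Prop :=
  ∃ (V : Set M) (ξ : M → E), p ∈ V ∧ IsUnitNormalOn I T f ξ V ∧
    ∀ v w : TangentSpace I p,
      metric I f p (A v) w = -inner ℝ (dif I ξ p v) (dif I f p w)

/-- Vanishing mean curvature on `U`: the shape operators have trace zero. -/
def IsMinimalOn (T : E → Submodule ℝ E) (f : M → E) (U : Set M) : Prop :=
  ∀ p ∈ U, ∃ A : Module.End ℝ (TangentSpace I p),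
    IsShapeOperator I T f p A ∧ LinearMap.trace ℝ (TangentSpace I p) A = 0

/-- The point `p` is umbilical: the shape operator is a multiple of the identity. -/
def IsUmbilical (T : E → Submodule ℝ E) (f : M → E) (p : M) : Prop :=
  ∃ (A : Module.End ℝ (TangentSpace I p)) (c : ℝ),
    IsShapeOperator I T f p A ∧ ∀ v, A v = c • v

/-- The distribution `Δ` of a hypersurface of `E`: at `p` it is spanned by the eigenvectors of the
shape operator with nonzero eigenvalues (the two choices of the unit normal give the same
vectors). -/
def distr (f : M → E) (p : M) : Submodule ℝ (TangentSpace I p) :=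
  Submodule.span ℝ {v | ∃ A : Module.End ℝ (TangentSpace I p),
    IsShapeOperator I (fun _ : E => ⊤) f p A ∧ ∃ μ : ℝ, μ ≠ 0 ∧ A v = μ • v}

/-- Type number two on `U`: at each point the shape operator has two nonzero eigenvalues
(counted with multiplicity) and vanishes on the orthogonal complement of the two unit
eigenvectors. -/
def IsTypeNumberTwoOn (f : M → E) (U : Set M) : Prop :=
  ∀ p ∈ U, ∃ A : Module.End ℝ (TangentSpace I p),
    IsShapeOperator I (fun _ : E => ⊤) f p A ∧
    ∃ (X Y : TangentSpace I p) (ν₁ ν₂ : ℝ),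
      metric I f p X X = 1 ∧ metric I f p Y Y = 1 ∧ metric I f p X Y = 0 ∧
      ν₁ ≠ 0 ∧ ν₂ ≠ 0 ∧ A X = ν₁ • X ∧ A Y = ν₂ • Y ∧
      ∀ x : TangentSpace I p, metric I f p x X = 0 → metric I f p x Y = 0 → A x = 0

/-- The distribution `D` is involutive on `U`: the Lie bracket of two smooth sections of `D` over
an open subset of `U` is again a section of `D`. -/
def IsInvolutiveOn [IsManifold I ∞ M] (D : ∀ p : M, Submodule ℝ (TangentSpace I p))
    (U : Set M) : Prop :=
  ∀ (O : Set M) (V W : ∀ p : M, TangentSpace I p), IsOpen O → O ⊆ U →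
    ContMDiffOn I I.tangent ∞ (fun p => (⟨p, V p⟩ : TangentBundle I M)) O →
    ContMDiffOn I I.tangent ∞ (fun p => (⟨p, W p⟩ : TangentBundle I M)) O →
    (∀ p ∈ O, V p ∈ D p) → (∀ p ∈ O, W p ∈ D p) →
    ∀ p ∈ O, VectorField.mlieBracket I V W p ∈ D p

/-- On the open set `U`, `f` is a minimal hypersurface of type number two in the class `K₀`, that
is, with involutive distribution `Δ`. -/
structure IsMinimalK0On [IsManifold I ∞ M] (f : M → E) (U : Set M) : Prop where
  immersion : IsImmersionOn I f U
  codim_one : Module.finrank ℝ B + 1 = Module.finrank ℝ E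
  type_two : IsTypeNumberTwoOn I f U
  involutive : IsInvolutiveOn I (distr I f) U
  minimal : IsMinimalOn I (fun _ : E => ⊤) f U

/-- `j` is an (immersed) integral surface, contained in `U`, of the distribution `D` on `M`. -/
structure IsIntegralSurface {S : Type*} [TopologicalSpace S]
    [ChartedSpace (EuclideanSpace ℝ (Fin 2)) S]
    (D : ∀ p : M, Submodule ℝ (TangentSpace I p)) (U : Set M) (j : S → M) : Prop where
  smooth : ContMDiff (𝓡 2) I ∞ j
  mem : ∀ s, j s ∈ U
  injective : ∀ s, Function.Injective (mfderiv (𝓡 2) I j s)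
  range_eq : ∀ s, LinearMap.range (mfderiv (𝓡 2) I j s).toLinearMap = D (j s)

end Immersions

section Surfaces

variable {E : Type*} [NormedAddCommGroup E] [InnerProductSpace ℝ E]
  {S : Type*} [TopologicalSpace S] [ChartedSpace (EuclideanSpace ℝ (Fin 2)) S]

/-- The tangent spaces of an affine subspace `F`. -/
def spaceTangent (F : AffineSubspace ℝ E) : E → Submodule ℝ E := fun _ => F.direction

/-- The tangent space at `x` of the sphere with centre `a` in the affine subspace `F`. -/
def sphereTangent (F : AffineSubspace ℝ E) (a : E) : E → Submodule ℝ E :=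
  fun x => F.direction ⊓ (Submodule.span ℝ {x - a})ᗮ

/-- `z` is a minimal surface in the three-dimensional affine subspace `F` (an `ℝ³`). -/
structure IsMinimalInSpace (F : AffineSubspace ℝ E) (z : S → E) : Prop where
  dim : Module.finrank ℝ F.direction = 3
  immersion : IsImmersionOn (𝓡 2) z Set.univ
  mem : ∀ s, z s ∈ F
  minimal : IsMinimalOn (𝓡 2) (spaceTangent F) z Set.univ

/-- `z` is a minimal surface in the sphere `S³(r)` with centre `a` and radius `r` in the
four-dimensional affine subspace `F`. -/
structure IsMinimalInSphere (F : AffineSubspace ℝ E) (a : E) (r : ℝ) (z : S → E) : Prop where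
  dim : Module.finrank ℝ F.direction = 4
  center_mem : a ∈ F
  radius_pos : 0 < r
  immersion : IsImmersionOn (𝓡 2) z Set.univ
  mem : ∀ s, z s ∈ F
  dist_eq : ∀ s, dist (z s) a = r
  minimal : IsMinimalOn (𝓡 2) (sphereTangent F a) z Set.univ

/-- The linear subspace orthogonal at `s` to the tangent plane of the surface `z` and to its unit
normal in the three-dimensional ambient space with tangent spaces `T`. -/
def normalPlane (T : E → Submodule ℝ E) (z : S → E) (s : S) : Submodule ℝ E :=
  (LinearMap.range (dif (𝓡 2) z s).toLinearMap ⊔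
    (T (z s) ⊓ (LinearMap.range (dif (𝓡 2) z s).toLinearMap)ᗮ))ᗮ

/-- `b` is a smooth field of bases `b_1(s), …, b_k(s)` of the planes `normalPlane T z s`. -/
structure IsNormalFrame {k : ℕ} (T : E → Submodule ℝ E) (z : S → E)
    (b : Fin k → S → E) : Prop where
  smooth : ∀ α, ContMDiff (𝓡 2) 𝓘(ℝ, E) ∞ (b α)
  linearIndependent : ∀ s, LinearIndependent ℝ (fun α => b α s)
  span_eq : ∀ s, Submodule.span ℝ (Set.range fun α => b α s) = normalPlane T z s

/-- The map `X(s; w) = z(s) + ∑ w^α b_α(s)`. -/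
def generated {k : ℕ} (z : S → E) (b : Fin k → S → E) :
    S × EuclideanSpace ℝ (Fin k) → E :=
  fun p => z p.1 + ∑ α, p.2 α • b α p.1

/-- The points at which `X(s; w) = z(s) + ∑ w^α b_α(s)` is regular. -/
def regularSet {k : ℕ} (z : S → E) (b : Fin k → S → E) :
    Set (S × EuclideanSpace ℝ (Fin k)) :=
  {p | Function.Injective (dif ((𝓡 2).prod (𝓡 k)) (generated z b) p)}

/-- By adding its normal planes, the surface `z` in the three-dimensional ambient space with tangent
spaces `T` generates a minimal hypersurface in `K₀`: for the frame `b`, the regular part of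
`X(s; w)` contains the surface `w = 0`, is minimal of type number two with involutive `Δ`, and the
given surface is an integral surface of `Δ`. -/
structure GeneratesMinimalK0 [IsManifold (𝓡 2) ∞ S] {k : ℕ} (z : S → E)
    (b : Fin k → S → E) : Prop where
  minimalK0 : IsMinimalK0On ((𝓡 2).prod (𝓡 k)) (generated z b) (regularSet z b)
  integral : IsIntegralSurface ((𝓡 2).prod (𝓡 k))
    (distr ((𝓡 2).prod (𝓡 k)) (generated z b)) (regularSet z b)
    (fun s : S => (s, (0 : EuclideanSpace ℝ (Fin k))))

end Surfaces

end ConullityTwo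

end

/-!
Write `Γ(y) ⊂ ℝ^{n+1}` for the image under `df` of the relative nullity of a minimal hypersurface
`f` of type number two, and let `R` be the orthogonal projection onto `Γ`.

*Leaves of `Δ`.* In a chart the shape operator is carried to `ℝ^{n+1}` as a symmetric operator `B`
that kills the normal `ξ`. Its two nonzero eigenvalues are `±√λ`, so `B³ = λ B`, an identity that
can be differentiated without choosing eigenvector fields, and `R = 1 - λ⁻¹ B² - ξ ⊗ ξ`
(`ShapeData`, `nullityProj`). Let `z` be a leaf of `Δ`. By the Codazzi equation, differentiating
`B³ = λ B` in a nullity direction shows that the component in `Γ` of the second fundamental form of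
`z` is a multiple of the metric (`LeafData.inner_proj_sndFDeriv`); call it `⟪·, ·⟫ K`. Along the
leaf `dR(a) = -(dz a ⊗ K + K ⊗ dz a)` (`LeafData.fderiv_proj`). Since second derivatives of `R`
commute and the leaf has dimension two, `dK = -|K|² dz` (`LeafData.fderiv_leafCurvature`), whence
`|K|` is constant. If `K = 0`, then `R` and `R z` are constant and the leaf lies in an `ℝ³` with
direction `Γᗮ`. If `K ≠ 0`, then `z + K / |K|²` and the part of `Γ` orthogonal to `K` are constant
and the leaf lies in an `S³(1 / |K|)`. The tensor `dR` determines `K`, so these constants, found in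
coordinate discs, agree over a connected leaf
(`IsIntegralSurface.isMinimalInSpace_or_isMinimalInSphere`). The shape operator of the leaf for the
normal `ξ` is the restriction of that of `f` to `Δ`, which has trace zero
(`IsIntegralSurface.isMinimalOn`).

*The converse.* In both cases the generated hypersurface has the form `X = a + μ (z - a) + q` with
`dX = μ dz + κ`, where `κ = dμ (z - a) + dq` is normal to the surface and vanishes only where both
`dμ` and `dq` do (`IsHomotheticForm`): over an `ℝ³` take `a = 0`, `μ = 1` and `q` orthogonal to the
`ℝ³`; over a sphere `μ = ⟪X - a, z - a⟫ / r²` and `q` is orthogonal to the `ℝ⁴`. Vectors in the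
direction of the rulings show that `κ` attains every normal vector, so `X` is regular exactly where
`μ ≠ 0`. There the unit normal `ξ` of `z` is also the unit normal of `X`, and the shape operator of
`X` is that of `z` multiplied by `μ⁻¹` and extended by zero along the rulings. At a point that is
not umbilical it has two opposite nonzero eigenvalues, and `Δ = ker κ = ker dμ ∩ ker dq`, which is
involutive because functions that are constant along two vector fields are constant along their
bracket (`dif_mlieBracket_eq_zero`).
-/

noncomputable section

namespace ConullityTwo

/-! ### Hypersurfaces of type number two in coordinates -/

section Calculus

variable {V W E G H : Type*} [NormedAddCommGroup V] [NormedSpace ℝ V]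
  [NormedAddCommGroup W] [NormedSpace ℝ W] [NormedAddCommGroup E] [InnerProductSpace ℝ E]
  [NormedAddCommGroup G] [NormedSpace ℝ G] [NormedAddCommGroup H] [NormedSpace ℝ H]

lemma fderiv_clm_apply_of_eventuallyEq {c : V → G →L[ℝ] H} {u : V → G} {w : V → H} {x : V}
    (hc : DifferentiableAt ℝ c x) (hu : DifferentiableAt ℝ u x)
    (h : (fun y => c y (u y)) =ᶠ[nhds x] w) (v : V) :
    c x (fderiv ℝ u x v) + fderiv ℝ c x v (u x) = fderiv ℝ w x v := by
  rw [← h.fderiv_eq, fderiv_clm_apply hc hu]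
  simp

lemma _root_.ContDiffAt.differentiableAt_of_infty {f : V → G} {x : V} (h : ContDiffAt ℝ ∞ f x) :
    DifferentiableAt ℝ f x :=
  h.differentiableAt (by simp)

lemma _root_.ContDiffAt.fderiv_infty {f : V → G} {x : V} (h : ContDiffAt ℝ ∞ f x) :
    ContDiffAt ℝ ∞ (fderiv ℝ f) x :=
  h.fderiv_right (by simp)

lemma _root_.ContDiffAt.fderiv_fderiv_comm {f : V → G} {x : V} (h : ContDiffAt ℝ ∞ f x) (v w : V) :
    fderiv ℝ (fderiv ℝ f) x v w = fderiv ℝ (fderiv ℝ f) x w v :=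
  h.isSymmSndFDerivAt (by
    rw [minSmoothness_of_isRCLikeNormedField]
    exact WithTop.coe_le_coe.2 le_top) v w

/-- A hypersurface `f` in a coordinate domain `U`, with unit normal `ξ`, whose shape operator is
carried to the ambient space as the symmetric operator `B y`, vanishing on `ξ y`. The identity
`B³ = λ B` with `λ ≠ 0` says that the nonzero eigenvalues are `± √λ`; it replaces both minimality
and the condition on the rank. -/
structure ShapeData (U : Set W) (f ξ : W → E) (B : W → E →L[ℝ] E) (lam : W → ℝ) : Prop where
  isOpen : IsOpen U
  f_smooth : ∀ y ∈ U, ContDiffAt ℝ ∞ f y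
  normal_smooth : ∀ y ∈ U, ContDiffAt ℝ ∞ ξ y
  B_smooth : ∀ y ∈ U, ContDiffAt ℝ ∞ B y
  lam_smooth : ∀ y ∈ U, ContDiffAt ℝ ∞ lam y
  lam_ne : ∀ y ∈ U, lam y ≠ 0
  fderiv_normal : ∀ y ∈ U, ∀ v, fderiv ℝ ξ y v = -B y (fderiv ℝ f y v)
  symm : ∀ y ∈ U, ∀ x x', inner ℝ (B y x) x' = inner ℝ x (B y x')
  cube : ∀ y ∈ U, ∀ x, B y (B y (B y x)) = lam y • B y x
  apply_normal : ∀ y ∈ U, B y (ξ y) = 0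
  norm_normal : ∀ y ∈ U, ‖ξ y‖ = 1
  exists_fderiv_eq : ∀ y ∈ U, ∀ x, B y x = 0 → inner ℝ x (ξ y) = (0 : ℝ) →
    ∃ t, fderiv ℝ f y t = x

/-- A leaf `J` of the distribution spanned by the eigenvectors of `B` with nonzero eigenvalues,
in coordinates. -/
structure LeafData (O : Set V) (J : V → W) (U : Set W) (f : W → E) (B : W → E →L[ℝ] E) :
    Prop where
  isOpen : IsOpen O
  smooth : ∀ s ∈ O, ContDiffAt ℝ ∞ J s
  mem : ∀ s ∈ O, J s ∈ U
  injective : ∀ s ∈ O, ∀ a, fderiv ℝ (fun t => f (J t)) s a = 0 → a = 0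
  range_eq : ∀ s ∈ O, ∀ x, (∃ a, fderiv ℝ (fun t => f (J t)) s a = x) ↔ ∃ y, B (J s) y = x

/-- The orthogonal projection onto the image of the relative nullity, that is, onto the
orthogonal complement of `ξ` in the kernel of `B`. -/
def nullityProj (ξ : W → E) (B : W → E →L[ℝ] E) (lam : W → ℝ) (y : W) : E →L[ℝ] E :=
  ContinuousLinearMap.id ℝ E - (lam y)⁻¹ • (B y ∘L B y) - InnerProductSpace.rankOne ℝ (ξ y) (ξ y)

omit [NormedAddCommGroup W] [NormedSpace ℝ W] in
lemma nullityProj_apply (ξ : W → E) (B : W → E →L[ℝ] E) (lam : W → ℝ) (y : W) (x : E) :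
    nullityProj ξ B lam y x = x - (lam y)⁻¹ • B y (B y x) - (inner ℝ (ξ y) x : ℝ) • ξ y := by
  simp [nullityProj]

namespace ShapeData

variable {U : Set W} {f ξ : W → E} {B : W → E →L[ℝ] E} {lam : W → ℝ} {y : W}
  (h : ShapeData U f ξ B lam)
include h

lemma inner_normal_apply (hy : y ∈ U) (x : E) : inner ℝ (ξ y) (B y x) = (0 : ℝ) := by
  rw [← h.symm y hy, h.apply_normal y hy, inner_zero_left]

lemma apply_nullityProj (hy : y ∈ U) (x : E) : B y (nullityProj ξ B lam y x) = 0 := by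
  simp [nullityProj_apply, h.cube y hy, h.apply_normal y hy, smul_smul,
    inv_mul_cancel₀ (h.lam_ne y hy)]

lemma inner_normal_nullityProj (hy : y ∈ U) (x : E) :
    inner ℝ (ξ y) (nullityProj ξ B lam y x) = (0 : ℝ) := by
  simp [nullityProj_apply, inner_sub_right, inner_smul_right, h.inner_normal_apply hy,
    h.norm_normal y hy]

lemma nullityProj_apply_B (hy : y ∈ U) (x : E) : nullityProj ξ B lam y (B y x) = 0 := by
  simp [nullityProj_apply, h.cube y hy, h.inner_normal_apply hy, smul_smul,
    inv_mul_cancel₀ (h.lam_ne y hy)]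

lemma nullityProj_normal (hy : y ∈ U) : nullityProj ξ B lam y (ξ y) = 0 := by
  simp [nullityProj_apply, h.apply_normal y hy, h.norm_normal y hy]

omit [NormedAddCommGroup W] [NormedSpace ℝ W] h in
lemma nullityProj_eq_self {x : E} (hx : B y x = 0)
    (hx' : inner ℝ (ξ y) x = (0 : ℝ)) : nullityProj ξ B lam y x = x := by
  simp [nullityProj_apply, hx, hx']

lemma nullityProj_idem (hy : y ∈ U) (x : E) :
    nullityProj ξ B lam y (nullityProj ξ B lam y x) = nullityProj ξ B lam y x :=
  nullityProj_eq_self (h.apply_nullityProj hy x) (h.inner_normal_nullityProj hy x)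

lemma nullityProj_symm (hy : y ∈ U) (x x' : E) :
    inner ℝ (nullityProj ξ B lam y x) x' = (inner ℝ x (nullityProj ξ B lam y x') : ℝ) := by
  simp only [nullityProj_apply, inner_sub_left, inner_sub_right, inner_smul_left,
    inner_smul_right, h.symm y hy, real_inner_comm (ξ y)]
  simp [mul_comm]

lemma nullityProj_smooth (hy : y ∈ U) : ContDiffAt ℝ ∞ (nullityProj ξ B lam) y := by
  unfold nullityProj
  refine (contDiffAt_const.sub (((h.lam_smooth y hy).inv (h.lam_ne y hy)).smul
    ((h.B_smooth y hy).clm_comp (h.B_smooth y hy)))).sub ?_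
  have h1 : ContDiffAt ℝ ∞ (fun y => (ContinuousLinearMap.smulRightL ℝ E E
    (innerSL ℝ (ξ y))) (ξ y)) y := by
    have := (innerSL ℝ (E := E)).contDiff (n := ∞) |>.contDiffAt.comp y (h.normal_smooth y hy)
    exact (((ContinuousLinearMap.smulRightL ℝ E E).contDiff.contDiffAt.comp y this)).clm_apply
      (h.normal_smooth y hy)
  refine h1.congr_of_eventuallyEq (Filter.Eventually.of_forall fun y => ?_)
  ext x
  simp

/-- The Codazzi equation. -/
lemma codazzi (hy : y ∈ U) (u v : W) :
    fderiv ℝ B y u (fderiv ℝ f y v) = fderiv ℝ B y v (fderiv ℝ f y u) := by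
  have key : ∀ u v, fderiv ℝ (fderiv ℝ ξ) y u v =
      -(B y (fderiv ℝ (fderiv ℝ f) y u v) + fderiv ℝ B y u (fderiv ℝ f y v)) := by
    intro u v
    have hd := (h.f_smooth y hy).fderiv_infty.differentiableAt_of_infty
    have hd' := (h.normal_smooth y hy).fderiv_infty.differentiableAt_of_infty
    have e : (fun y => B y (fderiv ℝ f y v)) =ᶠ[nhds y] fun y => -fderiv ℝ ξ y v := by
      filter_upwards [h.isOpen.mem_nhds hy] with y' hy'
      rw [h.fderiv_normal y' hy', neg_neg]
    have := fderiv_clm_apply_of_eventuallyEq (h.B_smooth y hy).differentiableAt_of_infty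
      (hd.clm_apply (differentiableAt_const v)) e u
    rw [fderiv_fun_neg, fderiv_clm_apply hd (differentiableAt_const v),
      fderiv_clm_apply hd' (differentiableAt_const v)] at this
    simp at this
    rw [this, neg_neg]
  have h1 := key u v
  rw [(h.normal_smooth y hy).fderiv_fderiv_comm, key v u,
    (h.f_smooth y hy).fderiv_fderiv_comm u v, neg_inj] at h1
  exact (add_left_cancel h1).symm

lemma fderiv_B_symm (hy : y ∈ U) (t : W) (x x' : E) :
    inner ℝ (fderiv ℝ B y t x) x' = (inner ℝ x (fderiv ℝ B y t x') : ℝ) := by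
  have hB := (h.B_smooth y hy).differentiableAt_of_infty
  have e : (fun y => (inner ℝ (B y x) x' : ℝ)) =ᶠ[nhds y] fun y => inner ℝ x (B y x') := by
    filter_upwards [h.isOpen.mem_nhds hy] with y' hy' using h.symm y' hy' x x'
  have := DFunLike.congr_fun (e.fderiv_eq (𝕜 := ℝ)) t
  rw [fderiv_inner_apply ℝ (hB.clm_apply (differentiableAt_const x)) (differentiableAt_const _),
    fderiv_inner_apply ℝ (differentiableAt_const _) (hB.clm_apply (differentiableAt_const x')),
    fderiv_clm_apply hB (differentiableAt_const x),
    fderiv_clm_apply hB (differentiableAt_const x')] at this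
  simpa using this

/-- The derivative of `B³ x = λ B x`. -/
lemma fderiv_cube (hy : y ∈ U) (t : W) (x : E) :
    B y (B y (fderiv ℝ B y t x)) + B y (fderiv ℝ B y t (B y x)) + fderiv ℝ B y t (B y (B y x)) =
      fderiv ℝ lam y t • B y x + lam y • fderiv ℝ B y t x := by
  have hB := (h.B_smooth y hy).differentiableAt_of_infty
  have hl := (h.lam_smooth y hy).differentiableAt_of_infty
  have d0 : DifferentiableAt ℝ (fun y => B y x) y := hB.clm_apply (differentiableAt_const x)
  have d1 : DifferentiableAt ℝ (fun y => B y (B y x)) y := hB.clm_apply d0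
  have e : (fun y => B y (B y (B y x))) =ᶠ[nhds y] fun y => lam y • B y x := by
    filter_upwards [h.isOpen.mem_nhds hy] with y' hy' using h.cube y' hy' x
  have := DFunLike.congr_fun (e.fderiv_eq (𝕜 := ℝ)) t
  rw [fderiv_clm_apply hB d1, fderiv_clm_apply hB d0, fderiv_fun_smul hl d0,
    fderiv_clm_apply hB (differentiableAt_const x)] at this
  simp at this
  rw [add_comm (fderiv ℝ lam y t • B y x), ← this]

/-- On the range of `B`, the derivative `Q` of `B` satisfies
`⟪Q (B x), y⟫ + ⟪Q x, B y⟫ = λ' ⟪x, y⟫`. -/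
lemma inner_fderiv_B (hy : y ∈ U) (t : W) (u v : E) :
    inner ℝ (fderiv ℝ B y t (B y (B y u))) (B y v) +
      (inner ℝ (fderiv ℝ B y t (B y u)) (B y (B y v)) : ℝ) =
      fderiv ℝ lam y t * inner ℝ (B y u) (B y v) := by
  set Q := fderiv ℝ B y t
  have hc := congrArg (fun w => (inner ℝ w (B y v) : ℝ)) (h.fderiv_cube hy t (B y (B y u)))
  have e1 : inner ℝ (B y (B y (Q (B y (B y u))))) (B y v) =
      lam y * (inner ℝ (Q (B y (B y u))) (B y v) : ℝ) := by
    rw [h.symm y hy, h.symm y hy, h.cube y hy, inner_smul_right]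
  have e2 : inner ℝ (B y (Q (B y (B y (B y u))))) (B y v) =
      lam y * (inner ℝ (Q (B y u)) (B y (B y v)) : ℝ) := by
    rw [h.symm y hy, h.cube y hy, map_smul, inner_smul_left, RCLike.conj_to_real]
  have e3 : inner ℝ (Q (B y (B y (B y (B y u))))) (B y v) =
      lam y * (inner ℝ (Q (B y (B y u))) (B y v) : ℝ) := by
    rw [h.cube y hy (B y u), map_smul, inner_smul_left, RCLike.conj_to_real]
  have e4 : inner ℝ (B y (B y (B y u))) (B y v) = lam y * (inner ℝ (B y u) (B y v) : ℝ) := by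
    rw [h.cube y hy, inner_smul_left, RCLike.conj_to_real]
  simp only [inner_add_left, inner_smul_left, RCLike.conj_to_real] at hc
  rw [e1, e2, e3, e4] at hc
  apply mul_left_cancel₀ (h.lam_ne y hy)
  linarith

end ShapeData

namespace LeafData

variable {U : Set W} {f ξ : W → E} {B : W → E →L[ℝ] E} {lam : W → ℝ} {O : Set V} {J : V → W}
  {s : V} (h : ShapeData U f ξ B lam) (hJ : LeafData O J U f B)
include h hJ

lemma surface_smooth (hs : s ∈ O) : ContDiffAt ℝ ∞ (fun t => f (J t)) s :=
  (h.f_smooth _ (hJ.mem s hs)).comp s (hJ.smooth s hs)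

lemma proj_smooth (hs : s ∈ O) : ContDiffAt ℝ ∞ (fun t => nullityProj ξ B lam (J t)) s :=
  (h.nullityProj_smooth (hJ.mem s hs)).comp s (hJ.smooth s hs)

lemma fderiv_surface (hs : s ∈ O) (a : V) :
    fderiv ℝ (fun t => f (J t)) s a = fderiv ℝ f (J s) (fderiv ℝ J s a) := by
  have := fderiv_comp s (h.f_smooth _ (hJ.mem s hs)).differentiableAt_of_infty
    (hJ.smooth s hs).differentiableAt_of_infty
  exact DFunLike.congr_fun this a

lemma fderiv_B_comp (hs : s ∈ O) (a : V) :
    fderiv ℝ (fun t => B (J t)) s a = fderiv ℝ B (J s) (fderiv ℝ J s a) := by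
  have := fderiv_comp s (h.B_smooth _ (hJ.mem s hs)).differentiableAt_of_infty
    (hJ.smooth s hs).differentiableAt_of_infty
  exact DFunLike.congr_fun this a

lemma fderiv_normal_comp (hs : s ∈ O) (a : V) :
    fderiv ℝ (fun t => ξ (J t)) s a = -B (J s) (fderiv ℝ (fun t => f (J t)) s a) := by
  have := fderiv_comp s (h.normal_smooth _ (hJ.mem s hs)).differentiableAt_of_infty
    (hJ.smooth s hs).differentiableAt_of_infty
  rw [fderiv_surface h hJ hs, ← h.fderiv_normal _ (hJ.mem s hs)]
  exact DFunLike.congr_fun this a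

lemma proj_fderiv (hs : s ∈ O) (a : V) :
    nullityProj ξ B lam (J s) (fderiv ℝ (fun t => f (J t)) s a) = 0 := by
  obtain ⟨x, hx⟩ := (hJ.range_eq s hs _).1 ⟨a, rfl⟩
  rw [← hx, h.nullityProj_apply_B (hJ.mem s hs)]

lemma B_fderiv_proj (hs : s ∈ O) (a : V) (x : E) :
    B (J s) (fderiv ℝ (fun t => nullityProj ξ B lam (J t)) s a x) =
      -fderiv ℝ B (J s) (fderiv ℝ J s a) (nullityProj ξ B lam (J s) x) := by
  have hR := (proj_smooth h hJ hs).differentiableAt_of_infty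
  have e : (fun t => B (J t) (nullityProj ξ B lam (J t) x)) =ᶠ[nhds s] fun _ => 0 := by
    filter_upwards [hJ.isOpen.mem_nhds hs] with t ht using h.apply_nullityProj (hJ.mem t ht) x
  have := fderiv_clm_apply_of_eventuallyEq
    (((h.B_smooth _ (hJ.mem s hs)).comp s (hJ.smooth s hs)).differentiableAt_of_infty)
    (hR.clm_apply (differentiableAt_const x)) e a
  rw [fderiv_clm_apply hR (differentiableAt_const x)] at this
  rw [← fderiv_B_comp h hJ hs, ← add_eq_zero_iff_eq_neg]
  simpa using! this

lemma fderiv_proj_fderiv (hs : s ∈ O) (a b : V) :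
    fderiv ℝ (fun t => nullityProj ξ B lam (J t)) s a (fderiv ℝ (fun t => f (J t)) s b) =
      -nullityProj ξ B lam (J s) (fderiv ℝ (fderiv ℝ (fun t => f (J t))) s a b) := by
  have hz := (surface_smooth h hJ hs).fderiv_infty.differentiableAt_of_infty
  have e : (fun t => nullityProj ξ B lam (J t) (fderiv ℝ (fun t => f (J t)) t b)) =ᶠ[nhds s]
      fun _ => 0 := by
    filter_upwards [hJ.isOpen.mem_nhds hs] with t ht using proj_fderiv h hJ ht b
  have := fderiv_clm_apply_of_eventuallyEq (proj_smooth h hJ hs).differentiableAt_of_infty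
    (hz.clm_apply (differentiableAt_const b)) e a
  rw [fderiv_clm_apply hz (differentiableAt_const b)] at this
  rw [← add_eq_zero_iff_eq_neg, add_comm]
  simpa using this

lemma fderiv_proj_normal (hs : s ∈ O) (a : V) :
    fderiv ℝ (fun t => nullityProj ξ B lam (J t)) s a (ξ (J s)) = 0 := by
  have e : (fun t => nullityProj ξ B lam (J t) (ξ (J t))) =ᶠ[nhds s] fun _ => 0 := by
    filter_upwards [hJ.isOpen.mem_nhds hs] with t ht using h.nullityProj_normal (hJ.mem t ht)
  have := fderiv_clm_apply_of_eventuallyEq (proj_smooth h hJ hs).differentiableAt_of_infty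
    (((h.normal_smooth _ (hJ.mem s hs)).comp s (hJ.smooth s hs)).differentiableAt_of_infty) e a
  change nullityProj ξ B lam (J s) (fderiv ℝ (fun t => ξ (J t)) s a) + _ = _ at this
  rw [fderiv_normal_comp h hJ hs, map_neg, h.nullityProj_apply_B (hJ.mem s hs)] at this
  simpa using! this

lemma proj_fderiv_proj (hs : s ∈ O) (a : V) (x : E) :
    nullityProj ξ B lam (J s) (fderiv ℝ (fun t => nullityProj ξ B lam (J t)) s a
      (nullityProj ξ B lam (J s) x)) = 0 := by
  have hR := (proj_smooth h hJ hs).differentiableAt_of_infty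
  have e : (fun t => nullityProj ξ B lam (J t) (nullityProj ξ B lam (J t) x)) =ᶠ[nhds s]
      fun t => nullityProj ξ B lam (J t) x := by
    filter_upwards [hJ.isOpen.mem_nhds hs] with t ht using h.nullityProj_idem (hJ.mem t ht) x
  have := fderiv_clm_apply_of_eventuallyEq hR (hR.clm_apply (differentiableAt_const x)) e a
  rw [fderiv_clm_apply hR (differentiableAt_const x)] at this
  have := congrArg (nullityProj ξ B lam (J s)) this
  simpa [h.nullityProj_idem (hJ.mem s hs)] using this

lemma fderiv_proj_symm (hs : s ∈ O) (a : V) (x x' : E) :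
    inner ℝ (fderiv ℝ (fun t => nullityProj ξ B lam (J t)) s a x) x' =
      (inner ℝ x (fderiv ℝ (fun t => nullityProj ξ B lam (J t)) s a x') : ℝ) := by
  have hR := (proj_smooth h hJ hs).differentiableAt_of_infty
  have e : (fun t => (inner ℝ (nullityProj ξ B lam (J t) x) x' : ℝ)) =ᶠ[nhds s]
      fun t => inner ℝ x (nullityProj ξ B lam (J t) x') := by
    filter_upwards [hJ.isOpen.mem_nhds hs] with t ht using h.nullityProj_symm (hJ.mem t ht) x x'
  have := DFunLike.congr_fun (e.fderiv_eq (𝕜 := ℝ)) a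
  rw [fderiv_inner_apply ℝ (hR.clm_apply (differentiableAt_const x)) (differentiableAt_const _),
    fderiv_inner_apply ℝ (differentiableAt_const _) (hR.clm_apply (differentiableAt_const x')),
    fderiv_clm_apply hR (differentiableAt_const x),
    fderiv_clm_apply hR (differentiableAt_const x')] at this
  simpa using this

/-- The second fundamental form of a leaf in the direction of the relative nullity is a multiple
of the metric. -/
lemma inner_proj_sndFDeriv (hs : s ∈ O) (x : E) : ∃ c : ℝ, ∀ a b : V,
    inner ℝ (nullityProj ξ B lam (J s) x) (fderiv ℝ (fderiv ℝ (fun t => f (J t))) s a b) =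
      c * inner ℝ (fderiv ℝ (fun t => f (J t)) s a) (fderiv ℝ (fun t => f (J t)) s b) := by
  have hy := hJ.mem s hs
  obtain ⟨t, ht⟩ := h.exists_fderiv_eq _ hy (nullityProj ξ B lam (J s) x)
    (h.apply_nullityProj hy x) (by rw [real_inner_comm]; exact h.inner_normal_nullityProj hy x)
  -- `q`: the derivative of `B` in the direction of the nullity, expressed by Codazzi
  have hq : ∀ a (y : E), inner ℝ (fderiv ℝ B (J s) t (fderiv ℝ (fun t => f (J t)) s a)) y =
      -(inner ℝ (fderiv ℝ (fun t => nullityProj ξ B lam (J t)) s a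
        (nullityProj ξ B lam (J s) x)) (B (J s) y) : ℝ) := by
    intro a y
    rw [fderiv_surface h hJ hs, h.codazzi hy, ht, ← h.symm _ hy, B_fderiv_proj h hJ hs,
      h.nullityProj_idem hy, inner_neg_left, neg_neg]
  have hm : ∀ a b, (inner ℝ (fderiv ℝ (fun t => nullityProj ξ B lam (J t)) s a
        (nullityProj ξ B lam (J s) x)) (fderiv ℝ (fun t => f (J t)) s b) : ℝ) =
      -inner ℝ (nullityProj ξ B lam (J s) x)
        (fderiv ℝ (fderiv ℝ (fun t => f (J t))) s a b) := by
    intro a b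
    rw [fderiv_proj_symm h hJ hs, fderiv_proj_fderiv h hJ hs, inner_neg_right,
      ← h.nullityProj_symm hy, h.nullityProj_idem hy]
  refine ⟨fderiv ℝ lam (J s) t / (2 * lam (J s)), fun a b => ?_⟩
  obtain ⟨u, hu⟩ := (hJ.range_eq s hs _).1 ⟨a, rfl⟩
  obtain ⟨v, hv⟩ := (hJ.range_eq s hs _).1 ⟨b, rfl⟩
  have key := h.inner_fderiv_B hy t u v
  have e : ∀ a b v, B (J s) v = fderiv ℝ (fun t => f (J t)) s b →
      inner ℝ (fderiv ℝ B (J s) t (fderiv ℝ (fun t => f (J t)) s a))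
        (B (J s) (fderiv ℝ (fun t => f (J t)) s b)) =
      lam (J s) * (inner ℝ (nullityProj ξ B lam (J s) x)
        (fderiv ℝ (fderiv ℝ (fun t => f (J t))) s a b) : ℝ) := by
    intro a b v hv
    rw [hq, ← hv, h.cube _ hy, hv, inner_smul_right, hm]
    ring
  rw [h.fderiv_B_symm hy, real_inner_comm, hu, hv, e a b v hv, e b a u hu,
    (surface_smooth h hJ hs).fderiv_fderiv_comm b a] at key
  field_simp [h.lam_ne _ hy]
  linarith

end LeafData

end Calculus

/-! ### The curvature vector of a leaf -/

section LeafCurvature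

variable {V W E : Type*} [NormedAddCommGroup V] [NormedSpace ℝ V]
  [NormedAddCommGroup W] [NormedSpace ℝ W] [NormedAddCommGroup E] [InnerProductSpace ℝ E]

/-- The normal curvature vector of the leaf: the component of its mean curvature vector in the
relative nullity, computed from the second derivative in the direction `e`. -/
def leafCurvature (f ξ : W → E) (B : W → E →L[ℝ] E) (lam : W → ℝ) (J : V → W) (e s : V) : E :=
  (inner ℝ (fderiv ℝ (fun t => f (J t)) s e) (fderiv ℝ (fun t => f (J t)) s e) : ℝ)⁻¹ •
    nullityProj ξ B lam (J s) (fderiv ℝ (fderiv ℝ (fun t => f (J t))) s e e)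

namespace LeafData

variable {U : Set W} {f ξ : W → E} {B : W → E →L[ℝ] E} {lam : W → ℝ} {O : Set V} {J : V → W}
  {s : V} (h : ShapeData U f ξ B lam) (hJ : LeafData O J U f B) {e : V} (he : e ≠ 0)
include h hJ

omit h in
lemma inner_fderiv_self_ne (hs : s ∈ O) {a : V} (ha : a ≠ 0) :
    (inner ℝ (fderiv ℝ (fun t => f (J t)) s a) (fderiv ℝ (fun t => f (J t)) s a) : ℝ) ≠ 0 :=
  fun h0 => ha (hJ.injective s hs a (inner_self_eq_zero.1 h0))

lemma proj_leafCurvature (hs : s ∈ O) : nullityProj ξ B lam (J s)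
    (leafCurvature f ξ B lam J e s) = leafCurvature f ξ B lam J e s := by
  rw [leafCurvature, map_smul, h.nullityProj_idem (hJ.mem s hs)]

lemma inner_fderiv_leafCurvature (hs : s ∈ O) (a : V) :
    inner ℝ (leafCurvature f ξ B lam J e s) (fderiv ℝ (fun t => f (J t)) s a) = (0 : ℝ) := by
  rw [← proj_leafCurvature h hJ hs, h.nullityProj_symm (hJ.mem s hs), proj_fderiv h hJ hs,
    inner_zero_right]

lemma inner_normal_leafCurvature (hs : s ∈ O) :
    inner ℝ (ξ (J s)) (leafCurvature f ξ B lam J e s) = (0 : ℝ) := by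
  rw [← proj_leafCurvature h hJ hs, h.inner_normal_nullityProj (hJ.mem s hs)]

include he in
lemma leafCurvature_smooth (hs : s ∈ O) : ContDiffAt ℝ ∞ (leafCurvature f ξ B lam J e) s := by
  have h1 := ((surface_smooth h hJ hs).fderiv_infty).clm_apply (contDiffAt_const (c := e))
  have h2 := ((surface_smooth h hJ hs).fderiv_infty).fderiv_infty.clm_apply
    (contDiffAt_const (c := e)) |>.clm_apply (contDiffAt_const (c := e))
  exact ((h1.inner ℝ h1).inv (inner_fderiv_self_ne hJ hs he)).smul
    ((proj_smooth h hJ hs).clm_apply h2)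

include he in
lemma proj_sndFDeriv (hs : s ∈ O) (a b : V) :
    nullityProj ξ B lam (J s) (fderiv ℝ (fderiv ℝ (fun t => f (J t))) s a b) =
      (inner ℝ (fderiv ℝ (fun t => f (J t)) s a) (fderiv ℝ (fun t => f (J t)) s b) : ℝ) •
        leafCurvature f ξ B lam J e s := by
  have hy := hJ.mem s hs
  have hne := inner_fderiv_self_ne hJ hs he
  refine ext_inner_left ℝ fun x => ?_
  obtain ⟨c, hc⟩ := inner_proj_sndFDeriv h hJ hs x
  rw [inner_smul_right, leafCurvature, inner_smul_right, ← h.nullityProj_symm hy,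
    ← h.nullityProj_symm hy, hc, hc]
  field_simp

include he in
/-- Along a leaf the projection onto the nullity has derivative `-(dz a ⊗ H + H ⊗ dz a)`, where
`H` is the curvature vector. -/
lemma fderiv_proj (hs : s ∈ O) (a : V) (x : E) :
    fderiv ℝ (fun t => nullityProj ξ B lam (J t)) s a x =
      -((inner ℝ (leafCurvature f ξ B lam J e s) x : ℝ) • fderiv ℝ (fun t => f (J t)) s a +
        (inner ℝ (fderiv ℝ (fun t => f (J t)) s a) x : ℝ) • leafCurvature f ξ B lam J e s) := by
  have hy := hJ.mem s hs
  set K := leafCurvature f ξ B lam J e s with hK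
  set D := fderiv ℝ (fun t => nullityProj ξ B lam (J t)) s a with hD
  set da := fderiv ℝ (fun t => f (J t)) s a with hda
  set R := nullityProj ξ B lam (J s) with hR
  have hRK : R K = K := proj_leafCurvature h hJ hs
  have hRa : R da = 0 := proj_fderiv h hJ hs a
  -- the difference of both sides is a symmetric operator `T` with kernel containing the tangent
  -- plane and the normal, and with `R T R = 0`
  let T : E → E := fun x => D x + ((inner ℝ K x : ℝ) • da + (inner ℝ da x : ℝ) • K)
  have hT : ∀ x, T x = D x + ((inner ℝ K x : ℝ) • da + (inner ℝ da x : ℝ) • K) := fun _ => rfl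
  have hTadd : ∀ x y, T (x + y) = T x + T y := by
    intro x y; simp only [hT, map_add, inner_add_right, add_smul]; abel
  have hTsmul : ∀ (c : ℝ) x, T (c • x) = c • T x := by
    intro c x; simp only [hT, map_smul, inner_smul_right, smul_add, smul_smul]
  have hTsymm : ∀ x y, inner ℝ (T x) y = (inner ℝ x (T y) : ℝ) := by
    intro x y
    simp only [hT, inner_add_left, inner_add_right, inner_smul_left, inner_smul_right,
      hD, fderiv_proj_symm h hJ hs, RCLike.conj_to_real, real_inner_comm x]
    ring
  have hTtan : ∀ y, T (B (J s) y) = 0 := by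
    intro y
    obtain ⟨b, hb⟩ := (hJ.range_eq s hs _).2 ⟨y, rfl⟩
    rw [hT, ← hb, hD, fderiv_proj_fderiv h hJ hs, proj_sndFDeriv h hJ he hs,
      inner_fderiv_leafCurvature h hJ hs]
    simp [hK, hda]
  have hTnor : T (ξ (J s)) = 0 := by
    obtain ⟨y, hy'⟩ := (hJ.range_eq s hs _).1 ⟨a, rfl⟩
    rw [hT, hD, fderiv_proj_normal h hJ hs, hda, ← hy', real_inner_comm,
      inner_normal_leafCurvature h hJ hs, real_inner_comm, h.inner_normal_apply hy]
    simp
  have hRTR : ∀ x, R (T (R x)) = 0 := by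
    intro x
    have : inner ℝ da (R x) = (0 : ℝ) := by
      rw [← h.nullityProj_symm hy, ← hR, hRa, inner_zero_left]
    rw [hT, map_add, hD, proj_fderiv_proj h hJ hs, this, map_add, map_smul, hRa]
    simp
  have hdec : ∀ x, T x = T (R x) := by
    intro x
    have : x = R x + ((lam (J s))⁻¹ • B (J s) (B (J s) x) +
        (inner ℝ (ξ (J s)) x : ℝ) • ξ (J s)) := by
      rw [hR, nullityProj_apply]; abel
    conv_lhs => rw [this]
    rw [hTadd, hTadd, hTsmul, hTsmul, hTtan, hTnor]
    simp
  have hT0 : T x = 0 := by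
    refine ext_inner_right ℝ fun y => ?_
    rw [hTsymm, hdec y, ← hTsymm, hdec x, ← h.nullityProj_idem hy y,
      ← h.nullityProj_symm hy, ← hR, hRTR, inner_zero_left, inner_zero_left]
  rwa [hT, add_eq_zero_iff_eq_neg] at hT0

include he in
/-- The curvature vector of a leaf is parallel in the normal bundle. -/
lemma fderiv_leafCurvature (hV : 1 < Module.finrank ℝ V) (hs : s ∈ O) (a : V) :
    fderiv ℝ (leafCurvature f ξ B lam J e) s a =
      -(inner ℝ (leafCurvature f ξ B lam J e s) (leafCurvature f ξ B lam J e s) : ℝ) •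
        fderiv ℝ (fun t => f (J t)) s a := by
  have : FiniteDimensional ℝ V := .of_finrank_pos (by omega)
  have hz := (surface_smooth h hJ hs).fderiv_infty.differentiableAt_of_infty
  have hH := (leafCurvature_smooth h hJ he hs).differentiableAt_of_infty
  have hR := proj_smooth h hJ hs
  set K := leafCurvature f ξ B lam J e with hK
  set z := fun t => f (J t) with hzdef
  -- differentiate the formula for the derivative of the projection, and use symmetry
  have key : ∀ (x : E) (a c : V), (inner ℝ (fderiv ℝ K s c) x : ℝ) • fderiv ℝ z s a +
      (inner ℝ (fderiv ℝ z s a) x : ℝ) • fderiv ℝ K s c =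
      (inner ℝ (fderiv ℝ K s a) x : ℝ) • fderiv ℝ z s c +
      (inner ℝ (fderiv ℝ z s c) x : ℝ) • fderiv ℝ K s a := by
    intro x
    have hF : ContDiffAt ℝ ∞ (fun t => nullityProj ξ B lam (J t) x) s :=
      hR.clm_apply contDiffAt_const
    have hd : ∀ a c : V, fderiv ℝ (fderiv ℝ (fun t => nullityProj ξ B lam (J t) x)) s c a =
        -((inner ℝ (fderiv ℝ K s c) x : ℝ) • fderiv ℝ z s a +
          (inner ℝ (K s) x : ℝ) • fderiv ℝ (fderiv ℝ z) s c a +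
          ((inner ℝ (fderiv ℝ (fderiv ℝ z) s c a) x : ℝ) • K s +
          (inner ℝ (fderiv ℝ z s a) x : ℝ) • fderiv ℝ K s c)) := by
      intro a c
      have e1 : (fun t => fderiv ℝ (fun t => nullityProj ξ B lam (J t) x) t a) =ᶠ[nhds s]
          fun t => -((inner ℝ (K t) x : ℝ) • fderiv ℝ z t a +
            (inner ℝ (fderiv ℝ z t a) x : ℝ) • K t) := by
        filter_upwards [hJ.isOpen.mem_nhds hs] with t ht
        rw [fderiv_clm_apply (proj_smooth h hJ ht).differentiableAt_of_infty
          (differentiableAt_const x)]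
        simpa using fderiv_proj h hJ he ht a x
      have e2 := DFunLike.congr_fun (e1.fderiv_eq (𝕜 := ℝ)) c
      have hza : DifferentiableAt ℝ (fun t => fderiv ℝ z t a) s :=
        hz.clm_apply (differentiableAt_const a)
      have hx : DifferentiableAt ℝ (fun _ : V => x) s := differentiableAt_const x
      have i1 : DifferentiableAt ℝ (fun t => (inner ℝ (K t) x : ℝ)) s := hH.inner ℝ hx
      have i2 : DifferentiableAt ℝ (fun t => (inner ℝ (fderiv ℝ z t a) x : ℝ)) s := hza.inner ℝ hx
      rw [fderiv_clm_apply hF.fderiv_infty.differentiableAt_of_infty (differentiableAt_const a),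
        fderiv_fun_neg, fderiv_fun_add (i1.fun_smul hza) (i2.fun_smul hH), fderiv_fun_smul i1 hza,
        fderiv_fun_smul i2 hH] at e2
      simp only [_root_.add_apply, _root_.neg_apply,
        _root_.smul_apply, ContinuousLinearMap.smulRight_apply,
        fderiv_inner_apply ℝ hH hx, fderiv_inner_apply ℝ hza hx] at e2
      rw [fderiv_clm_apply hz (differentiableAt_const a)] at e2
      simp at e2
      rw [e2]
      abel
    intro a c
    have := hF.fderiv_fderiv_comm a c
    rw [hd a c, hd c a, (surface_smooth h hJ hs).fderiv_fderiv_comm c a, neg_inj] at this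
    have e3 := sub_eq_zero.2 this
    rw [← sub_eq_zero, ← neg_eq_zero, ← e3]
    abel
  have htan : ∀ a b : V, (inner ℝ (fderiv ℝ K s a) (fderiv ℝ z s b) : ℝ) =
      -(inner ℝ (fderiv ℝ z s a) (fderiv ℝ z s b) * inner ℝ (K s) (K s)) := by
    intro a b
    have e1 : (fun t => (inner ℝ (K t) (fderiv ℝ z t b) : ℝ)) =ᶠ[nhds s] fun _ => 0 := by
      filter_upwards [hJ.isOpen.mem_nhds hs] with t ht using inner_fderiv_leafCurvature h hJ ht b
    have e2 := DFunLike.congr_fun (e1.fderiv_eq (𝕜 := ℝ)) a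
    rw [fderiv_inner_apply ℝ hH (hz.clm_apply (differentiableAt_const b)),
      fderiv_clm_apply hz (differentiableAt_const b)] at e2
    have e3 : (inner ℝ (K s) (fderiv ℝ (fderiv ℝ z) s a b) : ℝ) =
        inner ℝ (fderiv ℝ z s a) (fderiv ℝ z s b) * inner ℝ (K s) (K s) := by
      rw [← real_inner_smul_right, ← proj_sndFDeriv h hJ he hs,
        ← h.nullityProj_symm (hJ.mem s hs), proj_leafCurvature h hJ hs]
    simp only [fderiv_fun_const, Pi.zero_apply, ContinuousLinearMap.comp_zero, zero_add,
      ContinuousLinearMap.flip_apply, _root_.zero_apply, e3] at e2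
    linarith
  -- a nonzero vector `c` orthogonal to `a`
  obtain ⟨c, hc, hc0⟩ : ∃ c : V, (inner ℝ (fderiv ℝ z s a) (fderiv ℝ z s c) : ℝ) = 0 ∧ c ≠ 0 := by
    let l : V →ₗ[ℝ] ℝ := ((innerSL ℝ (fderiv ℝ z s a)) ∘L fderiv ℝ z s).toLinearMap
    obtain ⟨c, hc, hc0⟩ := (Submodule.ne_bot_iff _).1
      (LinearMap.ker_ne_bot_of_finrank_lt (f := l) (by simpa using hV))
    exact ⟨c, hc, hc0⟩
  have hne := inner_fderiv_self_ne hJ hs hc0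
  have h1 := key (fderiv ℝ z s c) a c
  rw [htan, htan, hc, zero_smul, zero_mul, neg_zero, zero_smul, zero_add, add_zero,
    ← mul_neg, mul_smul] at h1
  exact (smul_right_injective E hne h1).symm

include he in
lemma inner_leafCurvature_const (hV : 1 < Module.finrank ℝ V) (hO : IsPreconnected O)
    {s₀ : V} (hs₀ : s₀ ∈ O) (hs : s ∈ O) :
    (inner ℝ (leafCurvature f ξ B lam J e s) (leafCurvature f ξ B lam J e s) : ℝ) =
      inner ℝ (leafCurvature f ξ B lam J e s₀) (leafCurvature f ξ B lam J e s₀) := by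
  have hd : ∀ s ∈ O, DifferentiableAt ℝ (leafCurvature f ξ B lam J e) s :=
    fun s hs => (leafCurvature_smooth h hJ he hs).differentiableAt_of_infty
  refine hJ.isOpen.is_const_of_fderiv_eq_zero (𝕜 := ℝ) hO
    (f := fun s => (inner ℝ (leafCurvature f ξ B lam J e s) (leafCurvature f ξ B lam J e s) : ℝ))
    (fun s hs => ((hd s hs).inner ℝ (hd s hs)).differentiableWithinAt) (fun s hs => ?_) hs hs₀
  ext a
  rw [fderiv_inner_apply ℝ (hd s hs) (hd s hs), fderiv_leafCurvature h hJ he hV hs,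
    inner_smul_right, inner_smul_left,
    inner_fderiv_leafCurvature h hJ hs, real_inner_comm (leafCurvature f ξ B lam J e s)
      (fderiv ℝ (fun t => f (J t)) s a),
    inner_fderiv_leafCurvature h hJ hs]
  simp

include he in
/-- If the curvature vector vanishes, then the relative nullity is constant along the leaf and the
leaf lies in an affine subspace orthogonal to it. -/
lemma const_of_leafCurvature_eq_zero (hV : 1 < Module.finrank ℝ V) (hO : IsPreconnected O)
    {s₀ : V} (hs₀ : s₀ ∈ O) (h0 : leafCurvature f ξ B lam J e s₀ = 0) (hs : s ∈ O) :
    nullityProj ξ B lam (J s) = nullityProj ξ B lam (J s₀) ∧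
      nullityProj ξ B lam (J s) (f (J s)) = nullityProj ξ B lam (J s₀) (f (J s₀)) := by
  have hK : ∀ s ∈ O, leafCurvature f ξ B lam J e s = 0 := fun s hs => by
    rw [← inner_self_eq_zero (𝕜 := ℝ), inner_leafCurvature_const h hJ he hV hO hs₀ hs, h0,
      inner_zero_left]
  have hR : ∀ s ∈ O, fderiv ℝ (fun t => nullityProj ξ B lam (J t)) s = 0 := by
    intro s hs
    ext a x
    rw [fderiv_proj h hJ he hs, hK s hs]
    simp
  have dR : ∀ s ∈ O, DifferentiableAt ℝ (fun t => nullityProj ξ B lam (J t)) s :=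
    fun s hs => (proj_smooth h hJ hs).differentiableAt_of_infty
  have dz : ∀ s ∈ O, DifferentiableAt ℝ (fun t => f (J t)) s :=
    fun s hs => (surface_smooth h hJ hs).differentiableAt_of_infty
  refine ⟨hJ.isOpen.is_const_of_fderiv_eq_zero (𝕜 := ℝ) hO
    (f := fun s => nullityProj ξ B lam (J s))
    (fun s hs => (dR s hs).differentiableWithinAt) (fun s hs => hR s hs) hs hs₀,
    hJ.isOpen.is_const_of_fderiv_eq_zero (𝕜 := ℝ) hO
    (f := fun s => nullityProj ξ B lam (J s) (f (J s)))
    (fun s hs => ((dR s hs).clm_apply (dz s hs)).differentiableWithinAt) (fun s hs => ?_) hs hs₀⟩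
  rw [fderiv_clm_apply (dR s hs) (dz s hs), hR s hs]
  ext a
  simp [proj_fderiv h hJ hs]

include he in
/-- If the curvature vector `H` does not vanish, then the centre `z + H / |H|²` and the part of
the relative nullity orthogonal to `H` are constant along the leaf. -/
lemma const_of_leafCurvature_ne_zero (hV : 1 < Module.finrank ℝ V) (hO : IsPreconnected O)
    {s₀ : V} (hs₀ : s₀ ∈ O) (h0 : leafCurvature f ξ B lam J e s₀ ≠ 0) (hs : s ∈ O) :
    (f (J s) + (inner ℝ (leafCurvature f ξ B lam J e s) (leafCurvature f ξ B lam J e s) : ℝ)⁻¹ •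
      leafCurvature f ξ B lam J e s =
    f (J s₀) + (inner ℝ (leafCurvature f ξ B lam J e s₀) (leafCurvature f ξ B lam J e s₀) : ℝ)⁻¹ •
      leafCurvature f ξ B lam J e s₀) ∧
    ∀ x : E, nullityProj ξ B lam (J s) x -
      (inner ℝ (leafCurvature f ξ B lam J e s) (leafCurvature f ξ B lam J e s) : ℝ)⁻¹ •
        (inner ℝ (leafCurvature f ξ B lam J e s) x : ℝ) • leafCurvature f ξ B lam J e s =
      nullityProj ξ B lam (J s₀) x -
      (inner ℝ (leafCurvature f ξ B lam J e s₀) (leafCurvature f ξ B lam J e s₀) : ℝ)⁻¹ •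
        (inner ℝ (leafCurvature f ξ B lam J e s₀) x : ℝ) • leafCurvature f ξ B lam J e s₀ := by
  have hc : ∀ s ∈ O, _ := fun s hs => inner_leafCurvature_const h hJ he hV hO hs₀ hs
  rw [hc s hs]
  set c : ℝ := inner ℝ (leafCurvature f ξ B lam J e s₀) (leafCurvature f ξ B lam J e s₀) with hcdef
  have hc0 : c ≠ 0 := fun h => h0 (inner_self_eq_zero.1 h)
  have dR : ∀ s ∈ O, DifferentiableAt ℝ (fun t => nullityProj ξ B lam (J t)) s :=
    fun s hs => (proj_smooth h hJ hs).differentiableAt_of_infty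
  have dz : ∀ s ∈ O, DifferentiableAt ℝ (fun t => f (J t)) s :=
    fun s hs => (surface_smooth h hJ hs).differentiableAt_of_infty
  have dK : ∀ s ∈ O, DifferentiableAt ℝ (leafCurvature f ξ B lam J e) s :=
    fun s hs => (leafCurvature_smooth h hJ he hs).differentiableAt_of_infty
  have fK : ∀ s ∈ O, ∀ a, fderiv ℝ (leafCurvature f ξ B lam J e) s a =
      -c • fderiv ℝ (fun t => f (J t)) s a := fun s hs a => by
    rw [fderiv_leafCurvature h hJ he hV hs, hc s hs]
  refine ⟨hJ.isOpen.is_const_of_fderiv_eq_zero (𝕜 := ℝ) hO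
    (f := fun s => f (J s) + c⁻¹ • leafCurvature f ξ B lam J e s)
    (fun s hs => ((dz s hs).add ((dK s hs).const_smul c⁻¹)).differentiableWithinAt)
    (fun s hs => ?_) hs hs₀, fun x => hJ.isOpen.is_const_of_fderiv_eq_zero (𝕜 := ℝ) hO
    (f := fun s => nullityProj ξ B lam (J s) x -
      c⁻¹ • (inner ℝ (leafCurvature f ξ B lam J e s) x : ℝ) • leafCurvature f ξ B lam J e s)
    (fun s hs => ?_) (fun s hs => ?_) hs hs₀⟩
  · rw [fderiv_fun_add (dz s hs) ((dK s hs).fun_const_smul c⁻¹), fderiv_fun_const_smul (dK s hs)]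
    ext a
    simp [fK s hs, smul_smul, inv_mul_cancel₀ hc0]
  · have i1 : DifferentiableAt ℝ (fun s => (inner ℝ (leafCurvature f ξ B lam J e s) x : ℝ)) s :=
      (dK s hs).inner ℝ (differentiableAt_const x)
    exact (((dR s hs).clm_apply (differentiableAt_const x)).sub
      ((i1.smul (dK s hs)).const_smul c⁻¹)).differentiableWithinAt
  · have i1 : DifferentiableAt ℝ (fun s => (inner ℝ (leafCurvature f ξ B lam J e s) x : ℝ)) s :=
      (dK s hs).inner ℝ (differentiableAt_const x)
    rw [fderiv_fun_sub ((dR s hs).clm_apply (differentiableAt_const x))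
      ((i1.fun_smul (dK s hs)).fun_const_smul c⁻¹),
      fderiv_fun_const_smul (i1.fun_smul (dK s hs)), fderiv_fun_smul i1 (dK s hs),
      fderiv_clm_apply (dR s hs) (differentiableAt_const x)]
    ext a
    simp only [fderiv_fun_const, Pi.zero_apply, ContinuousLinearMap.comp_zero, zero_add,
      _root_.sub_apply, ContinuousLinearMap.flip_apply,
      _root_.smul_apply, _root_.add_apply,
      ContinuousLinearMap.smulRight_apply, _root_.zero_apply,
      fderiv_inner_apply ℝ (dK s hs) (differentiableAt_const x), fK s hs,
      fderiv_proj h hJ he hs, inner_zero_right, inner_smul_left, smul_add, smul_smul]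
    simp
    field_simp
    module

end LeafData

end LeafCurvature

/-! ### Differentials in charts -/

section Charts

open Set

variable {B : Type*} [NormedAddCommGroup B] [NormedSpace ℝ B]
  {H : Type*} [TopologicalSpace H] (I : ModelWithCorners ℝ B H)
  {M : Type*} [TopologicalSpace M] [ChartedSpace H M]
  {E : Type*} [NormedAddCommGroup E] [InnerProductSpace ℝ E]

instance finiteDimensional_tangentSpace [FiniteDimensional ℝ B] (p : M) :
    FiniteDimensional ℝ (TangentSpace I p) :=
  inferInstanceAs (FiniteDimensional ℝ B)

lemma finrank_tangentSpace (p : M) :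
    Module.finrank ℝ (TangentSpace I p) = Module.finrank ℝ B := rfl

/-- The derivative at `q` of the extended chart around `x`. -/
def chartDeriv (x q : M) : TangentSpace I q →L[ℝ] B := mfderiv I 𝓘(ℝ, B) (extChartAt I x) q

variable [IsManifold I ∞ M]

lemma chartDeriv_bijective {x q : M} (hq : q ∈ (extChartAt I x).source) :
    Function.Bijective (chartDeriv I x q) :=
  (isInvertible_mfderiv_extChartAt hq).bijective

variable {F : Type*} [NormedAddCommGroup F] [NormedSpace ℝ F]

lemma dif_eq_fderiv_chart [I.Boundaryless] {x q : M} (hq : q ∈ (extChartAt I x).source) {g : M → E}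
    (hg : MDifferentiableAt I 𝓘(ℝ, E) g q) (v : TangentSpace I q) :
    dif I g q v =
      fderiv ℝ (fun y => g ((extChartAt I x).symm y)) (extChartAt I x q) (chartDeriv I x q v) := by
  have hq' : q ∈ (chartAt H x).source := by rwa [extChartAt_source] at hq
  have h1 : MDifferentiableAt I 𝓘(ℝ, B) (extChartAt I x) q := mdifferentiableAt_extChartAt hq'
  have ht := (extChartAt I x).map_source hq
  have h2 : MDifferentiableAt 𝓘(ℝ, B) I (extChartAt I x).symm (extChartAt I x q) := by
    have := mdifferentiableWithinAt_extChartAt_symm (I := I) ht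
    rwa [I.range_eq_univ, mdifferentiableWithinAt_univ] at this
  have h3 : MDifferentiableAt 𝓘(ℝ, B) 𝓘(ℝ, E) (fun y => g ((extChartAt I x).symm y))
      (extChartAt I x q) := by
    refine MDifferentiableAt.comp _ ?_ h2
    rwa [(extChartAt I x).left_inv hq]
  have e : g =ᶠ[nhds q] (fun y => g ((extChartAt I x).symm y)) ∘ extChartAt I x := by
    filter_upwards [(isOpen_extChartAt_source (I := I) x).mem_nhds hq] with q' hq'
    rw [Function.comp_apply, (extChartAt I x).left_inv hq']
  rw [← mfderiv_eq_fderiv]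
  unfold dif chartDeriv
  rw [e.mfderiv_eq, mfderiv_comp q h3 h1]
  rfl

lemma contDiffAt_chart [I.Boundaryless] {x q : M} (hq : q ∈ (extChartAt I x).source) {g : M → F}
    (hg : ContMDiffAt I 𝓘(ℝ, F) ∞ g q) :
    ContDiffAt ℝ ∞ (fun y => g ((extChartAt I x).symm y)) (extChartAt I x q) := by
  have ht := (extChartAt I x).map_source hq
  have h2 : ContMDiffAt 𝓘(ℝ, B) I ∞ (extChartAt I x).symm (extChartAt I x q) :=
    (contMDiffOn_extChartAt_symm x).contMDiffAt ((isOpen_extChartAt_target x).mem_nhds ht)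
  rw [← contMDiffAt_iff_contDiffAt]
  refine ContMDiffAt.comp _ ?_ h2
  rwa [(extChartAt I x).left_inv hq]

omit [IsManifold I ∞ M] in
lemma eventually_chart [I.Boundaryless] {x q : M} (hq : q ∈ (extChartAt I x).source) {V : Set M}
    (hV : IsOpen V) (hqV : q ∈ V) : ∀ᶠ y in nhds (extChartAt I x q),
      y ∈ (extChartAt I x).target ∧ (extChartAt I x).symm y ∈ V := by
  have ht := (extChartAt I x).map_source hq
  have ho := (isOpen_extChartAt_target (I := I) x).mem_nhds ht
  have hc : ContinuousAt (extChartAt I x).symm (extChartAt I x q) :=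
    (continuousOn_extChartAt_symm x).continuousAt ho
  filter_upwards [ho, hc.preimage_mem_nhds (hV.mem_nhds (by rwa [(extChartAt I x).left_inv hq]))]
    with y h1 h2 using ⟨h1, h2⟩

/-- The second fundamental form in a chart: `⟪dξ v, df w⟫ = -⟪ξ, D²f (v, w)⟫`. -/
lemma IsUnitNormalOn.inner_dif_dif [I.Boundaryless] {T : E → Submodule ℝ E} {f ξ : M → E}
    {U V : Set M} (hU : IsOpen U) (hf : ContMDiffOn I 𝓘(ℝ, E) ∞ f U)
    (hξ : IsUnitNormalOn I T f ξ V) {q : M} (hqU : q ∈ U) (hqV : q ∈ V) (v w : TangentSpace I q) :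
    (inner ℝ (dif I ξ q v) (dif I f q w) : ℝ) =
      -inner ℝ (ξ q) (fderiv ℝ (fderiv ℝ (fun y => f ((extChartAt I q).symm y)))
        (extChartAt I q q) (chartDeriv I q q v) (chartDeriv I q q w)) := by
  have hq : q ∈ (extChartAt I q).source := mem_extChartAt_source q
  have sf := contDiffAt_chart I hq (hf.contMDiffAt (hU.mem_nhds hqU))
  have sξ := contDiffAt_chart I hq (hξ.smooth.contMDiffAt (hξ.isOpen.mem_nhds hqV))
  have e : (fun y => (inner ℝ (ξ ((extChartAt I q).symm y))
      (fderiv ℝ (fun y => f ((extChartAt I q).symm y)) y (chartDeriv I q q w)) : ℝ))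
      =ᶠ[nhds (extChartAt I q q)] fun _ => 0 := by
    filter_upwards [eventually_chart I hq (hU.inter hξ.isOpen) ⟨hqU, hqV⟩] with y hy
    have hy' := (extChartAt I q).map_target hy.1
    obtain ⟨w', hw'⟩ := (chartDeriv_bijective I hy').2 (chartDeriv I q q w)
    have := dif_eq_fderiv_chart I hy'
      ((hf.contMDiffAt (hU.mem_nhds hy.2.1)).mdifferentiableAt (by simp)) w'
    rw [(extChartAt I q).right_inv hy.1, hw'] at this
    rw [← this, real_inner_comm, hξ.orthogonal _ hy.2.2]
  have hd := sf.fderiv_infty.differentiableAt_of_infty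
  have e2 := DFunLike.congr_fun (e.fderiv_eq (𝕜 := ℝ)) (chartDeriv I q q v)
  rw [fderiv_inner_apply ℝ sξ.differentiableAt_of_infty
    (hd.clm_apply (differentiableAt_const _)), fderiv_clm_apply hd (differentiableAt_const _)] at e2
  rw [dif_eq_fderiv_chart I hq ((hξ.smooth.contMDiffAt
    (hξ.isOpen.mem_nhds hqV)).mdifferentiableAt (by simp)), dif_eq_fderiv_chart I hq
    ((hf.contMDiffAt (hU.mem_nhds hqU)).mdifferentiableAt (by simp))]
  simp only [fderiv_fun_const, Pi.zero_apply, ContinuousLinearMap.comp_zero, zero_add,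
    ContinuousLinearMap.flip_apply, _root_.zero_apply, (extChartAt I q).left_inv hq] at e2
  linarith

lemma IsUnitNormalOn.inner_dif_self [I.Boundaryless] {T : E → Submodule ℝ E} {f ξ : M → E}
    {V : Set M} (hξ : IsUnitNormalOn I T f ξ V) {q : M} (hqV : q ∈ V) (v : TangentSpace I q) :
    (inner ℝ (dif I ξ q v) (ξ q) : ℝ) = 0 := by
  have hq : q ∈ (extChartAt I q).source := mem_extChartAt_source q
  have sξ := contDiffAt_chart I hq (hξ.smooth.contMDiffAt (hξ.isOpen.mem_nhds hqV))
  have e : (fun y => (inner ℝ (ξ ((extChartAt I q).symm y)) (ξ ((extChartAt I q).symm y)) : ℝ))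
      =ᶠ[nhds (extChartAt I q q)] fun _ => 1 := by
    filter_upwards [eventually_chart I hq hξ.isOpen hqV] with y hy
    rw [real_inner_self_eq_norm_sq, hξ.norm_eq _ hy.2, one_pow]
  have e2 := DFunLike.congr_fun (e.fderiv_eq (𝕜 := ℝ)) (chartDeriv I q q v)
  rw [fderiv_inner_apply ℝ sξ.differentiableAt_of_infty sξ.differentiableAt_of_infty] at e2
  rw [dif_eq_fderiv_chart I hq ((hξ.smooth.contMDiffAt
    (hξ.isOpen.mem_nhds hqV)).mdifferentiableAt (by simp))]
  rw [real_inner_comm] at e2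
  simp only [fderiv_fun_const, Pi.zero_apply, _root_.zero_apply,
    (extChartAt I q).left_inv hq] at e2
  linarith

/-- Symmetry of the second fundamental form. -/
lemma IsUnitNormalOn.inner_dif_comm [I.Boundaryless] {T : E → Submodule ℝ E} {f ξ : M → E}
    {U V : Set M} (hU : IsOpen U) (hf : ContMDiffOn I 𝓘(ℝ, E) ∞ f U)
    (hξ : IsUnitNormalOn I T f ξ V) {q : M} (hqU : q ∈ U) (hqV : q ∈ V) (v w : TangentSpace I q) :
    (inner ℝ (dif I ξ q v) (dif I f q w) : ℝ) = inner ℝ (dif I ξ q w) (dif I f q v) := by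
  rw [hξ.inner_dif_dif I hU hf hqU hqV, hξ.inner_dif_dif I hU hf hqU hqV,
    (contDiffAt_chart I (mem_extChartAt_source q)
      (hf.contMDiffAt (hU.mem_nhds hqU))).fderiv_fderiv_comm]

end Charts

/-! ### Linear algebra in codimension one -/

section LinearAlgebra

variable {V E : Type*} [AddCommGroup V] [Module ℝ V] [NormedAddCommGroup E]
  [InnerProductSpace ℝ E] [FiniteDimensional ℝ E]

/-- In codimension one the tangent space is the orthogonal complement of the unit normal. -/
lemma range_eq_orthogonal_of_codim_one {L : V →ₗ[ℝ] E} (hL : Function.Injective L)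
    (hdim : Module.finrank ℝ V + 1 = Module.finrank ℝ E) {u : E} (hu : ‖u‖ = 1)
    (horth : ∀ v, inner ℝ (L v) u = (0 : ℝ)) : LinearMap.range L = (ℝ ∙ u)ᗮ := by
  have : Fact (Module.finrank ℝ E = Module.finrank ℝ V + 1) := ⟨hdim.symm⟩
  refine Submodule.eq_of_le_of_finrank_eq ?_ ?_
  · rintro _ ⟨v, rfl⟩
    rw [Submodule.mem_orthogonal_singleton_iff_inner_left]
    exact horth v
  · rw [LinearMap.finrank_range_of_inj hL,
      Submodule.finrank_orthogonal_span_singleton (n := Module.finrank ℝ V)]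
    rintro rfl
    simp at hu

lemma eq_or_eq_neg_of_codim_one {L : V →ₗ[ℝ] E} (hL : Function.Injective L)
    (hdim : Module.finrank ℝ V + 1 = Module.finrank ℝ E) {u u' : E} (hu : ‖u‖ = 1) (hu' : ‖u'‖ = 1)
    (horth : ∀ v, inner ℝ (L v) u = (0 : ℝ)) (horth' : ∀ v, inner ℝ (L v) u' = (0 : ℝ)) :
    u' = u ∨ u' = -u := by
  have h : u' ∈ (LinearMap.range L)ᗮ := by
    rw [Submodule.mem_orthogonal]
    rintro _ ⟨v, rfl⟩
    exact horth' v
  rw [range_eq_orthogonal_of_codim_one hL hdim hu horth, Submodule.orthogonal_orthogonal,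
    Submodule.mem_span_singleton] at h
  obtain ⟨c, rfl⟩ := h
  rw [norm_smul, hu, mul_one, Real.norm_eq_abs] at hu'
  rcases eq_or_eq_neg_of_abs_eq hu' with rfl | rfl <;> simp

end LinearAlgebra

/-! ### Shape operators -/

section ShapeOperators

variable {B : Type*} [NormedAddCommGroup B] [NormedSpace ℝ B]
  {H : Type*} [TopologicalSpace H] {I : ModelWithCorners ℝ B H}
  {M : Type*} [TopologicalSpace M] [ChartedSpace H M]
  {E : Type*} [NormedAddCommGroup E] [InnerProductSpace ℝ E]
  {f : M → E} {p : M}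

lemma metric_comm (v w : TangentSpace I p) : metric I f p v w = metric I f p w v :=
  real_inner_comm _ _

lemma metric_add_left (u v w : TangentSpace I p) :
    metric I f p (u + v) w = metric I f p u w + metric I f p v w := by
  simp [metric, inner_add_left]

lemma metric_sub_left (u v w : TangentSpace I p) :
    metric I f p (u - v) w = metric I f p u w - metric I f p v w := by
  simp [metric, inner_sub_left]

lemma metric_smul_left (c : ℝ) (v w : TangentSpace I p) :
    metric I f p (c • v) w = c * metric I f p v w := by
  simp [metric, inner_smul_left]

lemma metric_neg_left (v w : TangentSpace I p) :
    metric I f p (-v) w = -metric I f p v w := by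
  simp [metric]

lemma eq_of_metric_eq (hf : Function.Injective (dif I f p)) {v w : TangentSpace I p}
    (h : ∀ u, metric I f p v u = metric I f p w u) : v = w := by
  have h1 := h (v - w)
  rw [← sub_eq_zero, ← metric_sub_left] at h1
  have h2 : dif I f p (v - w) = 0 := inner_self_eq_zero.1 h1
  rw [← sub_eq_zero]
  exact hf (by rw [h2, map_zero])

/-- The rank-one operator `v ↦ ⟪v, X⟫ X` of the induced metric. -/
def metricRankOne (f : M → E) (X : TangentSpace I p) : Module.End ℝ (TangentSpace I p) :=
  ((innerSL ℝ (dif I f p X)).toLinearMap ∘ₗ (dif I f p).toLinearMap).smulRight X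

lemma metricRankOne_apply (X v : TangentSpace I p) :
    metricRankOne f X v = metric I f p v X • X := by
  simp [metricRankOne, metric, real_inner_comm]

lemma trace_metricRankOne [FiniteDimensional ℝ B] (X : TangentSpace I p) :
    LinearMap.trace ℝ (TangentSpace I p) (metricRankOne f X) = metric I f p X X := by
  rw [metricRankOne, LinearMap.trace_smulRight]
  simp [metric]

lemma sub_rankOne_orthogonal {X Y : TangentSpace I p} (hX : metric I f p X X = 1)
    (hY : metric I f p Y Y = 1) (hXY : metric I f p X Y = 0) (v : TangentSpace I p) :
    metric I f p (v - (metric I f p v X • X + metric I f p v Y • Y)) X = 0 ∧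
      metric I f p (v - (metric I f p v X • X + metric I f p v Y • Y)) Y = 0 := by
  simp [metric_sub_left, metric_add_left, metric_smul_left, hX, hY, hXY, metric_comm Y X]

lemma eq_rankOne_of_eigenvectors {A : Module.End ℝ (TangentSpace I p)} {X Y : TangentSpace I p}
    {a b : ℝ} (hX : metric I f p X X = 1) (hY : metric I f p Y Y = 1) (hXY : metric I f p X Y = 0)
    (hAX : A X = a • X) (hAY : A Y = b • Y)
    (h0 : ∀ x, metric I f p x X = 0 → metric I f p x Y = 0 → A x = 0) :
    A = a • metricRankOne f X + b • metricRankOne f Y := by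
  ext v
  have h := sub_rankOne_orthogonal hX hY hXY v
  have := h0 _ h.1 h.2
  rw [map_sub, map_add, map_smul, map_smul, hAX, hAY, sub_eq_zero] at this
  rw [this]
  simp [metricRankOne_apply, smul_smul, mul_comm]

variable [IsManifold I ∞ M] [I.Boundaryless] [FiniteDimensional ℝ E]

/-- In codimension one the two choices of the unit normal give opposite shape operators. -/
lemma IsShapeOperator.eq_or_eq_neg {U : Set M} (hf : IsImmersionOn I f U) (hp : p ∈ U)
    (hdim : Module.finrank ℝ B + 1 = Module.finrank ℝ E)
    {A A' : Module.End ℝ (TangentSpace I p)} (hA : IsShapeOperator I (fun _ : E => ⊤) f p A)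
    (hA' : IsShapeOperator I (fun _ : E => ⊤) f p A') : A' = A ∨ A' = -A := by
  obtain ⟨V, ξ, hpV, hξ, h⟩ := hA
  obtain ⟨V', ξ', hpV', hξ', h'⟩ := hA'
  have hinj := hf.injective p hp
  have e := eq_or_eq_neg_of_codim_one (L := (dif I f p).toLinearMap) hinj hdim
    (hξ.norm_eq p hpV) (hξ'.norm_eq p hpV') (hξ.orthogonal p hpV) (hξ'.orthogonal p hpV')
  have k := fun v w => hξ.inner_dif_dif I hf.isOpen hf.smooth hp hpV v w
  have k' := fun v w => hξ'.inner_dif_dif I hf.isOpen hf.smooth hp hpV' v w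
  rcases e with e | e
  · left
    ext v
    refine eq_of_metric_eq hinj fun w => ?_
    rw [h, h', k, k', e]
  · right
    ext v
    refine eq_of_metric_eq hinj fun w => ?_
    rw [h', LinearMap.neg_apply, metric_neg_left, h, k, k', e, inner_neg_left]

/-- The distribution `Δ` of a hypersurface of type number two is spanned by the two unit
eigenvectors with nonzero eigenvalues. -/
lemma distr_eq_span {U : Set M} (hf : IsImmersionOn I f U) (hp : p ∈ U)
    (hdim : Module.finrank ℝ B + 1 = Module.finrank ℝ E)
    {A : Module.End ℝ (TangentSpace I p)} (hA : IsShapeOperator I (fun _ : E => ⊤) f p A)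
    {X Y : TangentSpace I p} {a b : ℝ} (ha : a ≠ 0) (hb : b ≠ 0)
    (hX : metric I f p X X = 1) (hY : metric I f p Y Y = 1) (hXY : metric I f p X Y = 0)
    (hAX : A X = a • X) (hAY : A Y = b • Y)
    (h0 : ∀ x, metric I f p x X = 0 → metric I f p x Y = 0 → A x = 0) :
    distr I f p = Submodule.span ℝ {X, Y} := by
  have hA0 := eq_rankOne_of_eigenvectors hX hY hXY hAX hAY h0
  apply le_antisymm
  · refine Submodule.span_le.2 ?_
    rintro v ⟨A', hA', μ, hμ, hv⟩
    have key : ∀ μ : ℝ, μ ≠ 0 → A v = μ • v → v ∈ Submodule.span ℝ {X, Y} := by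
      intro μ hμ hv
      have : v = μ⁻¹ • A v := by rw [hv, smul_smul, inv_mul_cancel₀ hμ, one_smul]
      rw [this, hA0]
      refine Submodule.smul_mem _ _ ?_
      simp only [LinearMap.add_apply, LinearMap.smul_apply, metricRankOne_apply]
      exact Submodule.add_mem _
        (Submodule.smul_mem _ _ (Submodule.smul_mem _ _ (Submodule.subset_span (by simp))))
        (Submodule.smul_mem _ _ (Submodule.smul_mem _ _ (Submodule.subset_span (by simp))))
    rcases hA.eq_or_eq_neg hf hp hdim hA' with rfl | rfl
    · exact key μ hμ hv
    · exact key (-μ) (neg_ne_zero.2 hμ) (by rw [neg_smul, ← hv]; simp)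
  · refine Submodule.span_le.2 ?_
    rintro v (rfl | rfl)
    · exact Submodule.subset_span ⟨A, hA, a, ha, hAX⟩
    · exact Submodule.subset_span ⟨A, hA, b, hb, hAY⟩

lemma IsMinimalK0On.exists_principal [FiniteDimensional ℝ B] {U V : Set M} {ξ : M → E}
    (h : IsMinimalK0On I f U) (hp : p ∈ U) (hξ : IsUnitNormalOn I (fun _ : E => ⊤) f ξ V)
    (hpV : p ∈ V) : ∃ (X Y : TangentSpace I p) (a : ℝ), a ≠ 0 ∧ metric I f p X X = 1 ∧
      metric I f p Y Y = 1 ∧ metric I f p X Y = 0 ∧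
      (∀ v, dif I ξ p v =
        -(a • (metric I f p v X • dif I f p X - metric I f p v Y • dif I f p Y))) ∧
      distr I f p = Submodule.span ℝ {X, Y} := by
  have hinj := h.immersion.injective p hp
  obtain ⟨A, hA, X, Y, a, b, hX, hY, hXY, ha, hb, hAX, hAY, h0⟩ := h.type_two p hp
  have hA0 := eq_rankOne_of_eigenvectors hX hY hXY hAX hAY h0
  have htr : LinearMap.trace ℝ (TangentSpace I p) A = 0 := by
    obtain ⟨A', hA', ht⟩ := h.minimal p hp
    rcases hA.eq_or_eq_neg h.immersion hp h.codim_one hA' with rfl | rfl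
    · exact ht
    · simpa using ht
  have hab : b = -a := by
    rw [hA0, map_add, map_smul, map_smul, trace_metricRankOne, trace_metricRankOne, hX, hY] at htr
    simp at htr
    linarith
  subst hab
  -- the two choices of the normal have proportional derivatives
  obtain ⟨ε, hε, hεA⟩ : ∃ ε : ℝ, ε ≠ 0 ∧ ∀ v w, metric I f p (ε • A v) w =
      -inner ℝ (dif I ξ p v) (dif I f p w) := by
    obtain ⟨V', ξ', hpV', hξ', hs⟩ := hA
    have k := fun v w => hξ.inner_dif_dif I h.immersion.isOpen h.immersion.smooth hp hpV v w
    have k' := fun v w => hξ'.inner_dif_dif I h.immersion.isOpen h.immersion.smooth hp hpV' v w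
    rcases eq_or_eq_neg_of_codim_one (L := (dif I f p).toLinearMap) hinj h.codim_one
      (hξ'.norm_eq p hpV') (hξ.norm_eq p hpV) (hξ'.orthogonal p hpV') (hξ.orthogonal p hpV)
      with e | e
    · refine ⟨1, one_ne_zero, fun v w => ?_⟩
      rw [one_smul, hs, k, k', e]
    · refine ⟨-1, by norm_num, fun v w => ?_⟩
      rw [metric_smul_left, hs, k, k', e, inner_neg_left]
      ring
  refine ⟨X, Y, ε * a, mul_ne_zero hε ha, hX, hY, hXY, fun v => ?_,
    distr_eq_span h.immersion hp h.codim_one hA ha hb hX hY hXY hAX hAY h0⟩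
  have hr := range_eq_orthogonal_of_codim_one (L := (dif I f p).toLinearMap) hinj h.codim_one
    (hξ.norm_eq p hpV) (hξ.orthogonal p hpV)
  have hm : dif I ξ p v ∈ LinearMap.range (dif I f p).toLinearMap := by
    rw [hr, Submodule.mem_orthogonal_singleton_iff_inner_left]
    exact hξ.inner_dif_self I hpV v
  obtain ⟨u, hu⟩ := hm
  have hu' : dif I f p u = dif I ξ p v := hu
  have : u = -(ε • A v) := by
    refine eq_of_metric_eq hinj fun w => ?_
    rw [metric_neg_left, hεA, neg_neg, metric, hu']
  rw [← hu', this, hA0]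
  simp [metricRankOne_apply, smul_smul, mul_assoc, sub_eq_add_neg]

end ShapeOperators

/-! ### The shape operator as an operator of the ambient space -/

section AmbientShape

open Set

variable {B : Type*} [NormedAddCommGroup B] [NormedSpace ℝ B]
  {E : Type*} [NormedAddCommGroup E] [InnerProductSpace ℝ E]

/-- The derivative of `(y, c) ↦ f y + c ξ y` at `(y, 0)`. -/
def collarDeriv (f ξ : B → E) (y : B) : B × ℝ →L[ℝ] E :=
  (fderiv ℝ f y).coprod (ContinuousLinearMap.toSpanSingleton ℝ (ξ y))

/-- The shape operator of `f` with unit normal `ξ`, as an operator of the ambient space vanishing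
on the normal. -/
def ambientShape (f ξ : B → E) (y : B) : E →L[ℝ] E :=
  -((fderiv ℝ ξ y ∘L ContinuousLinearMap.fst ℝ B ℝ) ∘L (collarDeriv f ξ y).inverse)

lemma collarDeriv_apply (f ξ : B → E) (y v : B) (c : ℝ) :
    collarDeriv f ξ y (v, c) = fderiv ℝ f y v + c • ξ y := by
  simp [collarDeriv]

variable [FiniteDimensional ℝ B] [FiniteDimensional ℝ E] {f ξ : B → E} {y : B}

lemma exists_collarDeriv_equiv (hdim : Module.finrank ℝ B + 1 = Module.finrank ℝ E)
    (hf : Function.Injective (fderiv ℝ f y)) (hξ : ‖ξ y‖ = 1)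
    (horth : ∀ v, inner ℝ (fderiv ℝ f y v) (ξ y) = (0 : ℝ)) :
    ∃ e : (B × ℝ) ≃L[ℝ] E, (e : B × ℝ →L[ℝ] E) = collarDeriv f ξ y := by
  have hinj : Function.Injective (collarDeriv f ξ y) := by
    rw [injective_iff_map_eq_zero]
    rintro ⟨v, c⟩ h
    rw [collarDeriv_apply] at h
    have h2 := congrArg (fun x => (inner ℝ x (ξ y) : ℝ)) h
    simp [inner_add_left, horth, inner_smul_left, hξ] at h2
    subst h2
    rw [zero_smul, add_zero] at h
    rw [hf (h.trans (map_zero _).symm)]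
    rfl
  have hsurj : Function.Surjective (collarDeriv f ξ y) :=
    (LinearMap.injective_iff_surjective_of_finrank_eq_finrank
      (f := (collarDeriv f ξ y).toLinearMap) (by simp [hdim])).1 hinj
  refine ⟨(LinearEquiv.ofBijective (collarDeriv f ξ y).toLinearMap
    ⟨hinj, hsurj⟩).toContinuousLinearEquiv, ?_⟩
  ext x <;> rfl

lemma ambientShape_collarDeriv (hdim : Module.finrank ℝ B + 1 = Module.finrank ℝ E)
    (hf : Function.Injective (fderiv ℝ f y)) (hξ : ‖ξ y‖ = 1)
    (horth : ∀ v, inner ℝ (fderiv ℝ f y v) (ξ y) = (0 : ℝ)) (v : B) (c : ℝ) :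
    ambientShape f ξ y (fderiv ℝ f y v + c • ξ y) = -fderiv ℝ ξ y v := by
  obtain ⟨e, he⟩ := exists_collarDeriv_equiv hdim hf hξ horth
  rw [← collarDeriv_apply, ambientShape, ← he]
  simp

/-- Every vector splits into a tangential and a normal part. -/
lemma exists_eq_collarDeriv (hdim : Module.finrank ℝ B + 1 = Module.finrank ℝ E)
    (hf : Function.Injective (fderiv ℝ f y)) (hξ : ‖ξ y‖ = 1)
    (horth : ∀ v, inner ℝ (fderiv ℝ f y v) (ξ y) = (0 : ℝ)) (x : E) :
    ∃ v, x = fderiv ℝ f y v + (inner ℝ x (ξ y) : ℝ) • ξ y := by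
  obtain ⟨e, he⟩ := exists_collarDeriv_equiv hdim hf hξ horth
  obtain ⟨⟨v, c⟩, rfl⟩ := e.surjective x
  have h : e (v, c) = fderiv ℝ f y v + c • ξ y := by
    rw [← collarDeriv_apply, ← he]; rfl
  refine ⟨v, ?_⟩
  rw [h]
  simp [inner_add_left, horth, inner_smul_left, hξ]

lemma ambientShape_smooth (hdim : Module.finrank ℝ B + 1 = Module.finrank ℝ E)
    (hf : Function.Injective (fderiv ℝ f y)) (hξ : ‖ξ y‖ = 1)
    (horth : ∀ v, inner ℝ (fderiv ℝ f y v) (ξ y) = (0 : ℝ))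
    (sf : ContDiffAt ℝ ∞ f y) (sξ : ContDiffAt ℝ ∞ ξ y) : ContDiffAt ℝ ∞ (ambientShape f ξ) y := by
  obtain ⟨e, he⟩ := exists_collarDeriv_equiv hdim hf hξ horth
  have h1 : ContDiffAt ℝ ∞ (collarDeriv f ξ) y := by
    have a1 : ContDiffAt ℝ ∞ (fun y => fderiv ℝ f y ∘L ContinuousLinearMap.fst ℝ B ℝ) y :=
      sf.fderiv_infty.clm_comp contDiffAt_const
    have a2 : ContDiffAt ℝ ∞ (fun y => (ContinuousLinearMap.smulRightL ℝ (B × ℝ) E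
        (ContinuousLinearMap.snd ℝ B ℝ)) (ξ y)) y :=
      ((ContinuousLinearMap.smulRightL ℝ (B × ℝ) E
        (ContinuousLinearMap.snd ℝ B ℝ)).contDiff.contDiffAt.comp y sξ)
    refine (a1.add a2).congr_of_eventuallyEq (Filter.Eventually.of_forall fun y => ?_)
    ext x <;> simp [collarDeriv]
  have h2 : ContDiffAt ℝ ∞ (fun y => (collarDeriv f ξ y).inverse) y := by
    have := contDiffAt_map_inverse (n := ∞) e
    rw [he] at this
    exact this.comp y h1
  exact ((sξ.fderiv_infty.clm_comp contDiffAt_const).clm_comp h2).neg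

end AmbientShape

/-! ### Minimal hypersurfaces of type number two in a chart -/

section MinimalHypersurfaces

open Set

variable {B : Type*} [NormedAddCommGroup B] [NormedSpace ℝ B] [FiniteDimensional ℝ B]
  {H : Type*} [TopologicalSpace H] {I : ModelWithCorners ℝ B H} [I.Boundaryless]
  {M : Type*} [TopologicalSpace M] [ChartedSpace H M] [IsManifold I ∞ M]
  {E : Type*} [NormedAddCommGroup E] [InnerProductSpace ℝ E] [FiniteDimensional ℝ E]
  {f : M → E} {U : Set M}

/-- A minimal hypersurface of type number two in a chart. -/
lemma IsMinimalK0On.exists_shapeData (h : IsMinimalK0On I f U) {p : M} (hp : p ∈ U) :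
    ∃ (V : Set M) (ξ : M → E) (O : Set B) (S : B → E →L[ℝ] E) (lam : B → ℝ),
      p ∈ V ∧ IsUnitNormalOn I (fun _ => ⊤) f ξ V ∧ extChartAt I p p ∈ O ∧
      (∀ y ∈ O, y ∈ (extChartAt I p).target ∧ (extChartAt I p).symm y ∈ V ∩ U) ∧
      ShapeData O (fun y => f ((extChartAt I p).symm y)) (fun y => ξ ((extChartAt I p).symm y))
        S lam ∧
      ∀ y ∈ O, ∀ x, (∃ x', S y x' = x) ↔
        ∃ v ∈ distr I f ((extChartAt I p).symm y), dif I f ((extChartAt I p).symm y) v = x := by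
  obtain ⟨_, ⟨V, ξ, hpV, hξ, _⟩, _⟩ := h.type_two p hp
  set φ := extChartAt I p
  set f' := fun y => f (φ.symm y) with hf'
  set ξ' := fun y => ξ (φ.symm y) with hξ'
  have hU := h.immersion.isOpen
  let O₀ := φ.target ∩ φ.symm ⁻¹' (V ∩ U)
  have hO₀ : IsOpen O₀ := (continuousOn_extChartAt_symm p).isOpen_inter_preimage
    (isOpen_extChartAt_target p) (hξ.isOpen.inter hU)
  have hp₀ : φ p ∈ O₀ := by
    refine ⟨mem_extChartAt_target p, ?_⟩
    have : φ.symm (φ p) = p := extChartAt_to_inv p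
    rw [mem_preimage, this]
    exact ⟨hpV, hp⟩
  have sf : ∀ y ∈ O₀, ContDiffAt ℝ ∞ f' y := fun y hy => by
    have := contDiffAt_chart I (φ.map_target hy.1)
      (h.immersion.smooth.contMDiffAt (hU.mem_nhds hy.2.2))
    rwa [φ.right_inv hy.1] at this
  have sξ : ∀ y ∈ O₀, ContDiffAt ℝ ∞ ξ' y := fun y hy => by
    have := contDiffAt_chart I (φ.map_target hy.1)
      (hξ.smooth.contMDiffAt (hξ.isOpen.mem_nhds hy.2.1))
    rwa [φ.right_inv hy.1] at this
  have df : ∀ y ∈ O₀, ∀ v, dif I f (φ.symm y) v =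
      fderiv ℝ f' y (chartDeriv I p (φ.symm y) v) := fun y hy v => by
    have := dif_eq_fderiv_chart I (φ.map_target hy.1)
      ((h.immersion.smooth.contMDiffAt (hU.mem_nhds hy.2.2)).mdifferentiableAt (by simp)) v
    rwa [φ.right_inv hy.1] at this
  have dξ : ∀ y ∈ O₀, ∀ v, dif I ξ (φ.symm y) v =
      fderiv ℝ ξ' y (chartDeriv I p (φ.symm y) v) := fun y hy v => by
    have := dif_eq_fderiv_chart I (φ.map_target hy.1)
      ((hξ.smooth.contMDiffAt (hξ.isOpen.mem_nhds hy.2.1)).mdifferentiableAt (by simp)) v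
    rwa [φ.right_inv hy.1] at this
  have hbij : ∀ y ∈ O₀, Function.Bijective (chartDeriv I p (φ.symm y)) := fun y hy =>
    chartDeriv_bijective I (φ.map_target hy.1)
  have hinj : ∀ y ∈ O₀, Function.Injective (fderiv ℝ f' y) := by
    intro y hy v w hvw
    obtain ⟨v, rfl⟩ := (hbij y hy).2 v
    obtain ⟨w, rfl⟩ := (hbij y hy).2 w
    rw [← df y hy, ← df y hy] at hvw
    rw [h.immersion.injective _ hy.2.2 hvw]
  have hnorm : ∀ y ∈ O₀, ‖ξ' y‖ = 1 := fun y hy => hξ.norm_eq _ hy.2.1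
  have horth : ∀ y ∈ O₀, ∀ v, inner ℝ (fderiv ℝ f' y v) (ξ' y) = (0 : ℝ) := by
    intro y hy v
    obtain ⟨v, rfl⟩ := (hbij y hy).2 v
    rw [← df y hy]
    exact hξ.orthogonal _ hy.2.1 v
  -- the operator in terms of the two unit eigenvectors
  have hform : ∀ y ∈ O₀, ∃ (X Y : E) (a : ℝ), a ≠ 0 ∧ inner ℝ X X = (1 : ℝ) ∧
      inner ℝ Y Y = (1 : ℝ) ∧ inner ℝ X Y = (0 : ℝ) ∧ inner ℝ X (ξ' y) = (0 : ℝ) ∧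
      inner ℝ Y (ξ' y) = (0 : ℝ) ∧
      (∀ x, ambientShape f' ξ' y x =
        a • ((inner ℝ X x : ℝ) • X - (inner ℝ Y x : ℝ) • Y)) ∧
      ∀ x, (∃ v ∈ distr I f (φ.symm y), dif I f (φ.symm y) v = x) ↔
        ∃ b c : ℝ, b • X + c • Y = x := by
    intro y hy
    obtain ⟨X, Y, a, ha, hX, hY, hXY, hv, hd⟩ := h.exists_principal hy.2.2 hξ hy.2.1
    have hXξ := hξ.orthogonal _ hy.2.1 X
    have hYξ := hξ.orthogonal _ hy.2.1 Y
    refine ⟨dif I f (φ.symm y) X, dif I f (φ.symm y) Y, a, ha, hX, hY, hXY, hXξ, hYξ,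
      fun x => ?_, fun x => ?_⟩
    · obtain ⟨v, hx⟩ := exists_eq_collarDeriv h.codim_one (hinj y hy) (hnorm y hy) (horth y hy) x
      rw [hx, ambientShape_collarDeriv h.codim_one (hinj y hy) (hnorm y hy) (horth y hy)]
      obtain ⟨v, rfl⟩ := (hbij y hy).2 v
      rw [← dξ y hy, ← df y hy, hv, neg_neg, inner_add_right, inner_add_right, inner_smul_right,
        inner_smul_right, hXξ, hYξ, mul_zero, add_zero, add_zero, metric, metric,
        real_inner_comm (dif I f (φ.symm y) X), real_inner_comm (dif I f (φ.symm y) Y)]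
    · rw [hd]
      simp only [Submodule.mem_span_pair]
      constructor
      · rintro ⟨_, ⟨b, c, rfl⟩, rfl⟩
        exact ⟨b, c, by simp⟩
      · rintro ⟨b, c, rfl⟩
        exact ⟨_, ⟨b, c, rfl⟩, by simp⟩
  obtain ⟨x₀, hx₀⟩ : ∃ x₀, ambientShape f' ξ' (φ p) x₀ ≠ 0 := by
    obtain ⟨X, Y, a, ha, hX, hY, hXY, -, -, hB, -⟩ := hform _ hp₀
    refine ⟨X, fun h0 => ?_⟩
    rw [hB, hX, real_inner_comm, hXY] at h0
    have := congrArg (fun x => (inner ℝ X x : ℝ)) h0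
    simp only [inner_smul_right, inner_sub_right, hX, hXY, inner_zero_right] at this
    simp [ha] at this
  have sB : ∀ y ∈ O₀, ContDiffAt ℝ ∞ (ambientShape f' ξ') y := fun y hy =>
    ambientShape_smooth h.codim_one (hinj y hy) (hnorm y hy) (horth y hy) (sf y hy) (sξ y hy)
  let O := O₀ ∩ (fun y => ambientShape f' ξ' y x₀) ⁻¹' {0}ᶜ
  have hO : IsOpen O := by
    refine ContinuousOn.isOpen_inter_preimage (fun y hy => ?_) hO₀ isOpen_compl_singleton
    exact ((sB y hy).continuousAt.clm_apply continuousAt_const).continuousWithinAt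
  have hOx : ∀ y ∈ O, (inner ℝ (ambientShape f' ξ' y x₀) (ambientShape f' ξ' y x₀) : ℝ) ≠ 0 :=
    fun y hy h0 => hy.2 (inner_self_eq_zero.1 h0)
  -- the square of the eigenvalues, as a smooth function
  let lam : B → ℝ := fun y => inner ℝ
    (ambientShape f' ξ' y (ambientShape f' ξ' y (ambientShape f' ξ' y x₀)))
    (ambientShape f' ξ' y x₀) / inner ℝ (ambientShape f' ξ' y x₀) (ambientShape f' ξ' y x₀)
  have hcube : ∀ y ∈ O₀, ∃ c : ℝ, c ≠ 0 ∧ ∀ x, ambientShape f' ξ' y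
      (ambientShape f' ξ' y (ambientShape f' ξ' y x)) = c • ambientShape f' ξ' y x := by
    intro y hy
    obtain ⟨X, Y, a, ha, hX, hY, hXY, -, -, hB, -⟩ := hform _ hy
    refine ⟨a ^ 2, pow_ne_zero 2 ha, fun x => ?_⟩
    have hYX : inner ℝ Y X = (0 : ℝ) := by rw [real_inner_comm, hXY]
    simp only [hB, inner_smul_right, inner_sub_right, hX, hY, hXY, hYX]
    module
  have hlam : ∀ y ∈ O, lam y ≠ 0 ∧ ∀ x, ambientShape f' ξ' y
      (ambientShape f' ξ' y (ambientShape f' ξ' y x)) = lam y • ambientShape f' ξ' y x := by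
    intro y hy
    obtain ⟨c, hc0, hc⟩ := hcube y hy.1
    have : lam y = c := by
      simp only [lam]
      rw [hc, inner_smul_left, RCLike.conj_to_real, mul_div_assoc, div_self (hOx y hy), mul_one]
    rw [this]
    exact ⟨hc0, hc⟩
  refine ⟨V, ξ, O, ambientShape f' ξ', lam, hpV, hξ, ⟨hp₀, hx₀⟩, fun y hy => hy.1, ?_,
    fun y hy x => ?_⟩
  · refine ⟨hO, fun y hy => sf y hy.1, fun y hy => sξ y hy.1, fun y hy => sB y hy.1,
      fun y hy => ?_, fun y hy => (hlam y hy).1, fun y hy v => ?_, fun y hy x x' => ?_,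
      fun y hy x => (hlam y hy).2 x, fun y hy => ?_, fun y hy => hnorm y hy.1,
      fun y hy x _ hx => ?_⟩
    · have b1 : ContDiffAt ℝ ∞ (fun y => ambientShape f' ξ' y x₀) y :=
        (sB y hy.1).clm_apply contDiffAt_const
      exact ((((sB y hy.1).clm_apply ((sB y hy.1).clm_apply b1))).inner ℝ b1).div
        (b1.inner ℝ b1) (hOx y hy)
    · have := ambientShape_collarDeriv h.codim_one (hinj y hy.1) (hnorm y hy.1) (horth y hy.1) v 0
      rw [zero_smul, add_zero] at this
      rw [this, neg_neg]
    · obtain ⟨X, Y, a, -, -, -, -, -, -, hB, -⟩ := hform _ hy.1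
      simp only [hB, inner_smul_left, inner_smul_right, inner_sub_left, inner_sub_right,
        RCLike.conj_to_real, real_inner_comm x]
      ring
    · obtain ⟨X, Y, a, -, -, -, -, hXξ, hYξ, hB, -⟩ := hform _ hy.1
      rw [hB, hXξ, hYξ]
      simp
    · obtain ⟨v, hv⟩ := exists_eq_collarDeriv h.codim_one (hinj y hy.1) (hnorm y hy.1)
        (horth y hy.1) x
      exact ⟨v, by rw [hx, zero_smul, add_zero] at hv; exact hv.symm⟩
  · obtain ⟨X, Y, a, ha, hX, hY, hXY, -, -, hB, hd⟩ := hform _ hy.1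
    rw [hd]
    have hYX : inner ℝ Y X = (0 : ℝ) := by rw [real_inner_comm, hXY]
    constructor
    · rintro ⟨x', rfl⟩
      exact ⟨a * inner ℝ X x', -(a * inner ℝ Y x'), by rw [hB]; module⟩
    · rintro ⟨b, c, rfl⟩
      refine ⟨(a⁻¹ * b) • X - (a⁻¹ * c) • Y, ?_⟩
      simp only [hB, inner_smul_right, inner_sub_right, hX, hY, hXY, hYX]
      have e1 : a * (a⁻¹ * b) = b := by field_simp
      have e2 : a * (a⁻¹ * c) = c := by field_simp
      simp only [mul_one, mul_zero, sub_zero, zero_sub, smul_sub, smul_smul, mul_neg, e1, e2]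
      module

end MinimalHypersurfaces

/-! ### Leaves of `Δ` near a point -/

section Leaves

open Set

variable {B : Type*} [NormedAddCommGroup B] [NormedSpace ℝ B] [FiniteDimensional ℝ B]
  {H : Type*} [TopologicalSpace H] {I : ModelWithCorners ℝ B H} [I.Boundaryless]
  {M : Type*} [TopologicalSpace M] [ChartedSpace H M] [IsManifold I ∞ M]
  {E : Type*} [NormedAddCommGroup E] [InnerProductSpace ℝ E] [FiniteDimensional ℝ E]
  {S : Type*} [TopologicalSpace S] [ChartedSpace (EuclideanSpace ℝ (Fin 2)) S]
  [IsManifold (𝓡 2) ∞ S]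
  {f : M → E} {U : Set M} {j : S → M}

variable (I) in
/-- The image under `df` of the relative nullity of the hypersurface `f` at the point `s` of the
leaf `j`: the orthogonal complement of the tangent plane of the leaf and of the normal line. -/
def leafNullity (f : M → E) (j : S → M) (s : S) : Submodule ℝ E :=
  (LinearMap.range (dif (𝓡 2) (f ∘ j) s).toLinearMap ⊔
    (LinearMap.range (dif I f (j s)).toLinearMap)ᗮ)ᗮ

omit [FiniteDimensional ℝ B] [I.Boundaryless] [IsManifold I ∞ M] [FiniteDimensional ℝ E]
  [IsManifold (𝓡 2) ∞ S] in
lemma IsIntegralSurface.dif_comp (hf : IsImmersionOn I f U)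
    (hj : IsIntegralSurface I (distr I f) U j) (s : S) (v : TangentSpace (𝓡 2) s) :
    dif (𝓡 2) (f ∘ j) s v = dif I f (j s) (mfderiv (𝓡 2) I j s v) := by
  have h1 := (hf.smooth.contMDiffAt (hf.isOpen.mem_nhds (hj.mem s))).mdifferentiableAt (by simp)
  have h2 := (hj.smooth.contMDiffAt (x := s)).mdifferentiableAt (by simp)
  exact mfderiv_comp_apply s h1 h2 v

omit [FiniteDimensional ℝ B] [I.Boundaryless] [IsManifold I ∞ M] [FiniteDimensional ℝ E]
  [IsManifold (𝓡 2) ∞ S] in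
lemma IsIntegralSurface.isImmersionOn (hf : IsImmersionOn I f U)
    (hj : IsIntegralSurface I (distr I f) U j) : IsImmersionOn (𝓡 2) (f ∘ j) univ where
  isOpen := isOpen_univ
  smooth := hf.smooth.comp hj.smooth.contMDiffOn fun s _ => hj.mem s
  injective s _ v w hvw := by
    rw [hj.dif_comp hf, hj.dif_comp hf] at hvw
    exact hj.injective s (hf.injective _ (hj.mem s) hvw)

omit [FiniteDimensional ℝ B] [I.Boundaryless] [IsManifold I ∞ M] [FiniteDimensional ℝ E]
  [IsManifold (𝓡 2) ∞ S] in
lemma IsIntegralSurface.exists_dif_comp_iff (hf : IsImmersionOn I f U)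
    (hj : IsIntegralSurface I (distr I f) U j) (s : S) (x : E) :
    (∃ v, dif (𝓡 2) (f ∘ j) s v = x) ↔ ∃ v ∈ distr I f (j s), dif I f (j s) v = x := by
  rw [← hj.range_eq s]
  constructor
  · rintro ⟨v, rfl⟩
    exact ⟨_, ⟨v, rfl⟩, (hj.dif_comp hf s v).symm⟩
  · rintro ⟨_, ⟨v, rfl⟩, rfl⟩
    exact ⟨v, hj.dif_comp hf s v⟩

/-- Near each of its points a leaf has a curvature vector `K`, determined by the derivative of the
projection onto the nullity, and the data spanning the space or sphere of the leaf are constant. -/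
lemma IsIntegralSurface.exists_local_curvature (h : IsMinimalK0On I f U)
    (hj : IsIntegralSurface I (distr I f) U j) (s₀ : S) :
    ∃ (O : Set S) (K : S → E), IsOpen O ∧ s₀ ∈ O ∧ ∀ s ∈ O,
      (∀ v, dif (𝓡 2) (fun t => (leafNullity I f j t).starProjection (dif (𝓡 2) (f ∘ j) s v)) s v =
        -((inner ℝ (dif (𝓡 2) (f ∘ j) s v) (dif (𝓡 2) (f ∘ j) s v) : ℝ) • K s)) ∧
      (leafNullity I f j s).starProjection (K s) = K s ∧
      (inner ℝ (K s) (K s) : ℝ) = inner ℝ (K s₀) (K s₀) ∧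
      (K s₀ = 0 → (leafNullity I f j s).starProjection = (leafNullity I f j s₀).starProjection ∧
        (leafNullity I f j s).starProjection (f (j s)) =
          (leafNullity I f j s₀).starProjection (f (j s₀))) ∧
      (K s₀ ≠ 0 → f (j s) + (inner ℝ (K s) (K s) : ℝ)⁻¹ • K s =
          f (j s₀) + (inner ℝ (K s₀) (K s₀) : ℝ)⁻¹ • K s₀ ∧
        ∀ x, (leafNullity I f j s).starProjection x -
            (inner ℝ (K s) (K s) : ℝ)⁻¹ • (inner ℝ (K s) x : ℝ) • K s =
          (leafNullity I f j s₀).starProjection x -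
            (inner ℝ (K s₀) (K s₀) : ℝ)⁻¹ • (inner ℝ (K s₀) x : ℝ) • K s₀) := by
  obtain ⟨V, ξ, O₁, A, lam, hpV, hξ, hpO, hO, hS, hran⟩ := h.exists_shapeData (hj.mem s₀)
  have hf := h.immersion
  set φ := extChartAt I (j s₀) with hφ
  set ψ := extChartAt (𝓡 2) s₀ with hψ
  set f' := fun y => f (φ.symm y) with hf'
  set ξ' := fun y => ξ (φ.symm y) with hξ'
  let J := fun y => φ (j (ψ.symm y))
  let z' := fun y => (f ∘ j) (ψ.symm y)
  -- a coordinate domain of the leaf that is mapped into the chart of the hypersurface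
  have hO₂ : IsOpen (j ⁻¹' (φ.source ∩ φ ⁻¹' O₁)) :=
    ((continuousOn_extChartAt (j s₀)).isOpen_inter_preimage (isOpen_extChartAt_source (j s₀))
      hS.isOpen).preimage hj.smooth.continuous
  have hs₀ψ : s₀ ∈ ψ.source := mem_extChartAt_source s₀
  have hev := eventually_chart (𝓡 2) hs₀ψ hO₂ ⟨mem_extChartAt_source (j s₀), hpO⟩
  obtain ⟨r, hr, hball⟩ := Metric.eventually_nhds_iff_ball.1 hev
  set D := Metric.ball (ψ s₀) r with hD
  have hDt : ∀ y ∈ D, y ∈ ψ.target := fun y hy => (hball y hy).1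
  have hDs : ∀ y ∈ D, j (ψ.symm y) ∈ φ.source := fun y hy => (hball y hy).2.1
  have hDm : ∀ y ∈ D, J y ∈ O₁ := fun y hy => (hball y hy).2.2
  have hfz : ∀ y ∈ D, f' (J y) = z' y := fun y hy => by
    simp only [hf', J, z', Function.comp_apply]
    rw [φ.left_inv (hDs y hy)]
  have hfz' : ∀ y ∈ D, fderiv ℝ (fun t => f' (J t)) y = fderiv ℝ z' y := fun y hy => by
    refine Filter.EventuallyEq.fderiv_eq ?_
    filter_upwards [Metric.isOpen_ball.mem_nhds hy] with t ht using hfz t ht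
  have hzs := (hj.isImmersionOn hf).smooth
  have dz : ∀ y ∈ D, ∀ v, dif (𝓡 2) (f ∘ j) (ψ.symm y) v =
      fderiv ℝ (fun t => f' (J t)) y (chartDeriv (𝓡 2) s₀ (ψ.symm y) v) := fun y hy v => by
    have := dif_eq_fderiv_chart (𝓡 2) (ψ.map_target (hDt y hy))
      ((hzs.contMDiffAt Filter.univ_mem).mdifferentiableAt (by simp)) v
    rw [ψ.right_inv (hDt y hy)] at this
    rw [hfz' y hy, this]
  have hbij : ∀ y ∈ D, Function.Bijective (chartDeriv (𝓡 2) s₀ (ψ.symm y)) := fun y hy =>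
    chartDeriv_bijective (𝓡 2) (ψ.map_target (hDt y hy))
  have hJ : LeafData D J O₁ f' A := by
    refine ⟨Metric.isOpen_ball, fun y hy => ?_, hDm, fun y hy a ha => ?_, fun y hy x => ?_⟩
    · have h1 : ContMDiffAt (𝓡 2) 𝓘(ℝ, B) ∞ (fun s => φ (j s)) (ψ.symm y) := by
        refine ContMDiffAt.comp _ (contMDiffAt_extChartAt' ?_) hj.smooth.contMDiffAt
        rw [← extChartAt_source I]
        exact hDs y hy
      have := contDiffAt_chart (𝓡 2) (ψ.map_target (hDt y hy)) h1
      rwa [ψ.right_inv (hDt y hy)] at this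
    · obtain ⟨v, rfl⟩ := (hbij y hy).2 a
      rw [← dz y hy] at ha
      rw [(hj.isImmersionOn hf).injective _ (mem_univ _) (ha.trans (map_zero _).symm), map_zero]
    · have e1 : φ.symm (J y) = j (ψ.symm y) := φ.left_inv (hDs y hy)
      have h1 := hran _ (hDm y hy) x
      rw [e1] at h1
      rw [h1, ← hj.exists_dif_comp_iff hf]
      constructor
      · rintro ⟨a, rfl⟩
        obtain ⟨v, rfl⟩ := (hbij y hy).2 a
        exact ⟨v, dz y hy v⟩
      · rintro ⟨v, rfl⟩
        exact ⟨_, (dz y hy v).symm⟩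
  -- the projection of the coordinate picture is the orthogonal projection
  have hproj : ∀ y ∈ D, (leafNullity I f j (ψ.symm y)).starProjection =
      nullityProj ξ' A lam (J y) := by
    intro y hy
    have hy₁ := hDm y hy
    have e1 : φ.symm (J y) = j (ψ.symm y) := φ.left_inv (hDs y hy)
    have hVU := (hO _ hy₁).2
    rw [e1] at hVU
    have hξy : ξ' (J y) = ξ (j (ψ.symm y)) := by simp only [hξ', e1]
    have hr := range_eq_orthogonal_of_codim_one (L := (dif I f (j (ψ.symm y))).toLinearMap)
      (hf.injective _ hVU.2) h.codim_one (hξ.norm_eq _ hVU.1) (hξ.orthogonal _ hVU.1)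
    ext1 x
    refine Submodule.eq_starProjection_of_mem_orthogonal ?_ ?_
    · rw [leafNullity, hr, Submodule.orthogonal_orthogonal, ← hξy, ← Submodule.inf_orthogonal]
      refine ⟨?_, ?_⟩
      · rw [SetLike.mem_coe, Submodule.mem_orthogonal]
        rintro _ ⟨v, rfl⟩
        rw [ContinuousLinearMap.coe_coe, dz y hy, ← hS.nullityProj_symm hy₁,
          LeafData.proj_fderiv hS hJ hy, inner_zero_left]
      · rw [SetLike.mem_coe, Submodule.mem_orthogonal_singleton_iff_inner_right]
        exact hS.inner_normal_nullityProj hy₁ x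
    · rw [leafNullity, Submodule.orthogonal_orthogonal, nullityProj_apply, hr,
        Submodule.orthogonal_orthogonal, ← hξy]
      have : x - (x - (lam (J y))⁻¹ • A (J y) (A (J y) x) - (inner ℝ (ξ' (J y)) x : ℝ) • ξ' (J y)) =
          (lam (J y))⁻¹ • A (J y) (A (J y) x) + (inner ℝ (ξ' (J y)) x : ℝ) • ξ' (J y) := by abel
      rw [this]
      refine Submodule.add_mem_sup (Submodule.smul_mem _ _ ?_)
        (Submodule.smul_mem _ _ (Submodule.mem_span_singleton_self _))
      obtain ⟨a, ha⟩ := (hJ.range_eq y hy _).2 ⟨A (J y) x, rfl⟩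
      obtain ⟨v, rfl⟩ := (hbij y hy).2 a
      exact ⟨v, by rw [ContinuousLinearMap.coe_coe, dz y hy, ha]⟩
  let e : EuclideanSpace ℝ (Fin 2) := EuclideanSpace.single 0 1
  have he : e ≠ 0 := by simp [e]
  have hV2 : 1 < Module.finrank ℝ (EuclideanSpace ℝ (Fin 2)) := by simp
  have hDc : IsPreconnected D := (convex_ball _ _).isPreconnected
  have hs₀D : ψ s₀ ∈ D := Metric.mem_ball_self hr
  refine ⟨ψ.source ∩ ψ ⁻¹' D, fun s => leafCurvature f' ξ' A lam J e (ψ s),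
    (continuousOn_extChartAt s₀).isOpen_inter_preimage (isOpen_extChartAt_source s₀)
      Metric.isOpen_ball, ⟨hs₀ψ, hs₀D⟩, ?_⟩
  have hp₀ := hproj _ hs₀D
  have hz₀ := hfz _ hs₀D
  simp only [z'] at hz₀
  rw [ψ.left_inv hs₀ψ] at hp₀ hz₀
  rintro s ⟨hsψ, hsD⟩
  have hp := hproj _ hsD
  have hz := hfz _ hsD
  simp only [z'] at hz
  have hdz := dz _ hsD
  rw [ψ.left_inv hsψ] at hp hz hdz
  rw [hp₀, hp]
  change f' (J (ψ s)) = f (j s) at hz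
  change f' (J (ψ s₀)) = f (j s₀) at hz₀
  rw [← hz, ← hz₀]
  refine ⟨fun v => ?_, LeafData.proj_leafCurvature hS hJ hsD,
    LeafData.inner_leafCurvature_const hS hJ he hV2 hDc hs₀D hsD,
    fun h0 => LeafData.const_of_leafCurvature_eq_zero hS hJ he hV2 hDc hs₀D h0 hsD,
    fun h0 => LeafData.const_of_leafCurvature_ne_zero hS hJ he hV2 hDc hs₀D h0 hsD⟩
  have hsource : s ∈ (chartAt (EuclideanSpace ℝ (Fin 2)) s₀).source := by
    rwa [hψ, extChartAt_source] at hsψ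
  set x := dif (𝓡 2) (f ∘ j) s v with hx
  have sR : ContDiffAt ℝ ∞ (fun y => nullityProj ξ' A lam (J y)) (ψ s) :=
    LeafData.proj_smooth hS hJ hsD
  have dR := sR.differentiableAt_of_infty
  have dRx : DifferentiableAt ℝ (fun y => nullityProj ξ' A lam (J y) x) (ψ s) :=
    dR.clm_apply (differentiableAt_const x)
  have hmd : MDifferentiableAt (𝓡 2) 𝓘(ℝ, E)
      (fun t => (leafNullity I f j t).starProjection x) s := by
    have e1 : (fun t => (leafNullity I f j t).starProjection x) =ᶠ[nhds s]
        (fun y => nullityProj ξ' A lam (J y) x) ∘ ψ := by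
      filter_upwards [((continuousOn_extChartAt s₀).isOpen_inter_preimage
        (isOpen_extChartAt_source s₀) Metric.isOpen_ball).mem_nhds ⟨hsψ, hsD⟩] with t ht
      have := hproj _ ht.2
      rw [ψ.left_inv ht.1] at this
      rw [this]
      rfl
    exact (dRx.mdifferentiableAt.comp s (mdifferentiableAt_extChartAt hsource)).congr_of_eventuallyEq
      e1
  rw [dif_eq_fderiv_chart (𝓡 2) hsψ hmd]
  have e2 : (fun y => (leafNullity I f j (ψ.symm y)).starProjection x) =ᶠ[nhds (ψ s)]
      fun y => nullityProj ξ' A lam (J y) x := by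
    filter_upwards [Metric.isOpen_ball.mem_nhds hsD] with y hy
    rw [hproj y hy]
  rw [e2.fderiv_eq, fderiv_clm_apply dR (differentiableAt_const x)]
  simp only [fderiv_fun_const, Pi.zero_apply, ContinuousLinearMap.comp_zero, zero_add,
    ContinuousLinearMap.flip_apply]
  rw [LeafData.fderiv_proj hS hJ he hsD, ← hdz, ← hx, real_inner_comm, hx, hdz,
    real_inner_comm, LeafData.inner_fderiv_leafCurvature hS hJ hsD, zero_smul, zero_add]

end Leaves

/-! ### Connected leaves of `Δ` -/

section LeafTheorem

open Set

variable {B : Type*} [NormedAddCommGroup B] [NormedSpace ℝ B] [FiniteDimensional ℝ B]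
  {H : Type*} [TopologicalSpace H] {I : ModelWithCorners ℝ B H} [I.Boundaryless]
  {M : Type*} [TopologicalSpace M] [ChartedSpace H M] [IsManifold I ∞ M]
  {E : Type*} [NormedAddCommGroup E] [InnerProductSpace ℝ E] [FiniteDimensional ℝ E]
  {S : Type*} [TopologicalSpace S] [ChartedSpace (EuclideanSpace ℝ (Fin 2)) S]
  {f : M → E} {U : Set M} {j : S → M}

/-- The leaves of `Δ` are minimal in every ambient space that contains the normal direction of the
hypersurface: their shape operator is the restriction of that of the hypersurface to `Δ`. -/
lemma IsIntegralSurface.isMinimalOn (h : IsMinimalK0On I f U)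
    (hj : IsIntegralSurface I (distr I f) U j) {T : E → Submodule ℝ E}
    (hT : ∀ s, (LinearMap.range (dif I f (j s)).toLinearMap)ᗮ ≤ T (f (j s))) :
    IsMinimalOn (𝓡 2) T (f ∘ j) univ := by
  intro s _
  have hf := h.immersion
  obtain ⟨_, ⟨V, ξ, hpV, hξ, _⟩, _⟩ := h.type_two _ (hj.mem s)
  obtain ⟨X, Y, a, ha, hX, hY, hXY, hv, hd⟩ := h.exists_principal (hj.mem s) hξ hpV
  have hXd : X ∈ distr I f (j s) := by rw [hd]; exact Submodule.subset_span (by simp)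
  have hYd : Y ∈ distr I f (j s) := by rw [hd]; exact Submodule.subset_span (by simp)
  rw [← hj.range_eq s] at hXd hYd
  obtain ⟨x, rfl⟩ := hXd
  obtain ⟨y, rfl⟩ := hYd
  have hm : ∀ v w : TangentSpace (𝓡 2) s, metric I f (j s) (mfderiv (𝓡 2) I j s v)
      (mfderiv (𝓡 2) I j s w) = metric (𝓡 2) (f ∘ j) s v w := fun v w => by
    simp only [metric, hj.dif_comp hf]
  have hdξ : ∀ v, dif (𝓡 2) (ξ ∘ j) s v = dif I ξ (j s) (mfderiv (𝓡 2) I j s v) := fun v =>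
    mfderiv_comp_apply s ((hξ.smooth.contMDiffAt (hξ.isOpen.mem_nhds hpV)).mdifferentiableAt
      (by simp)) ((hj.smooth.contMDiffAt (x := s)).mdifferentiableAt (by simp)) v
  refine ⟨a • (metricRankOne (f ∘ j) x - metricRankOne (f ∘ j) y),
    ⟨j ⁻¹' V, ξ ∘ j, hpV, ⟨hξ.isOpen.preimage hj.smooth.continuous,
      hξ.smooth.comp hj.smooth.contMDiffOn fun _ ht => ht, fun t ht => hξ.norm_eq _ ht,
      fun t ht => hT t ?_, fun t ht v => ?_⟩, fun v w => ?_⟩, ?_⟩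
  · rw [Submodule.mem_orthogonal]
    rintro _ ⟨v, rfl⟩
    exact hξ.orthogonal _ ht v
  · rw [hj.dif_comp hf]
    exact hξ.orthogonal _ ht _
  · rw [hdξ, hv, inner_neg_left, neg_neg]
    simp only [ContinuousLinearMap.coe_coe] at hX hY hXY hv ⊢
    rw [hm, hm, ← hj.dif_comp hf, ← hj.dif_comp hf, LinearMap.smul_apply, metric_smul_left,
      LinearMap.sub_apply, metric_sub_left, metricRankOne_apply, metricRankOne_apply,
      metric_smul_left, metric_smul_left, inner_smul_left, inner_sub_left, inner_smul_left,
      inner_smul_left]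
    rfl
  · rw [map_smul, map_sub, trace_metricRankOne, trace_metricRankOne, ← hm, ← hm]
    erw [hX, hY]
    simp

omit [FiniteDimensional ℝ B] [I.Boundaryless] [IsManifold I ∞ M] in
/-- The tangent plane of a leaf and the normal line of the hypersurface span a
three-dimensional space. -/
lemma IsIntegralSurface.finrank_leafNullity_orthogonal (hf : IsImmersionOn I f U)
    (hdim : Module.finrank ℝ B + 1 = Module.finrank ℝ E)
    (hj : IsIntegralSurface I (distr I f) U j) (s : S) :
    Module.finrank ℝ (leafNullity I f j s)ᗮ = 3 := by
  have h1 : Module.finrank ℝ (LinearMap.range (dif (𝓡 2) (f ∘ j) s).toLinearMap) = 2 := by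
    rw [LinearMap.finrank_range_of_inj ((hj.isImmersionOn hf).injective s (mem_univ s)),
      finrank_tangentSpace, finrank_euclideanSpace_fin]
  have h2 : Module.finrank ℝ (LinearMap.range (dif I f (j s)).toLinearMap)ᗮ = 1 := by
    have := Submodule.finrank_add_finrank_orthogonal (LinearMap.range (dif I f (j s)).toLinearMap)
    rw [LinearMap.finrank_range_of_inj (hf.injective _ (hj.mem s)), finrank_tangentSpace] at this
    omega
  have h3 : LinearMap.range (dif (𝓡 2) (f ∘ j) s).toLinearMap ≤
      LinearMap.range (dif I f (j s)).toLinearMap := by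
    rintro _ ⟨v, rfl⟩
    exact ⟨_, (hj.dif_comp hf s v).symm⟩
  have h4 := Submodule.finrank_sup_add_finrank_inf_eq
    (LinearMap.range (dif (𝓡 2) (f ∘ j) s).toLinearMap)
    (LinearMap.range (dif I f (j s)).toLinearMap)ᗮ
  rw [((Submodule.orthogonal_disjoint _).mono_left h3).eq_bot, finrank_bot] at h4
  rw [leafNullity, Submodule.orthogonal_orthogonal]
  omega

omit [ChartedSpace (EuclideanSpace ℝ (Fin 2)) S] in
/-- A map on a connected space that is constant near each point is constant. -/
lemma eq_of_locally_eq [PreconnectedSpace S] {O : S → Set S} (hO : ∀ s, IsOpen (O s))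
    (hsO : ∀ s, s ∈ O s) {Y : Type*} (g : S → Y) (hg : ∀ s₀, ∀ s ∈ O s₀, g s = g s₀) (s t : S) :
    g s = g t :=
  ((IsLocallyConstant.iff_exists_open g).2
    fun s₀ => ⟨O s₀, hO s₀, hsO s₀, hg s₀⟩).apply_eq_of_preconnectedSpace s t

/-- A connected leaf of `Δ` is a minimal surface in an `ℝ³` or in an `S³(r)`. -/
theorem IsIntegralSurface.isMinimalInSpace_or_isMinimalInSphere [IsManifold (𝓡 2) ∞ S]
    [ConnectedSpace S] (h : IsMinimalK0On I f U) (hj : IsIntegralSurface I (distr I f) U j) :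
    (∃ F : AffineSubspace ℝ E, IsMinimalInSpace F (f ∘ j)) ∨
      ∃ (F : AffineSubspace ℝ E) (a : E) (r : ℝ), IsMinimalInSphere F a r (f ∘ j) := by
  have hf := h.immersion
  have himm := hj.isImmersionOn hf
  choose O K hO hsO hK using hj.exists_local_curvature h
  -- the curvature vector does not depend on the neighbourhood in which it is computed
  have hKK : ∀ s₀, ∀ s ∈ O s₀, K s₀ s = K s s := by
    intro s₀ s hs
    obtain ⟨v, hv⟩ : ∃ v : TangentSpace (𝓡 2) s, v ≠ 0 := by
      refine ⟨(EuclideanSpace.single 0 1 : EuclideanSpace ℝ (Fin 2)), ?_⟩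
      intro h0
      have h1 : (EuclideanSpace.single 0 1 : EuclideanSpace ℝ (Fin 2)) = 0 := h0
      simp at h1
    have h1 := (hK s₀ s hs).1 v
    rw [(hK s s (hsO s)).1 v, neg_inj] at h1
    have hne : (inner ℝ (dif (𝓡 2) (f ∘ j) s v) (dif (𝓡 2) (f ∘ j) s v) : ℝ) ≠ 0 := fun h0 =>
      hv (himm.injective s (mem_univ s) ((inner_self_eq_zero.1 h0).trans (map_zero _).symm))
    exact (smul_right_injective E hne h1).symm
  let k : S → E := fun s => K s s
  have hkn : ∀ s t, (inner ℝ (k s) (k s) : ℝ) = inner ℝ (k t) (k t) :=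
    eq_of_locally_eq hO hsO (fun s => (inner ℝ (k s) (k s) : ℝ)) fun s₀ s hs => by
      have := (hK s₀ s hs).2.2.1
      rwa [hKK s₀ s hs] at this
  have hkR : ∀ s, (leafNullity I f j s).starProjection (k s) = k s := fun s =>
    (hK s s (hsO s)).2.1
  obtain ⟨s₁⟩ : Nonempty S := inferInstance
  have hRn : ∀ s, (LinearMap.range (dif I f (j s)).toLinearMap)ᗮ ≤ (leafNullity I f j s)ᗮ :=
    fun s => by
      rw [leafNullity, Submodule.orthogonal_orthogonal]
      exact le_sup_right
  have hR0 : ∀ s x, x ∈ (leafNullity I f j s)ᗮ ↔ (leafNullity I f j s).starProjection x = 0 :=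
    fun s x => (Submodule.starProjection_apply_eq_zero_iff _).symm
  by_cases h0 : k s₁ = 0
  · left
    have hk0 : ∀ s, k s = 0 := fun s => by
      rw [← inner_self_eq_zero (𝕜 := ℝ), hkn s s₁, h0, inner_zero_left]
    have hR : ∀ s t, (leafNullity I f j s).starProjection = (leafNullity I f j t).starProjection :=
      eq_of_locally_eq hO hsO _ fun s₀ s hs => ((hK s₀ s hs).2.2.2.1 (hk0 s₀)).1
    have hRz : ∀ s t, (leafNullity I f j s).starProjection (f (j s)) =
        (leafNullity I f j t).starProjection (f (j t)) :=
      eq_of_locally_eq hO hsO (fun s => (leafNullity I f j s).starProjection (f (j s)))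
        fun s₀ s hs => ((hK s₀ s hs).2.2.2.1 (hk0 s₀)).2
    refine ⟨AffineSubspace.mk' (f (j s₁)) (leafNullity I f j s₁)ᗮ, ?_, himm, fun s => ?_,
      hj.isMinimalOn h fun s => ?_⟩
    · rw [AffineSubspace.direction_mk']
      exact hj.finrank_leafNullity_orthogonal hf h.codim_one s₁
    · rw [AffineSubspace.mem_mk', vsub_eq_sub, hR0, map_sub, Function.comp_apply, ← hRz s s₁,
        hR s₁ s, sub_self]
    · intro u hu
      rw [spaceTangent, AffineSubspace.direction_mk', hR0, hR s₁ s, ← hR0]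
      exact hRn s hu
  · right
    set c : ℝ := inner ℝ (k s₁) (k s₁) with hc
    have hc0 : 0 < c := real_inner_self_pos.2 h0
    have hkc : ∀ s, (inner ℝ (k s) (k s) : ℝ) = c := fun s => hkn s s₁
    have hk0 : ∀ s, k s ≠ 0 := fun s hs => by
      have := hkc s
      rw [hs, inner_zero_left] at this
      exact hc0.ne this
    have hcen : ∀ s t, f (j s) + c⁻¹ • k s = f (j t) + c⁻¹ • k t :=
      eq_of_locally_eq hO hsO (fun s => f (j s) + c⁻¹ • k s) fun s₀ s hs => by
        have := ((hK s₀ s hs).2.2.2.2 (hk0 s₀)).1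
        rw [hKK s₀ s hs] at this
        change _ + (inner ℝ (k s) (k s))⁻¹ • _ = _ + (inner ℝ (k s₀) (k s₀))⁻¹ • _ at this
        rwa [hkc, hkc] at this
    have hR : ∀ x s t, (leafNullity I f j s).starProjection x -
        c⁻¹ • (inner ℝ (k s) x : ℝ) • k s = (leafNullity I f j t).starProjection x -
        c⁻¹ • (inner ℝ (k t) x : ℝ) • k t := fun x =>
      eq_of_locally_eq hO hsO (fun s => (leafNullity I f j s).starProjection x -
        c⁻¹ • (inner ℝ (k s) x : ℝ) • k s)
        fun s₀ s hs => by
          have := ((hK s₀ s hs).2.2.2.2 (hk0 s₀)).2 x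
          rw [hKK s₀ s hs] at this
          change _ - (inner ℝ (k s) (k s))⁻¹ • _ = _ - (inner ℝ (k s₀) (k s₀))⁻¹ • _ at this
          rwa [hkc, hkc] at this
    set a := f (j s₁) + c⁻¹ • k s₁ with ha
    have hza : ∀ s, f (j s) - a = -(c⁻¹ • k s) := fun s => by
      rw [ha, ← hcen s s₁]; abel
    let D := (leafNullity I f j s₁)ᗮ ⊔ (ℝ ∙ k s₁)
    have hD : ∀ s x, (leafNullity I f j s).starProjection x -
        c⁻¹ • (inner ℝ (k s) x : ℝ) • k s = 0 → x ∈ D := by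
      intro s x hx
      rw [hR x s s₁, sub_eq_zero, smul_smul] at hx
      have : x = (x - (c⁻¹ * inner ℝ (k s₁) x) • k s₁) + (c⁻¹ * inner ℝ (k s₁) x) • k s₁ := by abel
      rw [this]
      refine Submodule.add_mem_sup ?_ (Submodule.smul_mem _ _ (Submodule.mem_span_singleton_self _))
      rw [hR0, map_sub, map_smul, hkR, hx, sub_self]
    have hkD : ∀ s, k s ∈ D := fun s => hD s _ (by
      rw [hkR, hkc, smul_smul, inv_mul_cancel₀ hc0.ne', one_smul, sub_self])
    have hkn' : ∀ s, k s ∈ leafNullity I f j s := fun s =>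
      Submodule.starProjection_eq_self_iff.1 (hkR s)
    have hDdim : Module.finrank ℝ D = 4 := by
      have h4 := Submodule.finrank_sup_add_finrank_inf_eq (leafNullity I f j s₁)ᗮ (ℝ ∙ k s₁)
      have h5 : (leafNullity I f j s₁)ᗮ ⊓ (ℝ ∙ k s₁) = ⊥ := by
        refine ((Submodule.orthogonal_disjoint (leafNullity I f j s₁)).symm.mono_right ?_).eq_bot
        rw [Submodule.span_singleton_le_iff_mem]
        exact hkn' s₁
      rw [h5, finrank_bot, finrank_span_singleton (hk0 s₁),
        hj.finrank_leafNullity_orthogonal hf h.codim_one s₁] at h4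
      exact h4
    refine ⟨AffineSubspace.mk' a D, a, (Real.sqrt c)⁻¹, ?_, AffineSubspace.self_mem_mk' a D,
      inv_pos.2 (Real.sqrt_pos.2 hc0), himm, fun s => ?_, fun s => ?_, hj.isMinimalOn h fun s => ?_⟩
    · rw [AffineSubspace.direction_mk']
      exact hDdim
    · rw [AffineSubspace.mem_mk', vsub_eq_sub, Function.comp_apply, hza]
      exact neg_mem (Submodule.smul_mem _ _ (hkD s))
    · rw [Function.comp_apply, dist_eq_norm, hza, norm_neg, norm_smul, norm_eq_sqrt_real_inner (k s),
        hkc, norm_inv, Real.norm_of_nonneg hc0.le]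
      have := Real.mul_self_sqrt hc0.le
      have h6 : Real.sqrt c ≠ 0 := (Real.sqrt_pos.2 hc0).ne'
      field_simp
      rw [sq, this]
    · intro u hu
      have hu' := hRn s hu
      have hku : (inner ℝ (k s) u : ℝ) = 0 := (Submodule.mem_orthogonal _ _).1 hu' _ (hkn' s)
      rw [sphereTangent, AffineSubspace.direction_mk']
      refine ⟨hD s u ?_, ?_⟩
      · rw [(hR0 s u).1 hu', hku]
        simp
      · rw [SetLike.mem_coe, Submodule.mem_orthogonal_singleton_iff_inner_right, hza, inner_neg_left,
          inner_smul_left, hku]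
        simp

end LeafTheorem

/-! ### Differentials of maps on manifolds and Lie brackets -/

section ManifoldCalculus

open Set

variable {B : Type*} [NormedAddCommGroup B] [NormedSpace ℝ B]
  {H : Type*} [TopologicalSpace H] {I : ModelWithCorners ℝ B H} [I.Boundaryless]
  {M : Type*} [TopologicalSpace M] [ChartedSpace H M] [IsManifold I ∞ M]
  {E : Type*} [NormedAddCommGroup E] [InnerProductSpace ℝ E]

lemma _root_.ContMDiff.dif_eq_fderiv_chart {g : M → E} (hg : ContMDiff I 𝓘(ℝ, E) ∞ g) {x q : M}
    (hq : q ∈ (extChartAt I x).source) (v : TangentSpace I q) : dif I g q v =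
      fderiv ℝ (fun y => g ((extChartAt I x).symm y)) (extChartAt I x q) (chartDeriv I x q v) :=
  ConullityTwo.dif_eq_fderiv_chart I hq (hg.contMDiffAt.mdifferentiableAt (by simp)) v

lemma _root_.ContMDiff.differentiableAt_chart {g : M → E} (hg : ContMDiff I 𝓘(ℝ, E) ∞ g) (p : M) :
    DifferentiableAt ℝ (fun y => g ((extChartAt I p).symm y)) (extChartAt I p p) :=
  (contDiffAt_chart I (mem_extChartAt_source p) hg.contMDiffAt).differentiableAt_of_infty

omit [I.Boundaryless] [IsManifold I ∞ M] in
lemma dif_const (c : E) (p : M) (v : TangentSpace I p) : dif I (fun _ => c) p v = 0 := by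
  rw [dif, mfderiv_const]; rfl

lemma dif_add {f g : M → E} (hf : ContMDiff I 𝓘(ℝ, E) ∞ f) (hg : ContMDiff I 𝓘(ℝ, E) ∞ g) (p : M)
    (v : TangentSpace I p) : dif I (fun x => f x + g x) p v = dif I f p v + dif I g p v := by
  have hp := mem_extChartAt_source (I := I) p
  rw [ContMDiff.dif_eq_fderiv_chart (g := fun x => f x + g x) (hf.add hg) hp,
    hf.dif_eq_fderiv_chart hp, hg.dif_eq_fderiv_chart hp,
    fderiv_fun_add (hf.differentiableAt_chart p) (hg.differentiableAt_chart p)]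
  rfl

lemma dif_smul {c : M → ℝ} {f : M → E} (hc : ContMDiff I 𝓘(ℝ, ℝ) ∞ c)
    (hf : ContMDiff I 𝓘(ℝ, E) ∞ f) (p : M) (v : TangentSpace I p) :
    dif I (fun x => c x • f x) p v = dif I c p v • f p + c p • dif I f p v := by
  have hp := mem_extChartAt_source (I := I) p
  rw [ContMDiff.dif_eq_fderiv_chart (g := fun x => c x • f x) (hc.smul hf) hp,
    hc.dif_eq_fderiv_chart hp, hf.dif_eq_fderiv_chart hp,
    fderiv_fun_smul (hc.differentiableAt_chart p) (hf.differentiableAt_chart p)]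
  rw [(extChartAt I p).left_inv hp]
  simp only [_root_.add_apply, _root_.smul_apply, ContinuousLinearMap.smulRight_apply]
  abel

lemma dif_sum {ι : Type*} (t : Finset ι) {f : ι → M → E}
    (hf : ∀ i, ContMDiff I 𝓘(ℝ, E) ∞ (f i)) (p : M) (v : TangentSpace I p) :
    dif I (fun x => ∑ i ∈ t, f i x) p v = ∑ i ∈ t, dif I (f i) p v := by
  classical
  induction t using Finset.induction_on with
  | empty => simp [dif_const]
  | insert a t ha ih =>
    simp only [Finset.sum_insert ha]
    rw [dif_add (hf a) (contMDiff_finsetSum fun i _ => hf i), ih]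

/-- The differential of a map with values in a linear subspace has values in that subspace. -/
lemma dif_mem [FiniteDimensional ℝ E] {G : Submodule ℝ E} {g : M → E}
    (hg : ContMDiff I 𝓘(ℝ, E) ∞ g) (hG : ∀ p, g p ∈ G) (p : M) (v : TangentSpace I p) :
    dif I g p v ∈ G := by
  have hp := mem_extChartAt_source (I := I) p
  rw [← Submodule.orthogonal_orthogonal G, Submodule.mem_orthogonal, hg.dif_eq_fderiv_chart hp]
  intro c hc
  have e : (fun y => (inner ℝ c (g ((extChartAt I p).symm y)) : ℝ)) = fun _ => 0 :=
    funext fun y => by rw [real_inner_comm]; exact (Submodule.mem_orthogonal _ _).1 hc _ (hG _)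
  have e2 := DFunLike.congr_fun (congrArg (fun F => fderiv ℝ F (extChartAt I p p)) e)
    (chartDeriv I p p v)
  rw [fderiv_inner_apply ℝ (differentiableAt_const _) (hg.differentiableAt_chart p)] at e2
  simpa only [fderiv_fun_const, Pi.zero_apply, _root_.zero_apply, inner_zero_left,
    add_zero] using e2

/-- A map that is constant along two vector fields is constant along their Lie bracket. -/
lemma dif_mlieBracket_eq_zero [FiniteDimensional ℝ B] {O : Set M} (hO : IsOpen O) {g : M → E}
    (hg : ContMDiff I 𝓘(ℝ, E) ∞ g) {V W : ∀ p : M, TangentSpace I p}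
    (hV : ContMDiffOn I I.tangent ∞ (fun p => (⟨p, V p⟩ : TangentBundle I M)) O)
    (hW : ContMDiffOn I I.tangent ∞ (fun p => (⟨p, W p⟩ : TangentBundle I M)) O)
    (hV0 : ∀ p ∈ O, dif I g p (V p) = 0) (hW0 : ∀ p ∈ O, dif I g p (W p) = 0) {p : M} (hp : p ∈ O) :
    dif I g p (VectorField.mlieBracket I V W p) = 0 := by
  have : CompleteSpace B := FiniteDimensional.complete ℝ B
  have hs := mem_extChartAt_source (I := I) p
  set φ := extChartAt I p with hφ
  let pull : (∀ p : M, TangentSpace I p) → B → B := fun V =>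
    VectorField.mpullbackWithin 𝓘(ℝ, B) I φ.symm V (range I)
  have hset : φ.symm ⁻¹' univ ∩ range I = univ := by
    rw [preimage_univ, univ_inter, I.range_eq_univ]
  have hdiff : ∀ V : ∀ p : M, TangentSpace I p,
      ContMDiffOn I I.tangent ∞ (fun p => (⟨p, V p⟩ : TangentBundle I M)) O →
      DifferentiableAt ℝ (pull V) (φ p) := by
    intro V hV
    have h1 := ((hV.contMDiffAt (hO.mem_nhds hp)).mdifferentiableAt (by simp)).mdifferentiableWithinAt
      (s := univ)
    have h2 := h1.differentiableWithinAt_mpullbackWithin_vectorField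
    rw [hset] at h2
    exact differentiableWithinAt_univ.1 h2
  have hpull : ∀ V : ∀ p : M, TangentSpace I p, (∀ p ∈ O, dif I g p (V p) = 0) →
      (fun y => fderiv ℝ (fun y => g (φ.symm y)) y (pull V y)) =ᶠ[nhds (φ p)] fun _ => 0 := by
    intro V hV
    filter_upwards [eventually_chart I hs hO hp] with y hy
    have hy' := φ.map_target hy.1
    have h1 : pull V y = chartDeriv I p (φ.symm y) (V (φ.symm y)) := by
      have h2 := mfderivWithin_extChartAt_symm_comp_mfderiv_extChartAt (I := I) hy.1
      have h3 := mfderiv_extChartAt_comp_mfderivWithin_extChartAt_symm (I := I) hy.1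
      have h4 := ContinuousLinearMap.inverse_eq h2 h3
      change (mfderivWithin 𝓘(ℝ, B) I φ.symm (range I) y).inverse (V (φ.symm y)) = _
      rw [h4]
      rfl
    have h2 := hg.dif_eq_fderiv_chart hy' (V (φ.symm y))
    rw [φ.right_inv hy.1, hV _ hy.2] at h2
    rw [h1, ← h2]
  have hbr : chartDeriv I p p (VectorField.mlieBracket I V W p) =
      VectorField.lieBracket ℝ (pull V) (pull W) (φ p) := by
    rw [← VectorField.mlieBracketWithin_univ, VectorField.mlieBracketWithin_apply]
    have h1 : (chartDeriv I p p).IsInvertible := isInvertible_mfderiv_extChartAt hs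
    rw [hset]
    have h2 : ∀ x, chartDeriv I p p ((chartDeriv I p p).inverse x) = x := by
      obtain ⟨e, he⟩ := h1
      intro x
      rw [← he]
      simp
    have h3 := h2 (VectorField.lieBracket ℝ (pull V) (pull W) (φ p))
    rw [← VectorField.lieBracketWithin_univ] at h3 ⊢
    exact h3
  rw [hg.dif_eq_fderiv_chart hs, hbr, VectorField.fderiv_apply_lieBracket
    (contDiffAt_chart I hs hg.contMDiffAt)
    (by rw [minSmoothness_of_isRCLikeNormedField]; exact WithTop.coe_le_coe.2 le_top)
    (hdiff W hW) (hdiff V hV), (hpull V hV0).fderiv_eq, (hpull W hW0).fderiv_eq]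
  simp

end ManifoldCalculus

/-! ### Trace-free symmetric operators of a plane -/

section Eigenvectors

variable {V E : Type*} [AddCommGroup V] [Module ℝ V] [FiniteDimensional ℝ V]
  [NormedAddCommGroup E] [InnerProductSpace ℝ E]

/-- A nonzero trace-free operator of a plane that is symmetric for the metric induced by `L` has an
orthonormal basis of eigenvectors, with opposite nonzero eigenvalues. -/
lemma exists_eigenvectors_of_trace_eq_zero {L : V →ₗ[ℝ] E} (hL : Function.Injective L)
    (hV : Module.finrank ℝ V = 2) {A : Module.End ℝ V}
    (hA : ∀ v w, inner ℝ (L (A v)) (L w) = (inner ℝ (L v) (L (A w)) : ℝ))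
    (htr : LinearMap.trace ℝ V A = 0) (hA0 : A ≠ 0) :
    ∃ (x y : V) (a : ℝ), a ≠ 0 ∧ inner ℝ (L x) (L x) = (1 : ℝ) ∧ inner ℝ (L y) (L y) = (1 : ℝ) ∧
      inner ℝ (L x) (L y) = (0 : ℝ) ∧ A x = a • x ∧ A y = (-a) • y ∧
      ∀ v, v = (inner ℝ (L v) (L x) : ℝ) • x + (inner ℝ (L v) (L y) : ℝ) • y := by
  let e := LinearEquiv.ofInjective L hL
  have he : ∀ v, ((e v : LinearMap.range L) : E) = L v := fun v => rfl
  let T : LinearMap.range L →ₗ[ℝ] LinearMap.range L := e.toLinearMap ∘ₗ A ∘ₗ e.symm.toLinearMap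
  have hT : T.IsSymmetric := by
    intro v w
    obtain ⟨v, rfl⟩ := e.surjective v
    obtain ⟨w, rfl⟩ := e.surjective w
    simp only [T, LinearMap.comp_apply, LinearEquiv.coe_coe, LinearEquiv.symm_apply_apply,
      Submodule.coe_inner, he]
    exact hA v w
  have hn : Module.finrank ℝ (LinearMap.range L) = 2 := by
    rw [LinearMap.finrank_range_of_inj hL, hV]
  let u := hT.eigenvectorBasis hn
  have hu : ∀ i, A (e.symm (u i)) = hT.eigenvalues hn i • e.symm (u i) := by
    intro i
    have := congrArg e.symm (hT.apply_eigenvectorBasis hn i)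
    rw [map_smul] at this
    change e.symm (e (A (e.symm _))) = _ at this
    rwa [e.symm_apply_apply] at this
  have htrT : LinearMap.trace ℝ _ T = 0 := by
    rw [← htr]
    exact LinearMap.trace_conj' A e
  have hsum : hT.eigenvalues hn 0 + hT.eigenvalues hn 1 = 0 := by
    rw [LinearMap.trace_eq_sum_inner T u, Fin.sum_univ_two] at htrT
    simp only [u, hT.apply_eigenvectorBasis hn, inner_smul_right] at htrT
    simpa [real_inner_self_eq_norm_sq] using htrT
  have hdec : ∀ v, v = (inner ℝ (L v) (L (e.symm (u 0))) : ℝ) • e.symm (u 0) +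
      (inner ℝ (L v) (L (e.symm (u 1))) : ℝ) • e.symm (u 1) := by
    intro v
    apply e.injective
    have := u.sum_repr' (e v)
    rw [Fin.sum_univ_two, Submodule.coe_inner, Submodule.coe_inner, real_inner_comm,
      real_inner_comm ((e v : LinearMap.range L) : E) (u 1 : LinearMap.range L)] at this
    rw [map_add, map_smul, map_smul, ← he, ← he, ← he, e.apply_symm_apply, e.apply_symm_apply]
    exact this.symm
  have hin : ∀ i k, (inner ℝ (L (e.symm (u i))) (L (e.symm (u k))) : ℝ) = inner ℝ (u i) (u k) := by
    intro i k
    rw [← he, ← he, e.apply_symm_apply, e.apply_symm_apply, Submodule.coe_inner]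
  refine ⟨e.symm (u 0), e.symm (u 1), hT.eigenvalues hn 0, fun h0 => hA0 ?_, ?_, ?_, ?_, hu 0, ?_,
    hdec⟩
  · have h1 : hT.eigenvalues hn 1 = 0 := by linarith
    ext v
    rw [hdec v, map_add, map_smul, map_smul, hu, hu, h0, h1]
    simp
  · rw [hin, real_inner_self_eq_norm_sq, u.orthonormal.1]; norm_num
  · rw [hin, real_inner_self_eq_norm_sq, u.orthonormal.1]; norm_num
  · rw [hin]; exact u.orthonormal.2 (by decide)
  · rw [hu, show hT.eigenvalues hn 1 = -hT.eigenvalues hn 0 by linarith]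

end Eigenvectors

/-! ### Hypersurfaces generated by normal planes -/

section GeneratedHypersurface

open Set

variable {S : Type*} [TopologicalSpace S] [ChartedSpace (EuclideanSpace ℝ (Fin 2)) S]
  {E : Type*} [NormedAddCommGroup E] [InnerProductSpace ℝ E] {k : ℕ}

/-- The first component of a tangent vector of `S × ℝᵏ`. -/
def tangentFst (p : S × EuclideanSpace ℝ (Fin k)) :
    TangentSpace ((𝓡 2).prod (𝓡 k)) p →ₗ[ℝ] TangentSpace (𝓡 2) p.1 :=
  LinearMap.fst ℝ (EuclideanSpace ℝ (Fin 2)) (EuclideanSpace ℝ (Fin k))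

/-- The second component of a tangent vector of `S × ℝᵏ`. -/
def tangentSnd (p : S × EuclideanSpace ℝ (Fin k)) :
    TangentSpace ((𝓡 2).prod (𝓡 k)) p →ₗ[ℝ] EuclideanSpace ℝ (Fin k) :=
  LinearMap.snd ℝ (EuclideanSpace ℝ (Fin 2)) (EuclideanSpace ℝ (Fin k))

/-- The tangent vector of `S × ℝᵏ` with given components. -/
def tangentMk (p : S × EuclideanSpace ℝ (Fin k)) (v : TangentSpace (𝓡 2) p.1)
    (u : EuclideanSpace ℝ (Fin k)) : TangentSpace ((𝓡 2).prod (𝓡 k)) p :=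
  ((v, u) : EuclideanSpace ℝ (Fin 2) × EuclideanSpace ℝ (Fin k))

@[simp] lemma tangentFst_mk (p : S × EuclideanSpace ℝ (Fin k)) (v : TangentSpace (𝓡 2) p.1)
    (u : EuclideanSpace ℝ (Fin k)) : tangentFst p (tangentMk p v u) = v := rfl

@[simp] lemma tangentSnd_mk (p : S × EuclideanSpace ℝ (Fin k)) (v : TangentSpace (𝓡 2) p.1)
    (u : EuclideanSpace ℝ (Fin k)) : tangentSnd p (tangentMk p v u) = u := rfl

lemma tangent_ext {p : S × EuclideanSpace ℝ (Fin k)}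
    {V W : TangentSpace ((𝓡 2).prod (𝓡 k)) p} (h1 : tangentFst p V = tangentFst p W)
    (h2 : tangentSnd p V = tangentSnd p W) : V = W :=
  Prod.ext h1 h2

lemma dif_comp_fst {g : S → E} {p : S × EuclideanSpace ℝ (Fin k)}
    (hg : MDifferentiableAt (𝓡 2) 𝓘(ℝ, E) g p.1) (V : TangentSpace ((𝓡 2).prod (𝓡 k)) p) :
    dif ((𝓡 2).prod (𝓡 k)) (fun p : S × EuclideanSpace ℝ (Fin k) => g p.1) p V =
      dif (𝓡 2) g p.1 (tangentFst p V) := by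
  have h := mfderiv_comp (I := (𝓡 2).prod (𝓡 k)) (I' := 𝓡 2) (I'' := 𝓘(ℝ, E)) p hg
    mdifferentiableAt_fst
  rw [mfderiv_fst] at h
  exact DFunLike.congr_fun h V

lemma dif_coord (p : S × EuclideanSpace ℝ (Fin k)) (α : Fin k)
    (V : TangentSpace ((𝓡 2).prod (𝓡 k)) p) :
    dif ((𝓡 2).prod (𝓡 k)) (fun p : S × EuclideanSpace ℝ (Fin k) => p.2 α) p V =
      tangentSnd p V α := by
  have h := mfderiv_comp (I := (𝓡 2).prod (𝓡 k)) (I' := 𝓡 k) (I'' := 𝓘(ℝ, ℝ)) p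
    (EuclideanSpace.proj α : EuclideanSpace ℝ (Fin k) →L[ℝ] ℝ).mdifferentiableAt
    mdifferentiableAt_snd
  rw [mfderiv_snd, ContinuousLinearMap.mfderiv_eq] at h
  exact DFunLike.congr_fun h V

lemma contMDiff_coord (α : Fin k) : ContMDiff ((𝓡 2).prod (𝓡 k)) 𝓘(ℝ, ℝ) ∞
    (fun p : S × EuclideanSpace ℝ (Fin k) => p.2 α) :=
  (EuclideanSpace.proj α : EuclideanSpace ℝ (Fin k) →L[ℝ] ℝ).contMDiff.comp contMDiff_snd

lemma contMDiff_comp_fst {g : S → E} (hg : ContMDiff (𝓡 2) 𝓘(ℝ, E) ∞ g) :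
    ContMDiff ((𝓡 2).prod (𝓡 k)) 𝓘(ℝ, E) ∞ (fun p : S × EuclideanSpace ℝ (Fin k) => g p.1) :=
  hg.comp contMDiff_fst

variable [IsManifold (𝓡 2) ∞ S]

section

variable {T : E → Submodule ℝ E} {z : S → E} {b : Fin k → S → E}

omit [IsManifold (𝓡 2) ∞ S] in
lemma contMDiff_generated (hz : ContMDiff (𝓡 2) 𝓘(ℝ, E) ∞ z)
    (hb : ∀ α, ContMDiff (𝓡 2) 𝓘(ℝ, E) ∞ (b α)) :
    ContMDiff ((𝓡 2).prod (𝓡 k)) 𝓘(ℝ, E) ∞ (generated z b) :=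
  (contMDiff_comp_fst hz).add
    (contMDiff_finsetSum fun α _ => (contMDiff_coord α).smul (contMDiff_comp_fst (hb α)))

lemma dif_generated (hz : ContMDiff (𝓡 2) 𝓘(ℝ, E) ∞ z)
    (hb : ∀ α, ContMDiff (𝓡 2) 𝓘(ℝ, E) ∞ (b α)) (p : S × EuclideanSpace ℝ (Fin k))
    (V : TangentSpace ((𝓡 2).prod (𝓡 k)) p) :
    dif ((𝓡 2).prod (𝓡 k)) (generated z b) p V = dif (𝓡 2) z p.1 (tangentFst p V) +
      ∑ α, (tangentSnd p V α • b α p.1 + p.2 α • dif (𝓡 2) (b α) p.1 (tangentFst p V)) := by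
  have h1 : ∀ α, ContMDiff ((𝓡 2).prod (𝓡 k)) 𝓘(ℝ, E) ∞
      (fun p : S × EuclideanSpace ℝ (Fin k) => p.2 α • b α p.1) :=
    fun α => (contMDiff_coord α).smul (contMDiff_comp_fst (hb α))
  change dif ((𝓡 2).prod (𝓡 k)) (fun p : S × EuclideanSpace ℝ (Fin k) =>
    z p.1 + ∑ α, p.2 α • b α p.1) p V = _
  rw [dif_add (contMDiff_comp_fst hz) (contMDiff_finsetSum fun α _ => h1 α), dif_sum _ h1,
    dif_comp_fst (hz.contMDiffAt.mdifferentiableAt (by simp))]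
  congr 1
  refine Finset.sum_congr rfl fun α _ => ?_
  rw [dif_smul (contMDiff_coord α) (contMDiff_comp_fst (hb α)), dif_coord,
    dif_comp_fst ((hb α).contMDiffAt.mdifferentiableAt (by simp))]

omit [IsManifold (𝓡 2) ∞ S] in
lemma IsNormalFrame.finrank_normalPlane (hb : IsNormalFrame T z b) (s : S) :
    Module.finrank ℝ (normalPlane T z s) = k := by
  rw [← hb.span_eq s, finrank_span_eq_card (hb.linearIndependent s), Fintype.card_fin]

omit [IsManifold (𝓡 2) ∞ S] in
lemma IsNormalFrame.exists_sum_eq (hb : IsNormalFrame T z b) {s : S} {x : E}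
    (hx : x ∈ normalPlane T z s) : ∃ u : EuclideanSpace ℝ (Fin k), ∑ α, u α • b α s = x := by
  rw [← hb.span_eq s, Submodule.mem_span_range_iff_exists_fun] at hx
  obtain ⟨c, hc⟩ := hx
  exact ⟨WithLp.toLp 2 c, hc⟩

omit [IsManifold (𝓡 2) ∞ S] in
lemma inner_eq_zero_of_mem_normalPlane {s : S} {x : E} (hx : x ∈ normalPlane T z s)
    (v : TangentSpace (𝓡 2) s) : (inner ℝ (dif (𝓡 2) z s v) x : ℝ) = 0 :=
  (Submodule.mem_orthogonal _ _).1 hx _ (Submodule.mem_sup_left ⟨v, rfl⟩)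

omit [IsManifold (𝓡 2) ∞ S] in
lemma IsUnitNormalOn.inner_eq_zero_of_mem_normalPlane {ξ : S → E} {V : Set S}
    (hξ : IsUnitNormalOn (𝓡 2) T z ξ V) {s : S} (hs : s ∈ V) {x : E}
    (hx : x ∈ normalPlane T z s) : (inner ℝ x (ξ s) : ℝ) = 0 := by
  rw [real_inner_comm]
  refine (Submodule.mem_orthogonal _ _).1 hx _ (Submodule.mem_sup_right ⟨hξ.mem s hs, ?_⟩)
  rw [SetLike.mem_coe, Submodule.mem_orthogonal]
  rintro _ ⟨v, rfl⟩
  exact hξ.orthogonal s hs v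

omit [IsManifold (𝓡 2) ∞ S] in
/-- The tangent plane and the normal plane meet only in zero. -/
lemma eq_zero_of_dif_eq {s : S} (hz : Function.Injective (dif (𝓡 2) z s)) {x : E}
    (hx : x ∈ normalPlane T z s) {v : TangentSpace (𝓡 2) s} (h : dif (𝓡 2) z s v = x) :
    v = 0 ∧ x = 0 := by
  have h1 := inner_eq_zero_of_mem_normalPlane hx v
  rw [h, inner_self_eq_zero] at h1
  exact ⟨hz (by rw [h, h1, map_zero]), h1⟩

end

/-- The hypersurface generated by the normal frame `b` along the surface `z` in the form
`X = a + μ (z - a) + q`, where the differentials of `μ` and `q` contribute only vectors normal to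
the surface. Then `dX = μ dz + κ` with `κ` normal, so the tangent planes of the surfaces
`{μ, q constant}` are parallel to those of `z`. -/
structure IsHomotheticForm (T : E → Submodule ℝ E) (z : S → E) (b : Fin k → S → E) (a : E)
    (μ : S × EuclideanSpace ℝ (Fin k) → ℝ) (q : S × EuclideanSpace ℝ (Fin k) → E) : Prop where
  immersion : IsImmersionOn (𝓡 2) z univ
  frame : IsNormalFrame T z b
  dim : k + 3 = Module.finrank ℝ E
  smooth_factor : ContMDiff ((𝓡 2).prod (𝓡 k)) 𝓘(ℝ, ℝ) ∞ μ
  smooth_rem : ContMDiff ((𝓡 2).prod (𝓡 k)) 𝓘(ℝ, E) ∞ q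
  eq : ∀ p, generated z b p = a + (μ p • (z p.1 - a) + q p)
  mem : ∀ p V, dif ((𝓡 2).prod (𝓡 k)) μ p V • (z p.1 - a) + dif ((𝓡 2).prod (𝓡 k)) q p V ∈
    normalPlane T z p.1
  eq_zero : ∀ p V,
    dif ((𝓡 2).prod (𝓡 k)) μ p V • (z p.1 - a) + dif ((𝓡 2).prod (𝓡 k)) q p V = 0 →
      dif ((𝓡 2).prod (𝓡 k)) μ p V = 0 ∧ dif ((𝓡 2).prod (𝓡 k)) q p V = 0
  ne_zero : ∀ s, μ (s, 0) ≠ 0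

namespace IsHomotheticForm

variable {T : E → Submodule ℝ E} {z : S → E} {b : Fin k → S → E} {a : E}
  {μ : S × EuclideanSpace ℝ (Fin k) → ℝ} {q : S × EuclideanSpace ℝ (Fin k) → E}
  {p : S × EuclideanSpace ℝ (Fin k)}

/-- The normal part `dμ • (z - a) + dq` of the differential of `a + μ (z - a) + q`. -/
def normalPart (z : S → E) (a : E) (μ : S × EuclideanSpace ℝ (Fin k) → ℝ)
    (q : S × EuclideanSpace ℝ (Fin k) → E) (p : S × EuclideanSpace ℝ (Fin k)) :
    TangentSpace ((𝓡 2).prod (𝓡 k)) p →ₗ[ℝ] E :=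
  (dif ((𝓡 2).prod (𝓡 k)) μ p).toLinearMap.smulRight (z p.1 - a) +
    (dif ((𝓡 2).prod (𝓡 k)) q p).toLinearMap

omit [IsManifold (𝓡 2) ∞ S] in
lemma normalPart_apply (V : TangentSpace ((𝓡 2).prod (𝓡 k)) p) : normalPart z a μ q p V =
    dif ((𝓡 2).prod (𝓡 k)) μ p V • (z p.1 - a) + dif ((𝓡 2).prod (𝓡 k)) q p V := rfl

omit [IsManifold (𝓡 2) ∞ S] in
lemma contMDiff_surface (h : IsHomotheticForm T z b a μ q) : ContMDiff (𝓡 2) 𝓘(ℝ, E) ∞ z :=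
  contMDiffOn_univ.1 h.immersion.smooth

omit [IsManifold (𝓡 2) ∞ S] in
lemma contMDiff_hypersurface (h : IsHomotheticForm T z b a μ q) :
    ContMDiff ((𝓡 2).prod (𝓡 k)) 𝓘(ℝ, E) ∞ (generated z b) :=
  contMDiff_generated h.contMDiff_surface h.frame.smooth

omit [IsManifold (𝓡 2) ∞ S] in
lemma dif_surface_injective (h : IsHomotheticForm T z b a μ q) (s : S) :
    Function.Injective (dif (𝓡 2) z s) := h.immersion.injective s (mem_univ s)

lemma dif_eq (h : IsHomotheticForm T z b a μ q) (V : TangentSpace ((𝓡 2).prod (𝓡 k)) p) :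
    dif ((𝓡 2).prod (𝓡 k)) (generated z b) p V =
      μ p • dif (𝓡 2) z p.1 (tangentFst p V) + normalPart z a μ q p V := by
  have h1 : ContMDiff ((𝓡 2).prod (𝓡 k)) 𝓘(ℝ, E) ∞
      (fun p : S × EuclideanSpace ℝ (Fin k) => z p.1 + -a) :=
    (contMDiff_comp_fst h.contMDiff_surface).add contMDiff_const
  have h2 : generated z b = fun p => a + (μ p • (z p.1 + -a) + q p) :=
    funext fun p => by rw [h.eq, sub_eq_add_neg]
  have h3 : ContMDiff ((𝓡 2).prod (𝓡 k)) 𝓘(ℝ, E) ∞ (fun p => μ p • (z p.1 + -a)) :=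
    h.smooth_factor.smul h1
  have h4 : ContMDiff ((𝓡 2).prod (𝓡 k)) 𝓘(ℝ, E) ∞ (fun p => μ p • (z p.1 + -a) + q p) :=
    h3.add h.smooth_rem
  rw [h2, dif_add contMDiff_const h4, dif_add h3 h.smooth_rem, dif_smul h.smooth_factor h1,
    dif_add (contMDiff_comp_fst h.contMDiff_surface) contMDiff_const, dif_const, dif_const,
    dif_comp_fst (h.contMDiff_surface.contMDiffAt.mdifferentiableAt (by simp)), normalPart_apply,
    sub_eq_add_neg, zero_add, add_zero, add_comm (dif _ μ p V • _), add_assoc]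

/-- Along the rulings the differential is the normal frame. -/
lemma dif_vertical (h : IsHomotheticForm T z b a μ q) (u : EuclideanSpace ℝ (Fin k)) :
    dif ((𝓡 2).prod (𝓡 k)) (generated z b) p (tangentMk p 0 u) = ∑ α, u α • b α p.1 := by
  rw [dif_generated h.contMDiff_surface h.frame.smooth]
  simp

/-- The rulings are mapped onto the normal plane. -/
lemma exists_vertical (h : IsHomotheticForm T z b a μ q) {x : E}
    (hx : x ∈ normalPlane T z p.1) : ∃ u : EuclideanSpace ℝ (Fin k),
      dif ((𝓡 2).prod (𝓡 k)) (generated z b) p (tangentMk p 0 u) = x := by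
  obtain ⟨u, hu⟩ := h.frame.exists_sum_eq hx
  exact ⟨u, by rw [h.dif_vertical, hu]⟩

omit [IsManifold (𝓡 2) ∞ S] in
lemma normalPart_mem (h : IsHomotheticForm T z b a μ q)
    (V : TangentSpace ((𝓡 2).prod (𝓡 k)) p) : normalPart z a μ q p V ∈ normalPlane T z p.1 :=
  h.mem p V

/-- The regular points are those with nonzero factor `μ`: at a zero of `μ` the differential has
values in the normal plane, whose dimension is too small. -/
lemma mem_regularSet_iff (h : IsHomotheticForm T z b a μ q) :
    p ∈ regularSet z b ↔ μ p ≠ 0 := by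
  constructor
  · intro hp h0
    let g : TangentSpace ((𝓡 2).prod (𝓡 k)) p →ₗ[ℝ] normalPlane T z p.1 :=
      (normalPart z a μ q p).codRestrict _ h.normalPart_mem
    have hg : Function.Injective g := by
      intro V W hVW
      refine hp ?_
      rw [h.dif_eq, h.dif_eq, h0, zero_smul, zero_smul]
      exact congrArg (fun x : normalPlane T z p.1 => (0 : E) + x) hVW
    have : FiniteDimensional ℝ (normalPlane T z p.1) := by
      rw [← h.frame.span_eq]
      exact FiniteDimensional.span_of_finite ℝ (finite_range _)
    have h1 := LinearMap.finrank_le_finrank_of_injective hg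
    rw [h.frame.finrank_normalPlane, finrank_tangentSpace, Module.finrank_prod,
      finrank_euclideanSpace_fin, finrank_euclideanSpace_fin] at h1
    omega
  · intro h0
    refine (injective_iff_map_eq_zero _).2 fun V hV => ?_
    have h1 : tangentFst p V = 0 := by
      have h2 := hV
      rw [h.dif_eq, ← map_smul, add_eq_zero_iff_eq_neg] at h2
      have h3 := (eq_zero_of_dif_eq (h.dif_surface_injective p.1)
        (Submodule.neg_mem _ (h.normalPart_mem V)) h2).1
      exact (smul_eq_zero.1 h3).resolve_left h0
    rw [dif_generated h.contMDiff_surface h.frame.smooth, h1] at hV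
    simp only [map_zero, smul_zero, add_zero, zero_add] at hV
    have h2 := Fintype.linearIndependent_iff.1 (h.frame.linearIndependent p.1) _ hV
    refine tangent_ext (by rw [h1, map_zero]) ?_
    rw [map_zero]
    ext α
    exact h2 α

/-- At a regular point every tangent vector of the surface is realised by a tangent vector of the
hypersurface along which the normal part of the differential vanishes. -/
lemma exists_lift (h : IsHomotheticForm T z b a μ q) (hp : μ p ≠ 0) :
    ∃ L : TangentSpace (𝓡 2) p.1 →ₗ[ℝ] TangentSpace ((𝓡 2).prod (𝓡 k)) p,
      (∀ v, dif ((𝓡 2).prod (𝓡 k)) (generated z b) p (L v) = dif (𝓡 2) z p.1 v) ∧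
      (∀ v, tangentFst p (L v) = (μ p)⁻¹ • v) ∧
      ∀ V, normalPart z a μ q p V = 0 ↔ V ∈ LinearMap.range L := by
  have hinj : Function.Injective (dif ((𝓡 2).prod (𝓡 k)) (generated z b) p) :=
    h.mem_regularSet_iff.2 hp
  obtain ⟨g, hg⟩ := LinearMap.exists_leftInverse_of_injective
    (dif ((𝓡 2).prod (𝓡 k)) (generated z b) p).toLinearMap (LinearMap.ker_eq_bot.2 hinj)
  have hg' : ∀ V, g (dif ((𝓡 2).prod (𝓡 k)) (generated z b) p V) = V :=
    fun V => LinearMap.congr_fun hg V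
  have hL : ∀ v, dif ((𝓡 2).prod (𝓡 k)) (generated z b) p (g (dif (𝓡 2) z p.1 v)) =
      dif (𝓡 2) z p.1 v := by
    intro v
    obtain ⟨u, hu⟩ := h.exists_vertical
      (h.normalPart_mem (p := p) (tangentMk p ((μ p)⁻¹ • v) 0))
    have h1 : dif (𝓡 2) z p.1 v = dif ((𝓡 2).prod (𝓡 k)) (generated z b) p
        (tangentMk p ((μ p)⁻¹ • v) 0 - tangentMk p 0 u) := by
      rw [map_sub, hu, h.dif_eq, tangentFst_mk, map_smul, smul_smul, mul_inv_cancel₀ hp, one_smul]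
      exact (add_sub_cancel_right _ _).symm
    rw [h1, hg']
  have hsplit : ∀ v, v - μ p • tangentFst p (g (dif (𝓡 2) z p.1 v)) = 0 ∧
      normalPart z a μ q p (g (dif (𝓡 2) z p.1 v)) = 0 := by
    intro v
    refine eq_zero_of_dif_eq (h.dif_surface_injective p.1) (h.normalPart_mem _) ?_
    have h1 := hL v
    rw [h.dif_eq] at h1
    rw [map_sub, map_smul, sub_eq_iff_eq_add', h1]
  refine ⟨g ∘ₗ (dif (𝓡 2) z p.1).toLinearMap, hL, fun v => ?_, fun V => ⟨fun hV => ?_, ?_⟩⟩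
  · have h1 := sub_eq_zero.1 (hsplit v).1
    change tangentFst p (g (dif (𝓡 2) z p.1 v)) = (μ p)⁻¹ • v
    rw [eq_inv_smul_iff₀ hp]
    exact h1.symm
  · refine ⟨μ p • tangentFst p V, hinj ?_⟩
    change dif _ _ _ (g (dif (𝓡 2) z p.1 _)) = _
    rw [hL, h.dif_eq, hV, add_zero, map_smul]
  · rintro ⟨v, rfl⟩
    exact (hsplit v).2

omit [IsManifold (𝓡 2) ∞ S] in
lemma normalPart_eq_zero_iff (h : IsHomotheticForm T z b a μ q)
    (V : TangentSpace ((𝓡 2).prod (𝓡 k)) p) : normalPart z a μ q p V = 0 ↔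
      dif ((𝓡 2).prod (𝓡 k)) μ p V = 0 ∧ dif ((𝓡 2).prod (𝓡 k)) q p V = 0 := by
  refine ⟨h.eq_zero p V, fun h1 => ?_⟩
  rw [normalPart_apply, h1.1, h1.2, zero_smul, add_zero]

/-- The unit normal of the surface is, constantly along the rulings, the unit normal of the
hypersurface. -/
lemma isUnitNormalOn (h : IsHomotheticForm T z b a μ q) {ξ : S → E} {V : Set S}
    (hξ : IsUnitNormalOn (𝓡 2) T z ξ V) :
    IsUnitNormalOn ((𝓡 2).prod (𝓡 k)) (fun _ : E => ⊤) (generated z b)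
      (fun p => ξ p.1) (Prod.fst ⁻¹' V) where
  isOpen := hξ.isOpen.preimage continuous_fst
  smooth := hξ.smooth.comp contMDiff_fst.contMDiffOn fun _ hp => hp
  norm_eq p hp := hξ.norm_eq p.1 hp
  mem _ _ := Submodule.mem_top
  orthogonal p hp W := by
    rw [h.dif_eq, inner_add_left, inner_smul_left, hξ.orthogonal p.1 hp,
      hξ.inner_eq_zero_of_mem_normalPlane hp (h.normalPart_mem W), mul_zero, add_zero]

/-- The unit normal of the surface has no normal component in its derivative, since the second
fundamental form of the hypersurface is symmetric and vanishes along the rulings. -/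
lemma inner_dif_normal (h : IsHomotheticForm T z b a μ q) {ξ : S → E} {V : Set S}
    (hξ : IsUnitNormalOn (𝓡 2) T z ξ V) {s : S} (hs : s ∈ V) (v : TangentSpace (𝓡 2) s) {x : E}
    (hx : x ∈ normalPlane T z s) : (inner ℝ (dif (𝓡 2) ξ s v) x : ℝ) = 0 := by
  have hd := (hξ.smooth.contMDiffAt (hξ.isOpen.mem_nhds hs)).mdifferentiableAt (by simp)
  let p : S × EuclideanSpace ℝ (Fin k) := (s, 0)
  obtain ⟨u, hu⟩ := h.exists_vertical (p := p) hx
  have h1 := (h.isUnitNormalOn hξ).inner_dif_comm ((𝓡 2).prod (𝓡 k)) isOpen_univ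
    (contMDiffOn_univ.2 h.contMDiff_hypersurface) (mem_univ p) hs (tangentMk p v 0)
    (tangentMk p 0 u)
  rw [hu, dif_comp_fst (p := p) hd, dif_comp_fst (p := p) hd, tangentFst_mk, tangentFst_mk,
    map_zero, inner_zero_left] at h1
  exact h1

/-- The shape operator of the hypersurface is that of the surface, scaled by `μ⁻¹` and extended by
zero to the rulings. -/
lemma exists_isShapeOperator (h : IsHomotheticForm T z b a μ q)
    {A : Module.End ℝ (TangentSpace (𝓡 2) p.1)} (hA : IsShapeOperator (𝓡 2) T z p.1 A)
    (L : TangentSpace (𝓡 2) p.1 →ₗ[ℝ] TangentSpace ((𝓡 2).prod (𝓡 k)) p)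
    (hL : ∀ v, dif ((𝓡 2).prod (𝓡 k)) (generated z b) p (L v) = dif (𝓡 2) z p.1 v) :
    IsShapeOperator ((𝓡 2).prod (𝓡 k)) (fun _ : E => ⊤) (generated z b) p
      (L ∘ₗ A ∘ₗ tangentFst p) := by
  obtain ⟨V, ξ, hpV, hξ, hA⟩ := hA
  have hd := (hξ.smooth.contMDiffAt (hξ.isOpen.mem_nhds hpV)).mdifferentiableAt (by simp)
  refine ⟨_, _, hpV, h.isUnitNormalOn hξ, fun X Y => ?_⟩
  have h1 := hA (tangentFst p X) (tangentFst p Y)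
  unfold metric at h1 ⊢
  rw [LinearMap.comp_apply, LinearMap.comp_apply, hL, dif_comp_fst hd, h.dif_eq, inner_add_right,
    inner_add_right, inner_smul_right, inner_smul_right, h1,
    inner_eq_zero_of_mem_normalPlane (h.normalPart_mem Y),
    h.inner_dif_normal hξ hpV _ (h.normalPart_mem Y)]
  ring

/-- At a regular point over a point that is not umbilical the hypersurface has two opposite nonzero
principal curvatures, whose principal directions span the kernel of the normal part. -/
lemma exists_principal [FiniteDimensional ℝ E] (h : IsHomotheticForm T z b a μ q) (hp : μ p ≠ 0)
    (hmin : IsMinimalOn (𝓡 2) T z univ) (humb : ¬ IsUmbilical (𝓡 2) T z p.1) :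
    ∃ A : Module.End ℝ (TangentSpace ((𝓡 2).prod (𝓡 k)) p),
      IsShapeOperator ((𝓡 2).prod (𝓡 k)) (fun _ : E => ⊤) (generated z b) p A ∧
      LinearMap.trace ℝ _ A = 0 ∧
      ∃ (X Y : TangentSpace ((𝓡 2).prod (𝓡 k)) p) (ν : ℝ), ν ≠ 0 ∧
        metric ((𝓡 2).prod (𝓡 k)) (generated z b) p X X = 1 ∧
        metric ((𝓡 2).prod (𝓡 k)) (generated z b) p Y Y = 1 ∧
        metric ((𝓡 2).prod (𝓡 k)) (generated z b) p X Y = 0 ∧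
        A X = ν • X ∧ A Y = (-ν) • Y ∧
        (∀ x, metric ((𝓡 2).prod (𝓡 k)) (generated z b) p x X = 0 →
          metric ((𝓡 2).prod (𝓡 k)) (generated z b) p x Y = 0 → A x = 0) ∧
        ∀ V, V ∈ Submodule.span ℝ {X, Y} ↔ normalPart z a μ q p V = 0 := by
  obtain ⟨A, hA, htr⟩ := hmin p.1 (mem_univ _)
  obtain ⟨L, hL, hL1, hker⟩ := h.exists_lift hp
  have hA' := h.exists_isShapeOperator hA L hL
  have hsymm : ∀ v w, (inner ℝ (dif (𝓡 2) z p.1 (A v)) (dif (𝓡 2) z p.1 w) : ℝ) =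
      inner ℝ (dif (𝓡 2) z p.1 v) (dif (𝓡 2) z p.1 (A w)) := by
    obtain ⟨V, ξ, hpV, hξ, h1⟩ := hA
    intro v w
    rw [real_inner_comm (dif (𝓡 2) z p.1 (A w))]
    change metric (𝓡 2) z p.1 (A v) w = metric (𝓡 2) z p.1 (A w) v
    rw [h1, h1, hξ.inner_dif_comm (𝓡 2) h.immersion.isOpen h.immersion.smooth (mem_univ _) hpV]
  have hA0 : A ≠ 0 := by
    rintro rfl
    exact humb ⟨0, 0, hA, fun v => by simp⟩
  obtain ⟨x, y, ν, hν, hx, hy, hxy, hAx, hAy, hdec⟩ := exists_eigenvectors_of_trace_eq_zero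
    (L := (dif (𝓡 2) z p.1).toLinearMap) (h.dif_surface_injective p.1)
    (by rw [finrank_tangentSpace, finrank_euclideanSpace_fin]) hsymm htr hA0
  have hcomp : (A ∘ₗ tangentFst p) ∘ₗ L = (μ p)⁻¹ • A := by
    ext v
    rw [LinearMap.comp_apply, LinearMap.comp_apply, hL1, map_smul, LinearMap.smul_apply]
  have heig : ∀ v, (L ∘ₗ A ∘ₗ tangentFst p) (L v) = (μ p)⁻¹ • L (A v) := by
    intro v
    rw [LinearMap.comp_apply, LinearMap.comp_apply, hL1, map_smul, map_smul]
  have hmet : ∀ V v, metric ((𝓡 2).prod (𝓡 k)) (generated z b) p V (L v) =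
      μ p * inner ℝ (dif (𝓡 2) z p.1 (tangentFst p V)) (dif (𝓡 2) z p.1 v) := by
    intro V v
    unfold metric
    rw [hL, h.dif_eq, inner_add_left, inner_smul_left,
      real_inner_comm (dif (𝓡 2) z p.1 v) (normalPart z a μ q p V),
      inner_eq_zero_of_mem_normalPlane (h.normalPart_mem V), add_zero]
    rfl
  refine ⟨_, hA', ?_, L x, L y, (μ p)⁻¹ * ν, mul_ne_zero (inv_ne_zero hp) hν, ?_, ?_, ?_, ?_, ?_,
    fun V h1 h2 => ?_, fun V => ?_⟩
  · rw [LinearMap.trace_comp_comm', hcomp, map_smul, htr, smul_zero]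
  · unfold metric; rw [hL]; exact hx
  · unfold metric; rw [hL]; exact hy
  · unfold metric; rw [hL, hL]; exact hxy
  · rw [heig, hAx, map_smul, smul_smul]
  · rw [heig, hAy, map_smul, smul_smul, mul_neg]
  · rw [hmet] at h1 h2
    have h3 := hdec (tangentFst p V)
    change _ = (inner ℝ (dif (𝓡 2) z p.1 _) (dif (𝓡 2) z p.1 _) : ℝ) • x +
      (inner ℝ (dif (𝓡 2) z p.1 _) (dif (𝓡 2) z p.1 _) : ℝ) • y at h3
    rw [(mul_eq_zero.1 h1).resolve_left hp, (mul_eq_zero.1 h2).resolve_left hp, zero_smul,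
      zero_smul, add_zero] at h3
    rw [LinearMap.comp_apply, LinearMap.comp_apply, h3, map_zero, map_zero]
  · rw [hker, Submodule.mem_span_pair]
    constructor
    · rintro ⟨c, d, rfl⟩
      exact ⟨c • x + d • y, by rw [map_add, map_smul, map_smul]⟩
    · rintro ⟨v, rfl⟩
      exact ⟨_, _, (by rw [← map_smul, ← map_smul, ← map_add]; exact congrArg L (hdec v).symm)⟩

lemma isImmersionOn (h : IsHomotheticForm T z b a μ q) :
    IsImmersionOn ((𝓡 2).prod (𝓡 k)) (generated z b) (regularSet z b) where
  isOpen := by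
    have : regularSet z b = {p | μ p ≠ 0} := Set.ext fun p => h.mem_regularSet_iff
    rw [this]
    exact isOpen_ne_fun h.smooth_factor.continuous continuous_const
  smooth := h.contMDiff_hypersurface.contMDiffOn
  injective _ hp := hp

omit [IsManifold (𝓡 2) ∞ S] in
lemma finrank_add_one (h : IsHomotheticForm T z b a μ q) :
    Module.finrank ℝ (EuclideanSpace ℝ (Fin 2) × EuclideanSpace ℝ (Fin k)) + 1 =
      Module.finrank ℝ E := by
  rw [Module.finrank_prod, finrank_euclideanSpace_fin, finrank_euclideanSpace_fin, ← h.dim]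
  ring

/-- The distribution `Δ` consists of the directions in which both `μ` and `q` are constant. -/
lemma mem_distr_iff [FiniteDimensional ℝ E] (h : IsHomotheticForm T z b a μ q) (hp : μ p ≠ 0)
    (hmin : IsMinimalOn (𝓡 2) T z univ) (humb : ¬ IsUmbilical (𝓡 2) T z p.1)
    (V : TangentSpace ((𝓡 2).prod (𝓡 k)) p) :
    V ∈ distr ((𝓡 2).prod (𝓡 k)) (generated z b) p ↔ normalPart z a μ q p V = 0 := by
  obtain ⟨A, hA, -, X, Y, ν, hν, hX, hY, hXY, hAX, hAY, h0, hspan⟩ :=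
    h.exists_principal hp hmin humb
  rw [distr_eq_span h.isImmersionOn (h.mem_regularSet_iff.2 hp) h.finrank_add_one hA hν
    (neg_ne_zero.2 hν) hX hY hXY hAX hAY h0, hspan]

lemma isMinimalK0On [FiniteDimensional ℝ E] (h : IsHomotheticForm T z b a μ q)
    (hmin : IsMinimalOn (𝓡 2) T z univ) (humb : ∀ s, ¬ IsUmbilical (𝓡 2) T z s) :
    IsMinimalK0On ((𝓡 2).prod (𝓡 k)) (generated z b) (regularSet z b) where
  immersion := h.isImmersionOn
  codim_one := h.finrank_add_one
  type_two p hp := by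
    obtain ⟨A, hA, -, X, Y, ν, hν, hX, hY, hXY, hAX, hAY, h0, -⟩ :=
      h.exists_principal (h.mem_regularSet_iff.1 hp) hmin (humb p.1)
    exact ⟨A, hA, X, Y, ν, -ν, hX, hY, hXY, hν, neg_ne_zero.2 hν, hAX, hAY, h0⟩
  involutive O V W hO hOU hV hW hVD hWD p hp := by
    have key : ∀ p ∈ O, ∀ Z, Z ∈ distr ((𝓡 2).prod (𝓡 k)) (generated z b) p ↔
        dif ((𝓡 2).prod (𝓡 k)) μ p Z = 0 ∧ dif ((𝓡 2).prod (𝓡 k)) q p Z = 0 := by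
      intro p hp Z
      rw [h.mem_distr_iff (h.mem_regularSet_iff.1 (hOU hp)) hmin (humb p.1),
        h.normalPart_eq_zero_iff]
    have hV0 := fun p hp => (key p hp _).1 (hVD p hp)
    have hW0 := fun p hp => (key p hp _).1 (hWD p hp)
    exact (key p hp _).2
      ⟨dif_mlieBracket_eq_zero hO h.smooth_factor hV hW (fun p hp => (hV0 p hp).1)
        (fun p hp => (hW0 p hp).1) hp,
      dif_mlieBracket_eq_zero hO h.smooth_rem hV hW (fun p hp => (hV0 p hp).2)
        (fun p hp => (hW0 p hp).2) hp⟩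
  minimal p hp := by
    obtain ⟨A, hA, htr, -⟩ := h.exists_principal (h.mem_regularSet_iff.1 hp) hmin (humb p.1)
    exact ⟨A, hA, htr⟩

/-- Along `w = 0` the normal part vanishes exactly on the tangent vectors of the surface. -/
lemma normalPart_eq_zero_iff_exists (h : IsHomotheticForm T z b a μ q) (s : S)
    (V : TangentSpace ((𝓡 2).prod (𝓡 k)) (s, (0 : EuclideanSpace ℝ (Fin k)))) :
    normalPart z a μ q (s, 0) V = 0 ↔ ∃ v, tangentMk (s, 0) v 0 = V := by
  have hz : ∀ v : TangentSpace (𝓡 2) s, dif ((𝓡 2).prod (𝓡 k)) (generated z b) (s, 0)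
      (tangentMk (s, 0) v 0) = dif (𝓡 2) z s v := by
    intro v
    have h1 := dif_generated h.contMDiff_surface h.frame.smooth (s, 0) (tangentMk (s, 0) v 0)
    rw [tangentFst_mk, tangentSnd_mk] at h1
    simpa using h1
  constructor
  · intro hV
    have h1 := h.dif_eq V
    rw [hV, add_zero, ← map_smul, ← hz] at h1
    exact ⟨_, ((h.mem_regularSet_iff.2 (h.ne_zero s) : Function.Injective _) h1).symm⟩
  · rintro ⟨v, rfl⟩
    have h1 := h.dif_eq (tangentMk (s, 0) v 0)
    rw [hz, tangentFst_mk] at h1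
    have h2 : dif (𝓡 2) z s (v - μ (s, 0) • v) =
        normalPart z a μ q (s, 0) (tangentMk (s, 0) v 0) := by
      rw [map_sub, map_smul]
      exact sub_eq_iff_eq_add'.2 h1
    have h3 : normalPart z a μ q (s, 0) (tangentMk (s, 0) v 0) ∈ normalPlane T z s :=
      h.normalPart_mem (p := (s, 0)) _
    exact (eq_zero_of_dif_eq (h.dif_surface_injective s) h3 h2).2

lemma generatesMinimalK0 [FiniteDimensional ℝ E] (h : IsHomotheticForm T z b a μ q)
    (hmin : IsMinimalOn (𝓡 2) T z univ) (humb : ∀ s, ¬ IsUmbilical (𝓡 2) T z s) :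
    GeneratesMinimalK0 z b where
  minimalK0 := h.isMinimalK0On hmin humb
  integral :=
    { smooth := contMDiff_id.prodMk contMDiff_const
      mem s := h.mem_regularSet_iff.2 (h.ne_zero s)
      injective s v w hvw := by
        rw [mfderiv_prod_left] at hvw
        exact congrArg Prod.fst hvw
      range_eq s := by
        ext V
        rw [h.mem_distr_iff (h.ne_zero s) hmin (humb s), h.normalPart_eq_zero_iff_exists s,
          mfderiv_prod_left]
        rfl }

end IsHomotheticForm

end GeneratedHypersurface

/-! ### Surfaces in an `ℝ³` and in an `S³(r)` -/

section SpaceAndSphere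

open Set

variable {S : Type*} [TopologicalSpace S] [ChartedSpace (EuclideanSpace ℝ (Fin 2)) S]
  {E : Type*} [NormedAddCommGroup E] [InnerProductSpace ℝ E] [FiniteDimensional ℝ E]
  {k : ℕ} {F : AffineSubspace ℝ E} {z : S → E} {b : Fin k → S → E}

omit [FiniteDimensional ℝ E] in
/-- When the surface is tangent to `T`, the normal plane is the orthogonal complement of `T`. -/
lemma normalPlane_eq_orthogonal {T : E → Submodule ℝ E} {s : S}
    (h : ∀ v, dif (𝓡 2) z s v ∈ T (z s)) : normalPlane T z s = (T (z s))ᗮ := by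
  have h1 : LinearMap.range (dif (𝓡 2) z s).toLinearMap ≤ T (z s) := by
    rintro _ ⟨v, rfl⟩
    exact h v
  rw [normalPlane, inf_comm, Submodule.sup_orthogonal_inf_of_hasOrthogonalProjection h1]

omit [TopologicalSpace S] [ChartedSpace (EuclideanSpace ℝ (Fin 2)) S] in
lemma exists_basis_of_finrank_eq {G : Submodule ℝ E} {m : ℕ} (hG : Module.finrank ℝ G = m) :
    ∃ e : Fin m → E, LinearIndependent ℝ e ∧ Submodule.span ℝ (range e) = G := by
  let B := Module.finBasisOfFinrankEq ℝ G hG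
  refine ⟨fun i => B i, B.linearIndependent.map' G.subtype G.ker_subtype, ?_⟩
  have : range (fun i => (B i : E)) = G.subtype '' range B := by
    rw [← range_comp]; rfl
  rw [this, ← Submodule.map_span, B.span_eq, Submodule.map_subtype_top]

variable [IsManifold (𝓡 2) ∞ S]

lemma dif_mem_direction (hz : ContMDiff (𝓡 2) 𝓘(ℝ, E) ∞ z) (hF : ∀ s, z s ∈ F) (s : S)
    (v : TangentSpace (𝓡 2) s) : dif (𝓡 2) z s v ∈ F.direction := by
  have h1 := dif_mem (G := F.direction) (g := fun t => z t + -z s) (hz.add contMDiff_const)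
    (fun t => by rw [← sub_eq_add_neg]; exact AffineSubspace.vsub_mem_direction (hF t) (hF s)) s v
  rwa [dif_add hz contMDiff_const, dif_const, add_zero] at h1

omit [FiniteDimensional ℝ E] in
/-- A surface in a sphere is orthogonal to the radius. -/
lemma inner_dif_sub_eq_zero {a : E} {r : ℝ} (hz : ContMDiff (𝓡 2) 𝓘(ℝ, E) ∞ z)
    (hr : ∀ s, dist (z s) a = r) (s : S) (v : TangentSpace (𝓡 2) s) :
    (inner ℝ (z s - a) (dif (𝓡 2) z s v) : ℝ) = 0 := by
  have hs := mem_extChartAt_source (I := 𝓡 2) s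
  have e : (fun y => (inner ℝ (z ((extChartAt (𝓡 2) s).symm y) - a)
      (z ((extChartAt (𝓡 2) s).symm y) - a) : ℝ)) = fun _ => r ^ 2 :=
    funext fun y => by rw [real_inner_self_eq_norm_sq, ← dist_eq_norm, hr]
  have hd := hz.differentiableAt_chart s
  have e2 := DFunLike.congr_fun (congrArg (fun F => fderiv ℝ F (extChartAt (𝓡 2) s s)) e)
    (chartDeriv (𝓡 2) s s v)
  rw [fderiv_inner_apply ℝ (hd.sub_const _) (hd.sub_const _), fderiv_sub_const,
    ← hz.dif_eq_fderiv_chart hs, (extChartAt (𝓡 2) s).left_inv hs] at e2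
  simp only [fderiv_fun_const, Pi.zero_apply, _root_.zero_apply] at e2
  rw [real_inner_comm (z s - a)] at e2
  linarith

namespace IsMinimalInSpace

omit [FiniteDimensional ℝ E] [IsManifold (𝓡 2) ∞ S] in
lemma contMDiff (h : IsMinimalInSpace F z) : ContMDiff (𝓡 2) 𝓘(ℝ, E) ∞ z :=
  contMDiffOn_univ.1 h.immersion.smooth

lemma normalPlane_eq (h : IsMinimalInSpace F z) (s : S) :
    normalPlane (spaceTangent F) z s = F.directionᗮ :=
  normalPlane_eq_orthogonal (dif_mem_direction h.contMDiff h.mem s)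

/-- The normal plane is constant, so a constant basis is a frame. -/
lemma exists_frame (h : IsMinimalInSpace F z) (hk : k + 3 = Module.finrank ℝ E) :
    ∃ b : Fin k → S → E, IsNormalFrame (spaceTangent F) z b := by
  have h1 : Module.finrank ℝ F.directionᗮ = k := by
    have := F.direction.finrank_add_finrank_orthogonal
    rw [h.dim] at this
    omega
  obtain ⟨e, he, hs⟩ := exists_basis_of_finrank_eq h1
  exact ⟨fun α _ => e α, fun _ => contMDiff_const, fun _ => he,
    fun s => by rw [h.normalPlane_eq, hs]⟩

/-- Over a surface in an `ℝ³` the hypersurface is the cylinder `z + q`, where `q` is orthogonal to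
the `ℝ³`. -/
lemma isHomotheticForm (h : IsMinimalInSpace F z) (hk : k + 3 = Module.finrank ℝ E)
    (hb : IsNormalFrame (spaceTangent F) z b) :
    IsHomotheticForm (spaceTangent F) z b 0 (fun _ => 1) (fun p => ∑ α, p.2 α • b α p.1) := by
  have hq : ContMDiff ((𝓡 2).prod (𝓡 k)) 𝓘(ℝ, E) ∞
      (fun p : S × EuclideanSpace ℝ (Fin k) => ∑ α, p.2 α • b α p.1) :=
    contMDiff_finsetSum fun α _ => (contMDiff_coord α).smul (contMDiff_comp_fst (hb.smooth α))
  refine ⟨h.immersion, hb, hk, contMDiff_const, hq, fun p => ?_, fun p V => ?_, fun p V hV => ?_,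
    fun _ => one_ne_zero⟩
  · simp [generated]
  · rw [dif_const, zero_smul, zero_add, h.normalPlane_eq]
    refine dif_mem hq (fun p => Submodule.sum_mem _ fun α _ => Submodule.smul_mem _ _ ?_) p V
    rw [← h.normalPlane_eq p.1, ← hb.span_eq p.1]
    exact Submodule.subset_span ⟨α, rfl⟩
  · rw [dif_const, zero_smul, zero_add] at hV
    exact ⟨dif_const _ _ _, hV⟩

end IsMinimalInSpace

namespace IsMinimalInSphere

variable {a : E} {r : ℝ}

omit [FiniteDimensional ℝ E] [IsManifold (𝓡 2) ∞ S] in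
lemma contMDiff (h : IsMinimalInSphere F a r z) : ContMDiff (𝓡 2) 𝓘(ℝ, E) ∞ z :=
  contMDiffOn_univ.1 h.immersion.smooth

omit [FiniteDimensional ℝ E] [IsManifold (𝓡 2) ∞ S] in
lemma sub_mem_direction (h : IsMinimalInSphere F a r z) (s : S) : z s - a ∈ F.direction :=
  AffineSubspace.vsub_mem_direction (h.mem s) h.center_mem

omit [FiniteDimensional ℝ E] [IsManifold (𝓡 2) ∞ S] in
lemma inner_self_eq (h : IsMinimalInSphere F a r z) (s : S) :
    (inner ℝ (z s - a) (z s - a) : ℝ) = r ^ 2 := by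
  rw [real_inner_self_eq_norm_sq, ← dist_eq_norm, h.dist_eq]

lemma normalPlane_eq (h : IsMinimalInSphere F a r z) (s : S) :
    normalPlane (sphereTangent F a) z s = F.directionᗮ ⊔ Submodule.span ℝ {z s - a} := by
  have hT : ∀ v, dif (𝓡 2) z s v ∈ sphereTangent F a (z s) := fun v =>
    ⟨dif_mem_direction h.contMDiff h.mem s v, Submodule.mem_orthogonal_singleton_iff_inner_right.2
      (inner_dif_sub_eq_zero h.contMDiff h.dist_eq s v)⟩
  rw [normalPlane_eq_orthogonal hT]
  rw [sphereTangent, ← Submodule.orthogonal_orthogonal (F.directionᗮ ⊔ _),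
    ← Submodule.inf_orthogonal, Submodule.orthogonal_orthogonal]

/-- The radius vector and a constant basis of the orthogonal complement of the `ℝ⁴` form a frame. -/
lemma exists_frame (h : IsMinimalInSphere F a r z) (hk : k + 3 = Module.finrank ℝ E) :
    ∃ b : Fin k → S → E, IsNormalFrame (sphereTangent F a) z b := by
  have h1 := F.direction.finrank_add_finrank_orthogonal
  rw [h.dim] at h1
  -- an ambient space that contains an `ℝ⁴` leaves room for the radius vector in the frame
  obtain ⟨m, rfl⟩ : ∃ m, k = m + 1 := ⟨k - 1, by omega⟩
  obtain ⟨e, he, hs⟩ := exists_basis_of_finrank_eq (m := m) (G := F.directionᗮ) (by omega)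
  refine ⟨Fin.cons (fun s => z s - a) fun α _ => e α, fun α => ?_, fun s => ?_, fun s => ?_⟩
  · refine Fin.cases ?_ (fun α => ?_) α
    · exact h.contMDiff.sub contMDiff_const
    · exact contMDiff_const
  all_goals
    have hc : (fun α => (Fin.cons (fun s => z s - a) (fun α _ => e α) : Fin (m + 1) → S → E) α s) =
        Fin.cons (z s - a) e := by
      funext α
      refine Fin.cases ?_ (fun α => ?_) α <;> rfl
    rw [hc]
  · rw [linearIndependent_finCons]
    refine ⟨he, fun hmem => ?_⟩
    rw [hs] at hmem
    have h2 := (Submodule.mem_orthogonal _ _).1 hmem _ (h.sub_mem_direction s)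
    rw [h.inner_self_eq] at h2
    exact pow_ne_zero 2 h.radius_pos.ne' h2
  · rw [Fin.range_cons, Submodule.span_insert, hs, h.normalPlane_eq, sup_comm]

/-- Over a surface in a sphere the hypersurface is `a + μ (z - a) + q`, where `q` is orthogonal to
the `ℝ⁴` of the sphere. -/
lemma isHomotheticForm (h : IsMinimalInSphere F a r z) (hk : k + 3 = Module.finrank ℝ E)
    (hb : IsNormalFrame (sphereTangent F a) z b) :
    IsHomotheticForm (sphereTangent F a) z b a
      (fun p => (r ^ 2)⁻¹ * inner ℝ (generated z b p - a) (z p.1 - a))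
      (fun p => generated z b p - a -
        ((r ^ 2)⁻¹ * inner ℝ (generated z b p - a) (z p.1 - a)) • (z p.1 - a)) := by
  have hr : r ^ 2 ≠ 0 := pow_ne_zero 2 h.radius_pos.ne'
  have hX := contMDiff_generated h.contMDiff hb.smooth
  have hza : ContMDiff ((𝓡 2).prod (𝓡 k)) 𝓘(ℝ, E) ∞
      (fun p : S × EuclideanSpace ℝ (Fin k) => z p.1 - a) :=
    (contMDiff_comp_fst h.contMDiff).sub contMDiff_const
  have hμ : ContMDiff ((𝓡 2).prod (𝓡 k)) 𝓘(ℝ, ℝ) ∞ (fun p : S × EuclideanSpace ℝ (Fin k) =>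
      (r ^ 2)⁻¹ * (inner ℝ (generated z b p - a) (z p.1 - a) : ℝ)) :=
    contMDiff_const.mul ((contDiff_inner (𝕜 := ℝ)).comp_contMDiff
      ((hX.sub contMDiff_const).prodMk_space hza))
  have hq : ContMDiff ((𝓡 2).prod (𝓡 k)) 𝓘(ℝ, E) ∞ (fun p => generated z b p - a -
        ((r ^ 2)⁻¹ * (inner ℝ (generated z b p - a) (z p.1 - a) : ℝ)) • (z p.1 - a)) :=
    (hX.sub contMDiff_const).sub (hμ.smul hza)
  have hqmem : ∀ p : S × EuclideanSpace ℝ (Fin k), generated z b p - a -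
      ((r ^ 2)⁻¹ * (inner ℝ (generated z b p - a) (z p.1 - a) : ℝ)) • (z p.1 - a) ∈
        F.directionᗮ := by
    intro p
    have h1 : ∑ α, p.2 α • b α p.1 ∈ normalPlane (sphereTangent F a) z p.1 := by
      rw [← hb.span_eq p.1]
      exact Submodule.sum_mem _ fun α _ => Submodule.smul_mem _ _ (Submodule.subset_span ⟨α, rfl⟩)
    rw [h.normalPlane_eq, Submodule.mem_sup] at h1
    obtain ⟨d, hd, x, hx, hdx⟩ := h1
    obtain ⟨c, rfl⟩ := Submodule.mem_span_singleton.1 hx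
    have h2 : generated z b p - a = (1 + c) • (z p.1 - a) + d := by
      change z p.1 + ∑ α, p.2 α • b α p.1 - a = _
      rw [← hdx, add_smul, one_smul]
      abel
    have h3 : (inner ℝ d (z p.1 - a) : ℝ) = 0 := by
      rw [real_inner_comm]
      exact (Submodule.mem_orthogonal _ _).1 hd _ (h.sub_mem_direction _)
    -- the factor `μ` is the coefficient of `z - a` in the splitting of `X - a`
    have h4 : (r ^ 2)⁻¹ * (inner ℝ (generated z b p - a) (z p.1 - a) : ℝ) = 1 + c := by
      rw [h2, inner_add_left, inner_smul_left, h3, h.inner_self_eq, add_zero]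
      exact (mul_comm _ _).trans (mul_inv_cancel_right₀ hr _)
    rw [h4, h2, add_sub_cancel_left]
    exact hd
  refine ⟨h.immersion, hb, hk, hμ, hq, fun p => ?_, fun p V => ?_, fun p V hV => ?_, fun s => ?_⟩
  · abel
  · rw [h.normalPlane_eq, add_comm]
    exact Submodule.add_mem_sup (dif_mem hq hqmem p V)
      (Submodule.smul_mem _ _ (Submodule.mem_span_singleton_self _))
  · have h1 := congrArg (fun x => (inner ℝ (z p.1 - a) x : ℝ)) hV
    simp only [inner_add_right, inner_smul_right, h.inner_self_eq, inner_zero_right] at h1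
    rw [(Submodule.mem_orthogonal _ _).1 (dif_mem hq hqmem p V) _ (h.sub_mem_direction _), add_zero]
      at h1
    have h2 := (mul_eq_zero.1 h1).resolve_right hr
    rw [h2, zero_smul, zero_add] at hV
    exact ⟨h2, hV⟩
  · have h1 : generated z b (s, 0) = z s := by simp [generated]
    rw [h1, h.inner_self_eq, inv_mul_cancel₀ hr]
    exact one_ne_zero

end IsMinimalInSphere

end SpaceAndSphere

end ConullityTwo

end

theorem theorem3p2 (n : ℕ) (hn : 3 ≤ n) :
    -- every connected integral surface of `Δ` is a minimal surface in an `ℝ³` or in an `S³(r)`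
    (∀ (M : Type*) [TopologicalSpace M] [ChartedSpace (EuclideanSpace ℝ (Fin n)) M]
        [IsManifold (𝓡 n) ∞ M] (f : M → ConullityTwo.Amb n),
      ConullityTwo.IsMinimalK0On (𝓡 n) f Set.univ →
      ∀ (S : Type*) [TopologicalSpace S] [ChartedSpace (EuclideanSpace ℝ (Fin 2)) S]
        [IsManifold (𝓡 2) ∞ S] [ConnectedSpace S] (j : S → M),
      ConullityTwo.IsIntegralSurface (𝓡 n) (ConullityTwo.distr (𝓡 n) f) Set.univ j →
        (∃ F : AffineSubspace ℝ (ConullityTwo.Amb n),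
          ConullityTwo.IsMinimalInSpace F (f ∘ j)) ∨
        (∃ (F : AffineSubspace ℝ (ConullityTwo.Amb n)) (a : ConullityTwo.Amb n) (r : ℝ),
          ConullityTwo.IsMinimalInSphere F a r (f ∘ j))) ∧
    -- the converse
    (∀ (S : Type*) [TopologicalSpace S] [ChartedSpace (EuclideanSpace ℝ (Fin 2)) S]
        [IsManifold (𝓡 2) ∞ S] (z : S → ConullityTwo.Amb n),
      -- surfaces in an `ℝ³`
      (∀ F : AffineSubspace ℝ (ConullityTwo.Amb n),
        ConullityTwo.IsMinimalInSpace F z →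
        (∀ s, ¬ ConullityTwo.IsUmbilical (𝓡 2) (ConullityTwo.spaceTangent F) z s) →
        (∃ b : Fin (n - 2) → S → ConullityTwo.Amb n,
          ConullityTwo.IsNormalFrame (ConullityTwo.spaceTangent F) z b) ∧
        ∀ b : Fin (n - 2) → S → ConullityTwo.Amb n,
          ConullityTwo.IsNormalFrame (ConullityTwo.spaceTangent F) z b →
          ConullityTwo.GeneratesMinimalK0 z b ∧
          ConullityTwo.regularSet z b = Set.univ) ∧
      -- surfaces in an `S³(r)`
      (∀ (F : AffineSubspace ℝ (ConullityTwo.Amb n)) (a : ConullityTwo.Amb n) (r : ℝ),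
        ConullityTwo.IsMinimalInSphere F a r z →
        (∀ s, ¬ ConullityTwo.IsUmbilical (𝓡 2) (ConullityTwo.sphereTangent F a) z s) →
        (∃ b : Fin (n - 2) → S → ConullityTwo.Amb n,
          ConullityTwo.IsNormalFrame (ConullityTwo.sphereTangent F a) z b) ∧
        ∀ b : Fin (n - 2) → S → ConullityTwo.Amb n,
          ConullityTwo.IsNormalFrame (ConullityTwo.sphereTangent F a) z b →
          ConullityTwo.GeneratesMinimalK0 z b ∧
          ConullityTwo.regularSet z b =
            {p | inner ℝ (ConullityTwo.generated z b p - a) (z p.1 - a) ≠ 0})) := by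
  have hE : n - 2 + 3 = Module.finrank ℝ (ConullityTwo.Amb n) := by
    rw [finrank_euclideanSpace_fin]
    omega
  refine ⟨fun M _ _ _ f hf S _ _ _ _ j hj => hj.isMinimalInSpace_or_isMinimalInSphere hf,
    fun S _ _ _ z => ⟨fun F hz humb => ⟨hz.exists_frame hE, fun b hb => ?_⟩,
      fun F a r hz humb => ⟨hz.exists_frame hE, fun b hb => ?_⟩⟩⟩
  · have h := hz.isHomotheticForm hE hb
    exact ⟨h.generatesMinimalK0 hz.minimal humb,
      Set.eq_univ_of_forall fun p => h.mem_regularSet_iff.2 one_ne_zero⟩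
  · have h := hz.isHomotheticForm hE hb
    refine ⟨h.generatesMinimalK0 hz.minimal humb, Set.ext fun p => h.mem_regularSet_iff.trans ?_⟩
    rw [mul_ne_zero_iff]
    exact and_iff_right (inv_ne_zero (pow_ne_zero 2 hz.radius_pos.ne'))
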